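/- Let $d\in\mathbb N$, let $\alpha,\beta<0$, and let $f\in\mathcal C^\alpha_{\mathrm{loc}}(\mathbb R^d)$ and $g\in\mathcal C^\beta_{\mathrm{loc}}(\mathbb R^d)$ be (complex-valued) distributions with $\operatorname{singsupp}(f)\cap\operatorname{singsupp}(g)=\emptyset$. Then there exists a unique canonical product $f\cdot g\in\mathcal D'(\mathbb R^d)$, and $f\cdot g\in\mathcal C^{\alpha+\beta}_{\mathrm{loc}}(\mathbb R^d)$. Here the following definitions are used. For $\gamma<0$ let $r_\gamma$ be the smallest integer strictly larger than $-\gamma$. The space $\mathcal C^\gamma_{\mathrm{loc}}(\mathbb R^d)$ consists of all $u\in\mathcal D'(\mathbb R^d)$ such that for every compact $K\subset\mathbb R^d$ there is a constant $C$ with $|u(\varphi^\lambda_x)|\le C\lambda^\gamma$ for all $x\in K$, $\lambda\in(0,1]$ and all test functions $\varphi\in\mathcal D(B(0,1))$ with $\|\varphi\|_{C^{r_\gamma}}\le 1$, where $\varphi^\lambda_x(y)=\lambda^{-d}\varphi\big(\tfrac{x-y}{\lambda}\big)$. A point $x$ is outside $\operatorname{singsupp}(u)$ if and only if $u$ coincides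 with a smooth function on some open neighbourhood of $x$. A distribution $p$ is a canonical product of $f$ and $g$ if $p=\Delta^*(f\otimes g)$, the pull-back along the diagonal map $\Delta:x\mapsto(x,x)$ of the distribution $f\otimes g\in\mathcal D'(\mathbb R^d\times\mathbb R^d)$ determined by $(f\otimes g)(\varphi\otimes\psi)=f(\varphi)g(\psi)$. The pull-back is understood in the sense of Hörmander: call admissible for $T\in\mathcal D'(\mathbb R^d\times\mathbb R^d)$ a closed conic subset $\Gamma$ of $(\mathbb R^d\times\mathbb R^d)\times(\mathbb R^{2d}\setminus\{0\})$ which contains the smooth wave front set $\mathrm{WF}(T)$ and contains no conormal $((x,x),(\xi,-\xi))$ of the diagonal. Let $\mathcal D'_\Gamma$ be the space of distributions with wave front set in $\Gamma$; $T_j\to T$ in $\mathcal D'_\Gamma$ means that $T_j\to T$ weakly and that $\sup_{\xi\in V}|\xi|^N|\widehat{\varphi T_j}(\xi)-\widehat{\varphi T}(\xi)|\to0$ for every $N\in\mathbb N$, every test function $\varphi$ and every closed cone $V$ with $\Gamma\cap(\operatorname{supp}\varphi\times V)=\emptyset$. Then $p=\Delta^*T$ means that $T$ is, for some admissible $\Gamma$,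 the limit in $\mathcal D'_\Gamma$ of a sequence of smooth functions and that, for every admissible $\Gamma$ and every sequence of smooth functions $w_j$ converging to $T$ in $\mathcal D'_\Gamma$, the functions $x\mapsto w_j(x,x)$ converge to $p$ in $\mathcal D'(\mathbb R^d)$. -/

import Mathlib

open scoped Distributions ContDiff Topology

namespace HolderProduct

noncomputable section

/-- Real test functions on the whole space `F`. -/
abbrev Test (F : Type*) [NormedAddCommGroup F] [NormedSpace ℝ F] :=
  𝓓((⊤ : TopologicalSpace.Opens F), ℝ)

/-- Complex-valued distributions on the whole space `F`. -/
abbrev Distr (F : Type*) [NormedAddCommGroup F] [NormedSpace ℝ F] :=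
  𝓓'((⊤ : TopologicalSpace.Opens F), ℂ)

section General

variable {F : Type*} [NormedAddCommGroup F] [NormedSpace ℝ F]

/-- The test function `φ · a`, for `a` smooth. -/
def mulSmooth (φ : Test F) (a : F → ℝ) (ha : ContDiff ℝ ∞ a) : Test F where
  toFun x := φ x * a x
  contDiff' := φ.contDiff.mul ha
  hasCompactSupport' := φ.hasCompactSupport.mul_right
  tsupport_subset' := fun _ _ => trivial

theorem contDiff_cos_clm (ξ : F →L[ℝ] ℝ) : ContDiff ℝ ∞ (fun x => Real.cos (ξ x)) :=
  Real.contDiff_cos.comp ξ.contDiff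

theorem contDiff_sin_clm (ξ : F →L[ℝ] ℝ) : ContDiff ℝ ∞ (fun x => Real.sin (ξ x)) :=
  Real.contDiff_sin.comp ξ.contDiff

/-- The Fourier transform of the compactly supported distribution `φ u` at the covector `ξ`,
i.e. `u` applied to `x ↦ φ x * exp (- i ξ x) = φ x * cos (ξ x) - i φ x * sin (ξ x)`. -/
def localFourier (u : Distr F) (φ : Test F) (ξ : F →L[ℝ] ℝ) : ℂ :=
  u (mulSmooth φ (fun x => Real.cos (ξ x)) (contDiff_cos_clm ξ))
    - Complex.I * u (mulSmooth φ (fun x => Real.sin (ξ x)) (contDiff_sin_clm ξ))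

/-- A set of covectors is conic if it is stable under multiplication by positive scalars. -/
def IsConic (V : Set (F →L[ℝ] ℝ)) : Prop :=
  ∀ ξ ∈ V, ∀ t : ℝ, 0 < t → t • ξ ∈ V

/-- The smooth wave front set, a subset of the cotangent space with the zero section removed. -/
def waveFrontSet (u : Distr F) : Set (F × (F →L[ℝ] ℝ)) :=
  {p | p.2 ≠ 0 ∧ ¬ ∃ φ : Test F, φ p.1 ≠ 0 ∧
    ∃ V : Set (F →L[ℝ] ℝ), IsOpen V ∧ IsConic V ∧ p.2 ∈ V ∧
      ∀ N : ℕ, ∃ C : ℝ, ∀ ξ ∈ V, (1 + ‖ξ‖) ^ N * ‖localFourier u φ ξ‖ ≤ C}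

/-- `Γ` is a closed conic subset of the cotangent space with the zero section removed
(closed relative to the complement of the zero section). -/
structure IsClosedCone (Γ : Set (F × (F →L[ℝ] ℝ))) : Prop where
  ne_zero : ∀ p ∈ Γ, p.2 ≠ 0
  conic : ∀ p ∈ Γ, ∀ t : ℝ, 0 < t → (p.1, t • p.2) ∈ Γ
  closed : IsClosed (Γ ∪ {p | p.2 = 0})

/-- Convergence `U j → u` in the space `𝓓'_Γ` of distributions with wave front set in `Γ`:
convergence as distributions, and, for every test function `φ` and every closed cone `V` such that
`Γ` does not meet `supp φ × V`, convergence of the Fourier transforms of `φ U j` to that of `φ u`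
on `V`, uniformly with respect to any polynomial weight. -/
structure TendstoIn (Γ : Set (F × (F →L[ℝ] ℝ))) (U : ℕ → Distr F) (u : Distr F) : Prop where
  mem_seq : ∀ j, waveFrontSet (U j) ⊆ Γ
  mem_limit : waveFrontSet u ⊆ Γ
  weak : ∀ φ : Test F, Filter.Tendsto (fun j => U j φ) Filter.atTop (𝓝 (u φ))
  fourier : ∀ (φ : Test F) (V : Set (F →L[ℝ] ℝ)), IsClosed V → IsConic V →
    Disjoint Γ (tsupport φ ×ˢ V) →
    ∀ (N : ℕ) (ε : ℝ), 0 < ε → ∀ᶠ j in Filter.atTop, ∀ ξ ∈ V,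
      ‖ξ‖ ^ N * ‖localFourier (U j) φ ξ - localFourier u φ ξ‖ ≤ ε

/-- The tensor product of two real test functions. -/
def tensorTest (φ ψ : Test F) : Test (F × F) where
  toFun z := φ z.1 * ψ z.2
  contDiff' := (φ.contDiff.comp contDiff_fst).mul (ψ.contDiff.comp contDiff_snd)
  hasCompactSupport' := by
    refine HasCompactSupport.intro (φ.hasCompactSupport.isCompact.prod
      ψ.hasCompactSupport.isCompact) ?_
    intro z hz
    by_cases h1 : z.1 ∈ tsupport φ
    · have h2 : z.2 ∉ tsupport ψ := fun h2 => hz ⟨h1, h2⟩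
      simp [image_eq_zero_of_notMem_tsupport h2]
    · simp [image_eq_zero_of_notMem_tsupport h1]
  tsupport_subset' := fun _ _ => trivial

/-- `T` is the tensor product `f ⊗ g`: the distribution on `F × F` with
`T (φ ⊗ ψ) = f φ * g ψ` for all test functions `φ`, `ψ`. -/
def IsTensorProduct (f g : Distr F) (T : Distr (F × F)) : Prop :=
  ∀ φ ψ : Test F, T (tensorTest φ ψ) = f φ * g ψ

/-- The conormal bundle of the diagonal map `x ↦ (x, x)`, without the zero section. -/
def diagonalConormal : Set ((F × F) × (F × F →L[ℝ] ℝ)) :=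
  {p | p.1.1 = p.1.2 ∧ p.2 ≠ 0 ∧ ∀ v : F, p.2 (v, v) = 0}

end General

section Measure

variable {F : Type*} [NormedAddCommGroup F] [NormedSpace ℝ F] [MeasureTheory.MeasureSpace F]
  [BorelSpace F]

/-- The distribution `φ ↦ ∫ φ w` defined by a (locally integrable) function `w`. -/
def ofFunction (w : F → ℂ) : Distr F :=
  ContinuousLinearMap.toUniformConvergenceCLM (RingHom.id ℝ) ℂ
    {S : Set (Test F) | IsCompact S}
    (TestFunction.integralAgainstBilinCLM (ContinuousLinearMap.lsmul ℝ ℝ)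
      MeasureTheory.volume w)

theorem ofFunction_apply
    [MeasureTheory.IsLocallyFiniteMeasure (MeasureTheory.volume : MeasureTheory.Measure F)]
    {w : F → ℂ} (hw : Continuous w) (φ : Test F) :
    ofFunction w φ = ∫ x, φ x • w x := by
  have h : MeasureTheory.LocallyIntegrableOn w ((⊤ : TopologicalSpace.Opens F) : Set F) :=
    hw.locallyIntegrable.locallyIntegrableOn _
  exact TestFunction.integralAgainstBilinCLM_eq_integral (B := ContinuousLinearMap.lsmul ℝ ℝ) h

variable [SecondCountableTopology F]

/-- The singular support: `x` is outside it iff `u` is given by a smooth function near `x`. -/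
def singularSupport (u : Distr F) : Set F :=
  {x | ¬ ∃ U : Set F, IsOpen U ∧ x ∈ U ∧ ∃ a : F → ℂ, ContDiffOn ℝ ∞ a U ∧
    ∀ φ : Test F, tsupport φ ⊆ U → u φ = ∫ y, φ y • a y}

/-- The closed cones `Γ` for which the pull-back along the diagonal map is defined on `𝓓'_Γ`,
and such that `T` lies in `𝓓'_Γ`. -/
def IsAdmissible (T : Distr (F × F)) (Γ : Set ((F × F) × (F × F →L[ℝ] ℝ))) : Prop :=
  IsClosedCone Γ ∧ Disjoint Γ diagonalConormal ∧ waveFrontSet T ⊆ Γ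

/-- `p` is the pull-back of `T` along the diagonal map `Δ x = (x, x)`, i.e. the value at `T` of the
sequentially continuous extension to the spaces `𝓓'_Γ` of the map `w ↦ w ∘ Δ` on smooth functions:
`T` is, for an admissible `Γ`, a limit in `𝓓'_Γ` of smooth functions, and whenever smooth functions
`w j` converge to `T` in `𝓓'_Γ`, with `Γ` admissible, then `w j ∘ Δ` converges to `p`. -/
def IsDiagonalPullback (T : Distr (F × F)) (p : Distr F) : Prop :=
  (∃ Γ, IsAdmissible T Γ ∧ ∃ w : ℕ → F × F → ℂ, (∀ j, ContDiff ℝ ∞ (w j)) ∧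
    TendstoIn Γ (fun j => ofFunction (w j)) T) ∧
  ∀ Γ, IsAdmissible T Γ → ∀ w : ℕ → F × F → ℂ, (∀ j, ContDiff ℝ ∞ (w j)) →
    TendstoIn Γ (fun j => ofFunction (w j)) T →
    ∀ φ : Test F, Filter.Tendsto (fun j => ofFunction (fun x => w j (x, x)) φ)
      Filter.atTop (𝓝 (p φ))

/-- `p` is the canonical product of `f` and `g`: the pull-back of `f ⊗ g` along the diagonal. -/
def IsCanonicalProduct (f g p : Distr F) : Prop :=
  ∃ T : Distr (F × F), IsTensorProduct f g T ∧ IsDiagonalPullback T p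

end Measure

section Holder

variable {d : ℕ}

/-- The test function `y ↦ lam ^ (-d) * φ ((x - y) / lam)`. -/
def rescale (φ : Test (EuclideanSpace ℝ (Fin d))) (x : EuclideanSpace ℝ (Fin d))
    (lam : ℝ) (hlam : 0 < lam) : Test (EuclideanSpace ℝ (Fin d)) where
  toFun y := (lam ^ d)⁻¹ * φ (lam⁻¹ • (x - y))
  contDiff' := contDiff_const.mul
    (φ.contDiff.comp ((contDiff_const.sub contDiff_id).const_smul lam⁻¹))
  hasCompactSupport' := by
    have h := φ.hasCompactSupport.comp_homeomorph
      ((Homeomorph.subLeft x).trans (Homeomorph.smulOfNeZero lam⁻¹ (inv_ne_zero hlam.ne')))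
    exact h.mul_left (f := fun _ => (lam ^ d)⁻¹)
  tsupport_subset' := fun _ _ => trivial

/-- The largest integer strictly less than `α`. -/
def strictFloor (α : ℝ) : ℤ := ⌈α⌉ - 1

theorem strictFloor_isGreatest (α : ℝ) : IsGreatest {n : ℤ | (n : ℝ) < α} (strictFloor α) := by
  constructor
  · have := Int.ceil_lt_add_one α
    simp only [strictFloor, Set.mem_ofPred_eq]
    push_cast
    linarith
  · intro n hn
    have : n < ⌈α⌉ := Int.lt_ceil.2 hn
    unfold strictFloor
    omega

/-- Test functions supported in the open unit ball, with `C^r` norm at most `1`. -/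
def unitTests (d r : ℕ) : Set (Test (EuclideanSpace ℝ (Fin d))) :=
  {φ | tsupport φ ⊆ Metric.ball 0 1 ∧ ∀ i ≤ r, ∀ x, ‖iteratedFDeriv ℝ i φ x‖ ≤ 1}

/-- The local Hölder space `C^α_loc` of negative exponent `α`. -/
def negHolderLoc (d : ℕ) (α : ℝ) : Set (Distr (EuclideanSpace ℝ (Fin d))) :=
  {u | ∀ K : Set (EuclideanSpace ℝ (Fin d)), IsCompact K → ∃ C : ℝ,
    ∀ x ∈ K, ∀ (lam : ℝ) (hlam : 0 < lam), lam ≤ 1 →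
      ∀ φ ∈ unitTests d (-strictFloor α).toNat,
        ‖u (rescale φ x lam hlam)‖ ≤ C * lam ^ α}

end Holder

end

end HolderProduct

namespace HolderProduct

/-!
Every covector `(ξ, η)` of the wave front set of `f ⊗ g` at `(x, y)` has `ξ = 0` or `η = 0` unless
`x` and `y` both are singular. As the singular supports are disjoint, the closed cone given by this
condition contains no conormal `((x, x), (ξ, -ξ))` of the diagonal, and hence stays away from these
conormals locally uniformly. Mollifications of `f ⊗ g` converge to `f ⊗ g` in `𝓓'_Γ` for this cone
`Γ`, and two sequences with the same limit in some `𝓓'_Γ` have restrictions to the diagonal with the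
same limit: after Fourier inversion, the difference of the sequences decays rapidly at frequencies
close to the conormals, uniformly, and the Fourier transform of the test function on the diagonal
does at all others.

So the product is the limit of the products of the mollified factors. With a smooth cutoff which is
`0` near `singsupp f` and `1` near `singsupp g`, it has the form `m₁ g + m₂ f` with smooth `m₁` and
`m₂`, which is locally as regular as the worse factor, and in particular of class `𝓒^(α + β)`.
-/

open scoped BoundedContinuousFunction
open MeasureTheory Filter Set

noncomputable section

/-- Smooth compactly supported functions: test functions with values in a normed space. -/
structure IsTest {E G : Type*} [NormedAddCommGroup E] [NormedSpace ℝ E] [NormedAddCommGroup G]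
    [NormedSpace ℝ G] (ψ : E → G) : Prop where
  smooth : ContDiff ℝ ∞ ψ
  compact : HasCompactSupport ψ

/-- The `C ^ M` norm of `ψ` is at most `B`. -/
def HasDerivBound {E G : Type*} [NormedAddCommGroup E] [NormedSpace ℝ E] [NormedAddCommGroup G]
    [NormedSpace ℝ G] (M : ℕ) (ψ : E → G) (B : ℝ) : Prop :=
  ∀ i ≤ M, ∀ x, ‖iteratedFDeriv ℝ i ψ x‖ ≤ B

section Slices

variable {X E G : Type*} [TopologicalSpace X] [TopologicalSpace E] [Zero G] {Ψ : X × E → G}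

theorem slice_eq_zero {x : X} (hx : x ∉ Prod.fst '' tsupport Ψ) (y : E) : Ψ (x, y) = 0 := by
  by_contra hne
  exact hx ⟨(x, y), subset_tsupport _ hne, rfl⟩

theorem slice_snd_eq_zero {y : E} (hy : y ∉ Prod.snd '' tsupport Ψ) (x : X) : Ψ (x, y) = 0 := by
  by_contra hne
  exact hy ⟨(x, y), subset_tsupport _ hne, rfl⟩

theorem tsupport_slice_subset [T2Space E] (h : HasCompactSupport Ψ) (x : X) :
    tsupport (fun y => Ψ (x, y)) ⊆ Prod.snd '' tsupport Ψ :=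
  closure_minimal (fun y hy => ⟨(x, y), subset_tsupport _ hy, rfl⟩)
    (h.isCompact.image continuous_snd).isClosed

end Slices

section TestFunctions

variable {X E G G' : Type*} [NormedAddCommGroup X] [NormedSpace ℝ X] [NormedAddCommGroup E]
  [NormedSpace ℝ E] [NormedAddCommGroup G] [NormedSpace ℝ G] [NormedAddCommGroup G']
  [NormedSpace ℝ G']

theorem HasDerivBound.nonneg {M : ℕ} {ψ : E → G} {B : ℝ} (h : HasDerivBound M ψ B) : 0 ≤ B :=
  (norm_nonneg _).trans (h 0 M.zero_le 0)

theorem HasDerivBound.norm_le {M : ℕ} {ψ : E → G} {B : ℝ} (h : HasDerivBound M ψ B) (x : E) :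
    ‖ψ x‖ ≤ B := by
  simpa using h 0 M.zero_le x

theorem isTest_test (φ : Test E) : IsTest φ := ⟨φ.contDiff, φ.hasCompactSupport⟩

theorem isTest_zero : IsTest (fun _ : E => (0 : G)) := ⟨contDiff_const, HasCompactSupport.zero⟩

namespace IsTest

theorem continuous {ψ : E → G} (h : IsTest ψ) : Continuous ψ := h.smooth.continuous

theorem clm_comp {ψ : E → G} (h : IsTest ψ) (A : G →L[ℝ] G') : IsTest (fun x => A (ψ x)) where
  smooth := A.contDiff.comp h.smooth
  compact := h.compact.comp_left (map_zero A)

theorem re {ψ : E → ℂ} (h : IsTest ψ) : IsTest (fun x => (ψ x).re) := h.clm_comp Complex.reCLM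

theorem im {ψ : E → ℂ} (h : IsTest ψ) : IsTest (fun x => (ψ x).im) := h.clm_comp Complex.imCLM

theorem ofReal {φ : E → ℝ} (h : IsTest φ) : IsTest (fun x => (φ x : ℂ)) :=
  h.clm_comp Complex.ofRealCLM

theorem add {ψ χ : E → G} (h : IsTest ψ) (h' : IsTest χ) : IsTest (fun x => ψ x + χ x) where
  smooth := h.smooth.add h'.smooth
  compact := h.compact.add h'.compact

theorem mul {ψ χ : E → ℂ} (h : IsTest ψ) (h' : ContDiff ℝ ∞ χ) :
    IsTest (fun x => ψ x * χ x) where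
  smooth := h.smooth.mul h'
  compact := h.compact.mul_right

theorem mul_left {ψ χ : E → ℂ} (h : IsTest ψ) (h' : ContDiff ℝ ∞ χ) :
    IsTest (fun x => χ x * ψ x) where
  smooth := h'.mul h.smooth
  compact := h.compact.mul_left

theorem const_mul {ψ : E → ℂ} (h : IsTest ψ) (c : ℂ) : IsTest (fun x => c * ψ x) :=
  h.mul_left contDiff_const

protected theorem fderiv {ψ : E → G} (h : IsTest ψ) : IsTest (fderiv ℝ ψ) where
  smooth := h.smooth.fderiv_right (by simp)
  compact := h.compact.fderiv ℝ

protected theorem iteratedFDeriv {ψ : E → G} (h : IsTest ψ) (i : ℕ) :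
    IsTest (iteratedFDeriv ℝ i ψ) where
  smooth := h.smooth.iteratedFDeriv_right (m := ∞) (by exact_mod_cast le_top)
  compact := h.compact.iteratedFDeriv i

theorem exists_hasDerivBound {ψ : E → G} (h : IsTest ψ) (M : ℕ) : ∃ B, HasDerivBound M ψ B := by
  choose C hC using fun i => (h.iteratedFDeriv i).continuous.bounded_above_of_compact_support
    (h.iteratedFDeriv i).compact
  have hC0 (i : ℕ) : 0 ≤ C i := (norm_nonneg _).trans (hC i 0)
  exact ⟨∑ i ∈ Finset.range (M + 1), C i, fun i hi x => (hC i x).trans <|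
    Finset.single_le_sum (fun i _ => hC0 i) (Finset.mem_range_succ_iff.2 hi)⟩

theorem slice {Ψ : X × E → G} (h : IsTest Ψ) (x : X) : IsTest (fun y => Ψ (x, y)) where
  smooth := h.smooth.comp (contDiff_const.prodMk contDiff_id)
  compact := .intro (h.compact.isCompact.image continuous_snd) fun _ hy => slice_snd_eq_zero hy x

theorem swap {Ψ : X × E → G} (h : IsTest Ψ) : IsTest (fun z : E × X => Ψ (z.2, z.1)) where
  smooth := h.smooth.comp (contDiff_snd.prodMk contDiff_fst)
  compact := h.compact.comp_homeomorph (Homeomorph.prodComm E X)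

end IsTest

end TestFunctions

section IteratedDerivatives

variable {X E G : Type*} [NormedAddCommGroup X] [NormedSpace ℝ X] [NormedAddCommGroup E]
  [NormedSpace ℝ E] [NormedAddCommGroup G] [NormedSpace ℝ G]

theorem norm_iteratedFDeriv_iteratedFDeriv (f : E → G) (k i : ℕ) (x : E) :
    ‖iteratedFDeriv ℝ k (iteratedFDeriv ℝ i f) x‖ = ‖iteratedFDeriv ℝ (k + i) f x‖ := by
  induction i generalizing k with
  | zero =>
    rw [iteratedFDeriv_zero_eq_comp, LinearIsometryEquiv.norm_iteratedFDeriv_comp_left, add_zero]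
  | succ i ih =>
    have curry_comp := LinearIsometryEquiv.norm_iteratedFDeriv_comp_left
      (𝕜 := ℝ) (F := E →L[ℝ] E [×i]→L[ℝ] G) (G := E [×(i + 1)]→L[ℝ] G)
      (continuousMultilinearCurryLeftEquiv ℝ (fun _ : Fin (i + 1) => E) G).symm
      (fderiv ℝ (iteratedFDeriv ℝ i f)) x k
    rw [← add_assoc, add_right_comm, ← ih, ← norm_iteratedFDeriv_fderiv]
    exact curry_comp

theorem iteratedFDeriv_comp_affine {f : E → G} (h : ContDiff ℝ ∞ f) (A : X →L[ℝ] E) (c : E)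
    (k : ℕ) (x : X) :
    iteratedFDeriv ℝ k (fun x => f (c + A x)) x =
      (iteratedFDeriv ℝ k f (c + A x)).compContinuousLinearMap (fun _ => A) := by
  have hc : ContDiff ℝ ∞ (fun z => f (c + z)) := h.comp (contDiff_const.add contDiff_id)
  have := A.iteratedFDeriv_comp_right hc x (i := k) (by exact_mod_cast le_top)
  rwa [iteratedFDeriv_comp_add_left] at this

theorem norm_iteratedFDeriv_comp_affine_le {f : E → G} (h : ContDiff ℝ ∞ f) (A : X →L[ℝ] E)
    (c : E) (k : ℕ) (x : X) :
    ‖iteratedFDeriv ℝ k (fun x => f (c + A x)) x‖ ≤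
      ‖iteratedFDeriv ℝ k f (c + A x)‖ * ‖A‖ ^ k := by
  rw [iteratedFDeriv_comp_affine h]
  refine (ContinuousMultilinearMap.norm_compContinuousLinearMap_le _ _).trans ?_
  simp

theorem iteratedFDeriv_slice {Ψ : X × E → G} (h : ContDiff ℝ ∞ Ψ) (k : ℕ) (x : X) (y : E) :
    iteratedFDeriv ℝ k (fun y => Ψ (x, y)) y =
      (iteratedFDeriv ℝ k Ψ (x, y)).compContinuousLinearMap
        (fun _ => ContinuousLinearMap.inr ℝ X E) := by
  simpa using iteratedFDeriv_comp_affine h (ContinuousLinearMap.inr ℝ X E) (x, 0) k y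

theorem norm_iteratedFDeriv_slice_fst_le {Ψ : X × E → G} (h : ContDiff ℝ ∞ Ψ) (k : ℕ) (x : X)
    (y : E) :
    ‖iteratedFDeriv ℝ k (fun x => Ψ (x, y)) x‖ ≤ ‖iteratedFDeriv ℝ k Ψ (x, y)‖ := by
  have := norm_iteratedFDeriv_comp_affine_le h (ContinuousLinearMap.inl ℝ X E) (0, y) k x
  simp only [ContinuousLinearMap.inl_apply, Prod.mk_add_mk, add_zero, zero_add] at this
  exact this.trans (mul_le_of_le_one_right (norm_nonneg _)
    (pow_le_one₀ (norm_nonneg _) (ContinuousLinearMap.norm_inl_le_one ℝ X E)))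

end IteratedDerivatives

section Curves

variable {X Y G : Type*} [NormedAddCommGroup X] [NormedSpace ℝ X] [NormedAddCommGroup Y]
  [NormedSpace ℝ Y] [NormedAddCommGroup G] [NormedSpace ℝ G]

open Classical in
/-- A test function as a bounded continuous function; `0` if `h` is not a test function. -/
def toBCF (h : Y → G) : Y →ᵇ G :=
  if hh : IsTest h then
    BoundedContinuousFunction.ofNormedAddCommGroup h hh.continuous _
      (hh.continuous.bounded_above_of_compact_support hh.compact).choose_spec
  else 0

theorem toBCF_apply {h : Y → G} (hh : IsTest h) (y : Y) : toBCF h y = h y := by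
  simp only [toBCF, hh, dite_true]
  rfl

/-- The curve `x ↦ Ψ (x, ·)` of bounded continuous functions. -/
def curve (Ψ : X × Y → G) (x : X) : Y →ᵇ G := toBCF fun y => Ψ (x, y)

theorem curve_apply {Ψ : X × Y → G} (h : IsTest Ψ) (x : X) (y : Y) : curve Ψ x y = Ψ (x, y) :=
  toBCF_apply (h.slice x) y

theorem hasCompactSupport_curve {Ψ : X × Y → G} (h : IsTest Ψ) : HasCompactSupport (curve Ψ) := by
  refine .intro (h.compact.isCompact.image continuous_fst) fun x hx => ?_
  ext y
  exact (curve_apply h x y).trans (slice_eq_zero hx y)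

theorem IsTest.fderiv_fst {Ψ : X × Y → G} (h : IsTest Ψ) (v : X) :
    IsTest fun z => _root_.fderiv ℝ Ψ z (v, 0) :=
  h.fderiv.clm_comp (ContinuousLinearMap.apply ℝ G (v, 0))

/-- The directional derivatives of `Ψ` in the first variable, as a linear map into the bounded
continuous functions: the derivative of `curve Ψ` at `x`. -/
def curveDeriv {Ψ : X × Y → G} (h : IsTest Ψ) (x : X) : X →ₗ[ℝ] (Y →ᵇ G) where
  toFun v := curve (fun z => fderiv ℝ Ψ z (v, 0)) x
  map_add' v w := by
    ext y
    simp [curve_apply (h.fderiv_fst _), ← map_add]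
  map_smul' c v := by
    ext y
    simp [curve_apply (h.fderiv_fst _), ← map_smul]

variable [FiniteDimensional ℝ X]

theorem hasFDerivAt_curve {Ψ : X × Y → G} (h : IsTest Ψ) (x : X) :
    HasFDerivAt (curve Ψ) (curveDeriv h x).toContinuousLinearMap x := by
  rw [hasFDerivAt_iff_isLittleO_nhds_zero, Asymptotics.isLittleO_iff]
  intro ε hε
  have huc := h.fderiv.compact.uniformContinuous_of_continuous h.fderiv.continuous
  obtain ⟨δ, hδ, hd⟩ := Metric.uniformContinuous_iff.1 huc ε hε
  filter_upwards [Metric.ball_mem_nhds (0 : X) hδ] with v hv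
  rw [mem_ball_zero_iff] at hv
  refine (BoundedContinuousFunction.norm_le (by positivity)).2 fun y => ?_
  have taylor : ‖Ψ (x + v, y) - Ψ (x, y) - fderiv ℝ Ψ (x, y) ((x + v, y) - (x, y))‖ ≤
      ε * ‖(x + v, y) - (x, y)‖ :=
    (convex_ball (x, y) δ).norm_image_sub_le_of_norm_hasFDerivWithin_le'
      (fun z _ => (h.smooth.differentiable (by simp) z).hasFDerivAt.hasFDerivWithinAt)
      (fun z hz => by simpa [dist_eq_norm] using (hd hz).le) (Metric.mem_ball_self hδ)
      (by simpa [dist_eq_norm] using hv)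
  simpa [curveDeriv, curve_apply h, curve_apply (h.fderiv_fst v)] using taylor

theorem contDiff_curve {Ψ : X × Y → G} (h : IsTest Ψ) : ContDiff ℝ ∞ (curve Ψ) := by
  rw [contDiff_infty]
  intro n
  induction n generalizing Ψ with
  | zero =>
    rw [Nat.cast_zero, contDiff_zero, continuous_iff_continuousAt]
    exact fun x => (hasFDerivAt_curve h x).continuousAt
  | succ n ih =>
    push_cast
    rw [contDiff_succ_iff_fderiv_apply]
    refine ⟨fun x => (hasFDerivAt_curve h x).differentiableAt, by simp, fun v => ?_⟩
    simp only [(hasFDerivAt_curve h _).fderiv]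
    exact ih (h.fderiv_fst v)

theorem iteratedFDeriv_curve_apply {Ψ : X × Y → G} (h : IsTest Ψ) (k : ℕ) (x : X)
    (m : Fin k → X) (y : Y) :
    iteratedFDeriv ℝ k (curve Ψ) x m y = iteratedFDeriv ℝ k (fun x => Ψ (x, y)) x m := by
  have eval_comp : (fun x => Ψ (x, y)) = BoundedContinuousFunction.evalCLM ℝ y ∘ curve Ψ := by
    ext x
    simp [curve_apply h]
  rw [eval_comp, ContinuousLinearMap.iteratedFDeriv_comp_left _
    ((contDiff_curve h).contDiffAt (x := x)) (i := k) (by exact_mod_cast le_top)]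
  simp

theorem norm_iteratedFDeriv_curve_le {Ψ : X × Y → G} (h : IsTest Ψ) {k : ℕ} {B : ℝ}
    (hB : ∀ z, ‖iteratedFDeriv ℝ k Ψ z‖ ≤ B) (x : X) : ‖iteratedFDeriv ℝ k (curve Ψ) x‖ ≤ B := by
  have hB0 : 0 ≤ B := (norm_nonneg _).trans (hB 0)
  refine ContinuousMultilinearMap.opNorm_le_bound hB0 fun m => ?_
  refine (BoundedContinuousFunction.norm_le (by positivity)).2 fun y => ?_
  rw [iteratedFDeriv_curve_apply h]
  exact ContinuousMultilinearMap.le_of_opNorm_le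
    ((norm_iteratedFDeriv_slice_fst_le h.smooth k x y).trans (hB _)) m

end Curves

section ParametricIntegral

variable {X E G : Type*} [NormedAddCommGroup X] [NormedSpace ℝ X] [NormedAddCommGroup E]
  [NormedSpace ℝ E] [NormedAddCommGroup G] [NormedSpace ℝ G]
  [MeasurableSpace X] [OpensMeasurableSpace X] (μ : Measure X) [IsFiniteMeasureOnCompacts μ]

/-- Integration over a compact set as a continuous linear map on bounded continuous functions. -/
def setIntegralCLM {K : Set X} (hK : IsCompact K) : (X →ᵇ G) →L[ℝ] G :=
  LinearMap.mkContinuous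
    { toFun h := ∫ x in K, h x ∂μ
      map_add' h h' := integral_add (h.continuous.continuousOn.integrableOn_compact hK)
        (h'.continuous.continuousOn.integrableOn_compact hK)
      map_smul' c _ := integral_smul c _ }
    (μ.real K) fun h => by
      rw [mul_comm]
      exact norm_setIntegral_le_of_norm_le_const hK.measure_lt_top fun x _ => h.norm_coe_le_norm x

theorem integral_slice_eq {Ψ : X × E → G} (h : IsTest Ψ) :
    (fun y => ∫ x, Ψ (x, y) ∂μ) =
      setIntegralCLM μ (h.compact.isCompact.image continuous_fst) ∘
        curve (fun z : E × X => Ψ (z.2, z.1)) := by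
  ext y
  change _ = ∫ x in _, curve _ y x ∂μ
  simp_rw [curve_apply h.swap]
  exact (setIntegral_eq_integral_of_forall_compl_eq_zero fun x hx => slice_eq_zero hx y).symm

theorem integrable_curve [FiniteDimensional ℝ X] {Ψ : X × E → G} (h : IsTest Ψ) :
    Integrable (curve Ψ) μ :=
  (contDiff_curve h).continuous.integrable_of_hasCompactSupport (hasCompactSupport_curve h)

variable [FiniteDimensional ℝ E]

theorem IsTest.integral_slice {Ψ : X × E → G} (h : IsTest Ψ) :
    IsTest (fun y => ∫ x, Ψ (x, y) ∂μ) where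
  smooth := by
    rw [integral_slice_eq μ h]
    exact (ContinuousLinearMap.contDiff _).comp (contDiff_curve h.swap)
  compact := .intro (h.compact.isCompact.image continuous_snd) fun y hy => by
    simp [slice_snd_eq_zero hy]

theorem iteratedFDeriv_integral_slice {Ψ : X × E → G} (h : IsTest Ψ) (k : ℕ) (y : E)
    (m : Fin k → E) :
    iteratedFDeriv ℝ k (fun y => ∫ x, Ψ (x, y) ∂μ) y m =
      ∫ x, iteratedFDeriv ℝ k (fun y => Ψ (x, y)) y m ∂μ := by
  rw [integral_slice_eq μ h, ContinuousLinearMap.iteratedFDeriv_comp_left _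
    (contDiff_curve h.swap).contDiffAt (by exact_mod_cast le_top)]
  change ∫ x in _, iteratedFDeriv ℝ k (curve _) y m x ∂μ = _
  simp_rw [iteratedFDeriv_curve_apply h.swap]
  refine setIntegral_eq_integral_of_forall_compl_eq_zero fun x hx => ?_
  simp [slice_eq_zero hx, iteratedFDeriv_fun_zero]

theorem integral_curve [FiniteDimensional ℝ X] [CompleteSpace G] {Ψ : X × E → G} (h : IsTest Ψ) :
    ∫ x, curve Ψ x ∂μ = toBCF (fun y => ∫ x, Ψ (x, y) ∂μ) := by
  ext y
  have eval_comm := (BoundedContinuousFunction.evalCLM ℝ y).integral_comp_comm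
    (integrable_curve μ h)
  rw [toBCF_apply (h.integral_slice μ)]
  exact eval_comm.symm.trans (by simp [curve_apply h])

end ParametricIntegral

section Pairing

variable {E : Type*} [NormedAddCommGroup E] [NormedSpace ℝ E]

/-- A smooth compactly supported real function as a bundled test function. -/
def toTest (φ : E → ℝ) (h : IsTest φ) : Test E where
  toFun := φ
  contDiff' := h.smooth
  hasCompactSupport' := h.compact
  tsupport_subset' := fun _ _ => trivial

@[simp]
theorem toTest_apply (φ : E → ℝ) (h : IsTest φ) (x : E) : toTest φ h x = φ x := rfl

open Classical in
/-- The `ℂ`-linear extension of a distribution to complex test functions, `0` on functions which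
are not test functions. -/
def pair (u : Distr E) (ψ : E → ℂ) : ℂ :=
  if h : IsTest ψ then u (toTest _ h.re) + Complex.I * u (toTest _ h.im) else 0

theorem pair_eq (u : Distr E) {ψ : E → ℂ} (h : IsTest ψ) :
    pair u ψ = u (toTest _ h.re) + Complex.I * u (toTest _ h.im) := by
  simp [pair, h]

theorem pair_ofReal (u : Distr E) (φ : Test E) : pair u (fun x => (φ x : ℂ)) = u φ := by
  rw [pair_eq u (isTest_test φ).ofReal]
  have re_eq : toTest _ (isTest_test φ).ofReal.re = φ := by ext x; simp
  have im_eq : toTest _ (isTest_test φ).ofReal.im = 0 := by ext x; simp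
  rw [re_eq, im_eq, map_zero, mul_zero, add_zero]

theorem pair_add (u : Distr E) {ψ χ : E → ℂ} (h : IsTest ψ) (h' : IsTest χ) :
    pair u (fun x => ψ x + χ x) = pair u ψ + pair u χ := by
  rw [pair_eq u h, pair_eq u h', pair_eq u (h.add h')]
  have re_eq : toTest _ (h.add h').re = toTest _ h.re + toTest _ h'.re := by ext x; simp
  have im_eq : toTest _ (h.add h').im = toTest _ h.im + toTest _ h'.im := by ext x; simp
  rw [re_eq, im_eq, map_add, map_add]
  ring

theorem pair_const_mul (u : Distr E) {ψ : E → ℂ} (h : IsTest ψ) (c : ℂ) :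
    pair u (fun x => c * ψ x) = c * pair u ψ := by
  rw [pair_eq u h, pair_eq u (h.const_mul c)]
  have re_eq : toTest _ (h.const_mul c).re = c.re • toTest _ h.re - c.im • toTest _ h.im := by
    ext x; simp
  have im_eq : toTest _ (h.const_mul c).im = c.re • toTest _ h.im + c.im • toTest _ h.re := by
    ext x; simp
  rw [re_eq, im_eq, map_add, map_sub, map_smul, map_smul, map_smul, map_smul]
  simp only [Complex.real_smul]
  conv_rhs => rw [← Complex.re_add_im c]
  linear_combination (-(c.im : ℂ) * u (toTest _ h.im)) * Complex.I_sq

theorem pair_sub (u : Distr E) {ψ χ : E → ℂ} (h : IsTest ψ) (h' : IsTest χ) :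
    pair u (fun x => ψ x - χ x) = pair u ψ - pair u χ := by
  have := pair_add u h (h'.const_mul (-1))
  rw [pair_const_mul u h'] at this
  simpa [sub_eq_add_neg] using this

theorem pair_zero (u : Distr E) : pair u (fun _ => 0) = 0 := by
  have := pair_const_mul u (isTest_zero (E := E)) 0
  simpa using this

/-- The exponential `x ↦ exp (- i ξ x)`. -/
def expChar (ξ : E →L[ℝ] ℝ) (x : E) : ℂ := Complex.exp (-(Complex.I * (ξ x : ℂ)))

theorem contDiff_expChar (ξ : E →L[ℝ] ℝ) : ContDiff ℝ ∞ (expChar ξ) :=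
  (contDiff_const.mul (Complex.ofRealCLM.contDiff.comp ξ.contDiff)).neg.cexp

theorem norm_expChar (ξ : E →L[ℝ] ℝ) (x : E) : ‖expChar ξ x‖ = 1 := by
  rw [expChar, show -(Complex.I * (ξ x : ℂ)) = ((-(ξ x) : ℝ) : ℂ) * Complex.I by
    push_cast; ring]
  exact Complex.norm_exp_ofReal_mul_I _

@[simp]
theorem mulSmooth_apply (φ : Test E) (a : E → ℝ) (ha : ContDiff ℝ ∞ a) (x : E) :
    mulSmooth φ a ha x = φ x * a x := rfl

theorem localFourier_eq_pair (u : Distr E) (φ : Test E) (ξ : E →L[ℝ] ℝ) :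
    localFourier u φ ξ = pair u (fun x => (φ x : ℂ) * expChar ξ x) := by
  rw [localFourier, ← pair_ofReal, ← pair_ofReal, ← pair_const_mul u (isTest_test _).ofReal,
    ← pair_sub u (isTest_test _).ofReal ((isTest_test _).ofReal.const_mul _)]
  congr 1
  ext x
  change _ = (φ x : ℂ) * Complex.exp (-(Complex.I * (ξ x : ℂ)))
  have cos_sin : Complex.exp (-(Complex.I * (ξ x : ℂ))) =
      (Real.cos (ξ x) : ℂ) - Complex.I * (Real.sin (ξ x) : ℂ) := by
    rw [show -(Complex.I * (ξ x : ℂ)) = -(ξ x : ℂ) * Complex.I by ring, Complex.exp_mul_I]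
    push_cast
    rw [Complex.cos_neg, Complex.sin_neg]
    ring
  rw [cos_sin]
  simp only [mulSmooth_apply, Complex.ofReal_mul]
  ring

end Pairing

section Jets

variable {X E : Type*} [NormedAddCommGroup X] [NormedSpace ℝ X] [NormedAddCommGroup E]
  [NormedSpace ℝ E]

/-- The fibre of the bundle of jets of order `M` of complex functions on `E`. -/
abbrev Jet (E : Type*) [NormedAddCommGroup E] [NormedSpace ℝ E] (M : ℕ) :=
  (i : Fin (M + 1)) → E [×i]→L[ℝ] ℂ

/-- The derivatives of `ψ` at `x` of order at most `M`. -/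
def jet (M : ℕ) (ψ : E → ℂ) (x : E) : Jet E M := fun i => iteratedFDeriv ℝ i ψ x

theorem norm_jet_le_iff {M : ℕ} {ψ : E → ℂ} {B : ℝ} (hB : 0 ≤ B) :
    (∀ x, ‖jet M ψ x‖ ≤ B) ↔ HasDerivBound M ψ B := by
  simp_rw [pi_norm_le_iff_of_nonneg hB, HasDerivBound, ← Nat.lt_succ_iff]
  exact ⟨fun h i hi x => h x ⟨i, hi⟩, fun h x i => h i i.2 x⟩

theorem IsTest.jet {ψ : E → ℂ} (h : IsTest ψ) (M : ℕ) : IsTest (jet M ψ) where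
  smooth := contDiff_pi.2 fun i => (h.iteratedFDeriv i).smooth
  compact := .intro h.compact.isCompact fun _ hx => funext fun i =>
    image_eq_zero_of_notMem_tsupport fun hx' => hx (tsupport_iteratedFDeriv_subset i hx')

open TopologicalSpace (Compacts)

/-- The restriction of `pair u` to the space `𝓓_K` of test functions supported in `K`. -/
def pairSupportedIn (u : Distr E) (K : Compacts E) : 𝓓_{K}(E, ℂ) →L[ℝ] ℂ :=
  let u' : Test E →L[ℝ] ℂ := u
  let u_K := u' ∘L TestFunction.ofSupportedInCLM (K := K) ℝ fun _ _ => trivial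
  u_K ∘L ContDiffMapSupportedIn.postcompCLM Complex.reCLM +
    Complex.I • (u_K ∘L ContDiffMapSupportedIn.postcompCLM Complex.imCLM)

theorem pairSupportedIn_apply (u : Distr E) (K : Compacts E) (ψ : 𝓓_{K}(E, ℂ)) :
    pairSupportedIn u K ψ = pair u ψ := by
  rw [pair_eq u ⟨ψ.contDiff, ψ.hasCompactSupport⟩]
  rfl

theorem exists_bound_pair (u : Distr E) {K : Set E} (hK : IsCompact K) :
    ∃ (M : ℕ) (C : ℝ), 0 ≤ C ∧ ∀ ψ : E → ℂ, IsTest ψ → tsupport ψ ⊆ K →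
      ∀ B, HasDerivBound M ψ B → ‖pair u ψ‖ ≤ C * B := by
  obtain ⟨s, C, -, hC⟩ := Seminorm.bound_of_continuous
    (ContDiffMapSupportedIn.withSeminorms' ℝ E ℂ ⊤ ⟨K, hK⟩)
    ((normSeminorm ℝ ℂ).comp (pairSupportedIn u ⟨K, hK⟩).toLinearMap)
    (continuous_norm.comp (pairSupportedIn u ⟨K, hK⟩).continuous)
  refine ⟨s.sup id, C, C.2, fun ψ hψ hψK B hB => ?_⟩
  let ψ' : 𝓓_{(⟨K, hK⟩ : Compacts E)}(E, ℂ) :=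
    ContDiffMapSupportedIn.of_support_subset hψ.smooth ((subset_tsupport _).trans hψK)
  have seminorm_le : (s.sup (ContDiffMapSupportedIn.supSeminorm ℝ E ℂ ⊤ ⟨K, hK⟩)) ψ' ≤ B := by
    refine Seminorm.finset_sup_apply_le hB.nonneg fun n hn => ?_
    refine Seminorm.finset_sup_apply_le hB.nonneg fun i hi => ?_
    refine (ContDiffMapSupportedIn.seminorm_top_le_iff ℝ hB.nonneg i ψ').2 fun x _ => ?_
    exact hB i ((Finset.mem_Iic.1 hi).trans (Finset.le_sup (f := id) hn)) x
  calc ‖pair u ψ‖ = ‖pairSupportedIn u ⟨K, hK⟩ ψ'‖ := by rw [pairSupportedIn_apply]; rfl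
    _ ≤ C * (s.sup (ContDiffMapSupportedIn.supSeminorm ℝ E ℂ ⊤ ⟨K, hK⟩)) ψ' := hC ψ'
    _ ≤ C * B := mul_le_mul_of_nonneg_left seminorm_le C.2

theorem exists_clm_apply_eq {V W F : Type*} [AddCommGroup V] [Module ℝ V] [NormedAddCommGroup W]
    [NormedSpace ℝ W] [NormedAddCommGroup F] [NormedSpace ℝ F] [FiniteDimensional ℝ F]
    (A : V →ₗ[ℝ] W) (ℓ : V →ₗ[ℝ] F) (C : ℝ) (h : ∀ v, ‖ℓ v‖ ≤ C * ‖A v‖) :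
    ∃ L : W →L[ℝ] F, ∀ v, L (A v) = ℓ v := by
  have hker : A.ker ≤ ℓ.ker := fun v hv => by
    simpa [LinearMap.mem_ker.1 hv] using h v
  let g : A.range →ₗ[ℝ] F := A.ker.liftQ ℓ hker ∘ₗ A.quotKerEquivRange.symm.toLinearMap
  have hg (v : V) : g ⟨A v, v, rfl⟩ = ℓ v :=
    congrArg (A.ker.liftQ ℓ hker) (A.quotKerEquivRange_symm_apply_image v ⟨v, rfl⟩)
  obtain ⟨L, hL⟩ := (g.mkContinuous C (by rintro ⟨_, v, rfl⟩; exact (hg v).symm ▸ h v)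
    ).exist_extension_of_finiteDimensional_range
  exact ⟨L, fun v => (DFunLike.congr_fun hL ⟨A v, v, rfl⟩).symm.trans (hg v)⟩

/-- The map `ψ ↦ jet M ψ` on `𝓓_K`. -/
def jetSupportedIn (K : Compacts E) (M : ℕ) : 𝓓_{K}(E, ℂ) →ₗ[ℝ] (E →ᵇ Jet E M) where
  toFun ψ := toBCF (jet M ψ)
  map_add' ψ χ := by
    have isTest (ψ : 𝓓_{K}(E, ℂ)) : IsTest ψ := ⟨ψ.contDiff, ψ.hasCompactSupport⟩
    ext1 x
    simp only [BoundedContinuousFunction.add_apply, toBCF_apply ((isTest _).jet M)]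
    exact funext fun i => iteratedFDeriv_add_apply
      (ψ.contDiff.contDiffAt.of_le (by exact_mod_cast le_top))
      (χ.contDiff.contDiffAt.of_le (by exact_mod_cast le_top))
  map_smul' c ψ := by
    have isTest (ψ : 𝓓_{K}(E, ℂ)) : IsTest ψ := ⟨ψ.contDiff, ψ.hasCompactSupport⟩
    ext1 x
    simp only [BoundedContinuousFunction.smul_apply, toBCF_apply ((isTest _).jet M)]
    exact funext fun i => iteratedFDeriv_const_smul_apply
      (ψ.contDiff.contDiffAt.of_le (by exact_mod_cast le_top))

theorem exists_bound_iteratedFDeriv_clm_comp {W F : Type*} [NormedAddCommGroup W]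
    [NormedSpace ℝ W] [NormedAddCommGroup F] [NormedSpace ℝ F] (L : W →L[ℝ] F) (k : ℕ) :
    ∃ C, 0 ≤ C ∧ ∀ c : X → W, ContDiff ℝ ∞ c →
      ∀ x, ‖iteratedFDeriv ℝ k (L ∘ c) x‖ ≤ C * ‖iteratedFDeriv ℝ k c x‖ :=
  ⟨‖L‖, norm_nonneg L, fun _ hc _ =>
    L.norm_iteratedFDeriv_comp_left hc.contDiffAt (by exact_mod_cast le_top)⟩

theorem exists_clm_jet_eq_pair (u : Distr E) {K : Set E} (hK : IsCompact K) :
    ∃ (M : ℕ) (L : (E →ᵇ Jet E M) →L[ℝ] ℂ),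
      ∀ ψ : E → ℂ, IsTest ψ → tsupport ψ ⊆ K → pair u ψ = L (toBCF (jet M ψ)) := by
  obtain ⟨M, C, -, hu⟩ := exists_bound_pair u hK
  obtain ⟨L, hL⟩ := exists_clm_apply_eq (W := E →ᵇ Jet E M) (jetSupportedIn ⟨K, hK⟩ M)
    (pairSupportedIn u ⟨K, hK⟩).toLinearMap C fun ψ => by
      have hψ : IsTest ψ := ⟨ψ.contDiff, ψ.hasCompactSupport⟩
      have deriv_le : HasDerivBound M ψ ‖toBCF (jet M ψ)‖ :=
        (norm_jet_le_iff (norm_nonneg (toBCF (jet M ψ)))).1 fun x =>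
          toBCF_apply (hψ.jet M) x ▸ (toBCF (jet M ψ)).norm_coe_le_norm x
      exact (pairSupportedIn_apply u _ ψ).symm ▸ hu ψ hψ ψ.tsupport_subset _ deriv_le
  refine ⟨M, L, fun ψ hψ hψK => ?_⟩
  let ψ' : 𝓓_{(⟨K, hK⟩ : Compacts E)}(E, ℂ) :=
    ContDiffMapSupportedIn.of_support_subset hψ.smooth ((subset_tsupport _).trans hψK)
  exact (pairSupportedIn_apply u _ ψ').symm.trans (hL ψ').symm

/-- The jets in the second variable. -/
def jetSlice (M : ℕ) (Ψ : X × E → ℂ) (z : X × E) : Jet E M := jet M (fun y => Ψ (z.1, y)) z.2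

theorem jetSlice_eq {Ψ : X × E → ℂ} (h : ContDiff ℝ ∞ Ψ) (M : ℕ) (i : Fin (M + 1)) :
    (fun z => jetSlice M Ψ z i) = ContinuousMultilinearMap.compContinuousLinearMapL
      (fun _ => ContinuousLinearMap.inr ℝ X E) ∘ iteratedFDeriv ℝ i Ψ :=
  funext fun z => iteratedFDeriv_slice h i z.1 z.2

theorem IsTest.jetSlice {Ψ : X × E → ℂ} (h : IsTest Ψ) (M : ℕ) : IsTest (jetSlice M Ψ) where
  smooth := contDiff_pi.2 fun i => by
    rw [jetSlice_eq h.smooth]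
    exact (ContinuousLinearMap.contDiff _).comp (h.iteratedFDeriv i).smooth
  compact := .intro h.compact.isCompact fun z hz => funext fun i => by
    rw [congrFun (jetSlice_eq h.smooth M i) z, Function.comp_apply,
      image_eq_zero_of_notMem_tsupport fun hz' => hz (tsupport_iteratedFDeriv_subset i hz'),
      map_zero, Pi.zero_apply]

theorem HasDerivBound.norm_iteratedFDeriv_jetSlice_le {Ψ : X × E → ℂ} (h : IsTest Ψ)
    {k M : ℕ} {B : ℝ} (hB : HasDerivBound (k + M) Ψ B) (z : X × E) :
    ‖iteratedFDeriv ℝ k (jetSlice M Ψ) z‖ ≤ B := by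
  refine ContinuousMultilinearMap.opNorm_le_bound hB.nonneg fun m => ?_
  refine (pi_norm_le_iff_of_nonneg (mul_nonneg hB.nonneg (by positivity))).2 fun i => ?_
  have component_eq : iteratedFDeriv ℝ k (jetSlice M Ψ) z m i =
      iteratedFDeriv ℝ k (fun z => jetSlice M Ψ z i) z m := by
    have := (ContinuousLinearMap.proj (R := ℝ) (φ := fun i : Fin (M + 1) => E [×i]→L[ℝ] ℂ)
      i).iteratedFDeriv_comp_left (h.jetSlice M).smooth.contDiffAt (x := z) (i := k)
      (by exact_mod_cast le_top)
    exact (DFunLike.congr_fun this m).symm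
  rw [component_eq, jetSlice_eq h.smooth]
  refine ContinuousMultilinearMap.le_of_opNorm_le ?_ m
  have norm_restrict_le : ‖(ContinuousMultilinearMap.compContinuousLinearMapL
      (fun _ => ContinuousLinearMap.inr ℝ X E) :
        ((X × E) [×i]→L[ℝ] ℂ) →L[ℝ] (E [×i]→L[ℝ] ℂ))‖ ≤ 1 :=
    (ContinuousMultilinearMap.norm_compContinuousLinearMapL_le _ _).trans <|
      Finset.prod_le_one (fun _ _ => norm_nonneg _)
        fun _ _ => ContinuousLinearMap.norm_inr_le_one ℝ X E
  calc _ ≤ _ * ‖iteratedFDeriv ℝ k (iteratedFDeriv ℝ i Ψ) z‖ :=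
        ContinuousLinearMap.norm_iteratedFDeriv_comp_left _
          (h.iteratedFDeriv i).smooth.contDiffAt (by exact_mod_cast le_top)
    _ ≤ ‖iteratedFDeriv ℝ (k + i) Ψ z‖ := by
        rw [norm_iteratedFDeriv_iteratedFDeriv]
        exact mul_le_of_le_one_left (norm_nonneg _) norm_restrict_le
    _ ≤ B := hB _ (Nat.add_le_add_left (Nat.lt_succ_iff.1 i.2) k) z

theorem exists_clm_curve_eq_pair_slice (u : Distr E) {K : Set E} (hK : IsCompact K) :
    ∃ (M : ℕ) (L : (E →ᵇ Jet E M) →L[ℝ] ℂ), ∀ Ψ : X × E → ℂ, IsTest Ψ →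
      Prod.snd '' tsupport Ψ ⊆ K →
        (fun x => pair u (fun y => Ψ (x, y))) = L ∘ curve (jetSlice M Ψ) := by
  obtain ⟨M, L, hL⟩ := exists_clm_jet_eq_pair u hK
  exact ⟨M, L, fun Ψ h hΨK => funext fun x =>
    hL _ (h.slice x) ((tsupport_slice_subset h.compact x).trans hΨK)⟩

variable [FiniteDimensional ℝ X]

theorem IsTest.pair_slice (u : Distr E) {Ψ : X × E → ℂ} (h : IsTest Ψ) :
    IsTest (fun x => pair u (fun y => Ψ (x, y))) where
  smooth := by
    obtain ⟨M, L, hL⟩ :=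
      exists_clm_curve_eq_pair_slice (X := X) u (h.compact.isCompact.image continuous_snd)
    rw [hL Ψ h subset_rfl]
    exact L.contDiff.comp (contDiff_curve (h.jetSlice M))
  compact := .intro (h.compact.isCompact.image continuous_fst) fun x hx => by
    simp only [slice_eq_zero hx, pair_zero]

theorem exists_bound_pair_slice (u : Distr E) {K : Set E} (hK : IsCompact K) (k : ℕ) :
    ∃ (M : ℕ) (C : ℝ), 0 ≤ C ∧ ∀ Ψ : X × E → ℂ, IsTest Ψ → Prod.snd '' tsupport Ψ ⊆ K →
      ∀ B, HasDerivBound M Ψ B →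
        ∀ x, ‖iteratedFDeriv ℝ k (fun x => pair u (fun y => Ψ (x, y))) x‖ ≤ C * B := by
  obtain ⟨M, L, hL⟩ := exists_clm_curve_eq_pair_slice (X := X) u hK
  obtain ⟨C, hC, hLC⟩ := exists_bound_iteratedFDeriv_clm_comp (X := X) (W := E →ᵇ Jet E M) L k
  refine ⟨k + M, C, hC, fun Ψ h hΨK B hB x => ?_⟩
  rw [hL Ψ h hΨK]
  refine (hLC _ (contDiff_curve (h.jetSlice M)) x).trans (mul_le_mul_of_nonneg_left ?_ hC)
  exact norm_iteratedFDeriv_curve_le (h.jetSlice M) (hB.norm_iteratedFDeriv_jetSlice_le h) x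

end Jets

section ParametricIntegral

variable {X E : Type*} [NormedAddCommGroup X] [NormedSpace ℝ X] [NormedAddCommGroup E]
  [NormedSpace ℝ E] [FiniteDimensional ℝ E] [MeasurableSpace X] [OpensMeasurableSpace X]
  (μ : Measure X) [IsFiniteMeasureOnCompacts μ]

theorem jet_integral_slice {Ψ : X × E → ℂ} (h : IsTest Ψ) (M : ℕ) (y : E) :
    jet M (fun y => ∫ x, Ψ (x, y) ∂μ) y = ∫ x, jetSlice M Ψ (x, y) ∂μ := by
  have integrable_slice : Integrable (fun x => jetSlice M Ψ (x, y)) μ :=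
    ((h.jetSlice M).swap.slice y).continuous.integrable_of_hasCompactSupport
      ((h.jetSlice M).swap.slice y).compact
  have eval_apply (i : Fin (M + 1)) := (ContinuousLinearMap.proj (R := ℝ)
    (φ := fun i : Fin (M + 1) => E [×i]→L[ℝ] ℂ) i).integral_comp_comm integrable_slice
  have integrable_component (i : Fin (M + 1)) : Integrable (fun x => jetSlice M Ψ (x, y) i) μ :=
    (ContinuousLinearMap.proj (R := ℝ)
      (φ := fun i : Fin (M + 1) => E [×i]→L[ℝ] ℂ) i).integrable_comp integrable_slice
  ext i m
  refine (iteratedFDeriv_integral_slice μ h i y m).trans ?_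
  refine Eq.trans ?_ (DFunLike.congr_fun (eval_apply i) m)
  exact (ContinuousMultilinearMap.integral_apply (integrable_component i) m).symm

theorem pair_integral [FiniteDimensional ℝ X] (u : Distr E) {Ψ : X × E → ℂ} (h : IsTest Ψ) :
    pair u (fun y => ∫ x, Ψ (x, y) ∂μ) = ∫ x, pair u (fun y => Ψ (x, y)) ∂μ := by
  have hK : IsCompact (Prod.snd '' tsupport Ψ) := h.compact.isCompact.image continuous_snd
  obtain ⟨M, L, hL⟩ := exists_clm_jet_eq_pair u hK
  have tsupport_subset : tsupport (fun y => ∫ x, Ψ (x, y) ∂μ) ⊆ Prod.snd '' tsupport Ψ :=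
    closure_minimal (fun y hy => by
      by_contra hy'
      exact hy (by simp [slice_snd_eq_zero hy'])) hK.isClosed
  calc pair u (fun y => ∫ x, Ψ (x, y) ∂μ)
      = L (toBCF (jet M fun y => ∫ x, Ψ (x, y) ∂μ)) := hL _ (h.integral_slice μ) tsupport_subset
    _ = L (∫ x, curve (jetSlice M Ψ) x ∂μ) := by
        rw [integral_curve μ (h.jetSlice M), funext (jet_integral_slice μ h M)]
    _ = ∫ x, L (curve (jetSlice M Ψ) x) ∂μ :=
        (L.integral_comp_comm (integrable_curve μ (h.jetSlice M))).symm
    _ = ∫ x, pair u (fun y => Ψ (x, y)) ∂μ := integral_congr_ae <| ae_of_all _ fun x =>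
        (hL _ (h.slice x) (tsupport_slice_subset h.compact x)).symm

end ParametricIntegral

section Construction

variable {X E : Type*} [NormedAddCommGroup X] [NormedSpace ℝ X] [NormedAddCommGroup E]
  [NormedSpace ℝ E]

open TopologicalSpace (Compacts)

/-- `A` is `ℂ`-linear on test functions and, on those supported in a given compact set, bounded by
a `C ^ M` norm: such an `A` is the pairing with a distribution, see `ofFunctional`. -/
structure IsDistributional (A : (E → ℂ) → ℂ) : Prop where
  map_add : ∀ ψ χ, IsTest ψ → IsTest χ → A (fun x => ψ x + χ x) = A ψ + A χ
  map_const_mul : ∀ (c : ℂ) ψ, IsTest ψ → A (fun x => c * ψ x) = c * A ψ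
  exists_bound : ∀ K : Set E, IsCompact K → ∃ (M : ℕ) (C : ℝ), 0 ≤ C ∧ ∀ ψ : E → ℂ, IsTest ψ →
    tsupport ψ ⊆ K → ∀ B, HasDerivBound M ψ B → ‖A ψ‖ ≤ C * B

theorem IsDistributional.map_ofReal_add {A : (E → ℂ) → ℂ} (hA : IsDistributional A)
    {φ χ : E → ℝ} (hφ : IsTest φ) (hχ : IsTest χ) :
    A (fun x => ((φ x + χ x : ℝ) : ℂ)) = A (fun x => (φ x : ℂ)) + A (fun x => (χ x : ℂ)) := by
  simp_rw [Complex.ofReal_add]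
  exact hA.map_add _ _ hφ.ofReal hχ.ofReal

theorem IsDistributional.map_ofReal_mul {A : (E → ℂ) → ℂ} (hA : IsDistributional A)
    {φ : E → ℝ} (hφ : IsTest φ) (c : ℝ) :
    A (fun x => ((c * φ x : ℝ) : ℂ)) = c • A (fun x => (φ x : ℂ)) := by
  simp_rw [Complex.ofReal_mul, Complex.real_smul]
  exact hA.map_const_mul c _ hφ.ofReal

theorem hasDerivBound_ofReal (K : Compacts E) (φ : 𝓓_{K}(E, ℝ)) (M : ℕ) :
    HasDerivBound M (fun x => (φ x : ℂ)) ((Finset.range (M + 1)).sup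
      (ContDiffMapSupportedIn.seminorm ℝ E ℝ ⊤ K) φ) := fun i hi x => by
  have norm_ofReal : ‖iteratedFDeriv ℝ i (fun x => (φ x : ℂ)) x‖ = ‖iteratedFDeriv ℝ i φ x‖ :=
    Complex.ofRealLI.norm_iteratedFDeriv_comp_left φ.contDiff.contDiffAt (by exact_mod_cast le_top)
  exact norm_ofReal.trans_le <|
    (ContDiffMapSupportedIn.norm_iteratedFDeriv_apply_le_seminorm_top ℝ).trans <|
      Seminorm.le_finset_sup_apply (Finset.mem_range_succ_iff.2 hi)

theorem IsDistributional.continuous_ofReal {A : (E → ℂ) → ℂ} (hA : IsDistributional A)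
    (K : Compacts E) : Continuous fun φ : 𝓓_{K}(E, ℝ) => A fun x => (φ x : ℂ) := by
  have isTest (φ : 𝓓_{K}(E, ℝ)) : IsTest φ := ⟨φ.contDiff, φ.hasCompactSupport⟩
  obtain ⟨M, C, hC, hAC⟩ := hA.exists_bound K K.isCompact
  exact (ContDiffMapSupportedIn.mkCLMtoNormedSpace (𝕜 := ℝ)
    (fun φ : 𝓓_{K}(E, ℝ) => A fun x => (φ x : ℂ))
    (fun φ χ => hA.map_ofReal_add (isTest φ) (isTest χ)) (fun c φ => hA.map_ofReal_mul (isTest φ) c)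
    ⟨Finset.range (M + 1), C, hC, fun φ => hAC _ (isTest φ).ofReal
      ((tsupport_comp_subset Complex.ofReal_zero φ).trans φ.tsupport_subset) _
      (hasDerivBound_ofReal K φ M)⟩).cont

/-- The distribution whose pairing with test functions is `A`. -/
def ofFunctional (A : (E → ℂ) → ℂ) (hA : IsDistributional A) : Distr E :=
  ContinuousLinearMap.toUniformConvergenceCLM (RingHom.id ℝ) ℂ {S : Set (Test E) | IsCompact S} <|
    TestFunction.mkCLM ℝ (fun φ => A fun x => (φ x : ℂ))
      (fun φ χ => hA.map_ofReal_add (isTest_test φ) (isTest_test χ))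
      (fun c φ => hA.map_ofReal_mul (isTest_test φ) c) fun K _ => hA.continuous_ofReal K

theorem pair_ofFunctional {A : (E → ℂ) → ℂ} (hA : IsDistributional A) {ψ : E → ℂ}
    (h : IsTest ψ) : pair (ofFunctional A hA) ψ = A ψ := by
  have apply_eq (φ : Test E) : ofFunctional A hA φ = A fun x => (φ x : ℂ) := rfl
  rw [pair_eq _ h, apply_eq, apply_eq, ← hA.map_const_mul _ _ (isTest_test _).ofReal,
    ← hA.map_add _ _ (isTest_test _).ofReal ((isTest_test _).ofReal.const_mul _)]
  congr 1
  ext x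
  simp only [toTest_apply]
  rw [mul_comm]
  exact Complex.re_add_im _

theorem HasDerivBound.mul {ψ m : E → ℂ} (hψ : IsTest ψ) (hm : ContDiff ℝ ∞ m) {M : ℕ} {B C : ℝ}
    (hC : 0 ≤ C) (hB : HasDerivBound M ψ B)
    (hmC : ∀ i ≤ M, ∀ x ∈ tsupport ψ, ‖iteratedFDeriv ℝ i m x‖ ≤ C) :
    HasDerivBound M (fun x => ψ x * m x) (2 ^ M * C * B) := by
  intro i hi x
  have hB0 := hB.nonneg
  by_cases hx : x ∈ tsupport ψ
  · calc ‖iteratedFDeriv ℝ i (fun x => ψ x * m x) x‖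
        ≤ ∑ j ∈ Finset.range (i + 1), (i.choose j : ℝ) * ‖iteratedFDeriv ℝ j ψ x‖ *
          ‖iteratedFDeriv ℝ (i - j) m x‖ :=
          norm_iteratedFDeriv_mul_le hψ.smooth hm x (by exact_mod_cast le_top)
      _ ≤ ∑ j ∈ Finset.range (i + 1), (i.choose j : ℝ) * B * C := by
          gcongr with j hj
          · exact hB j ((Finset.mem_range_succ_iff.1 hj).trans hi) x
          · exact hmC _ ((Nat.sub_le i j).trans hi) x hx
      _ = 2 ^ i * C * B := by
          rw [← Finset.sum_mul, ← Finset.sum_mul, ← Nat.cast_sum, Nat.sum_range_choose]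
          push_cast
          ring
      _ ≤ 2 ^ M * C * B := by
          gcongr
          exact one_le_two
  · have notMem_tsupport : x ∉ tsupport (iteratedFDeriv ℝ i fun x => ψ x * m x) := fun h =>
      hx (tsupport_mul_subset_left (tsupport_iteratedFDeriv_subset i h))
    rw [image_eq_zero_of_notMem_tsupport notMem_tsupport, norm_zero]
    positivity

theorem exists_bound_iteratedFDeriv_on {m : E → ℂ} (hm : ContDiff ℝ ∞ m) {K : Set E}
    (hK : IsCompact K) (M : ℕ) :
    ∃ C, 0 ≤ C ∧ ∀ i ≤ M, ∀ y ∈ K, ‖iteratedFDeriv ℝ i m y‖ ≤ C := by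
  have exists_bound (i : ℕ) : ∃ C, 0 ≤ C ∧ ∀ y ∈ K, ‖iteratedFDeriv ℝ i m y‖ ≤ C := by
    obtain ⟨C, hC⟩ := hK.exists_bound_of_continuousOn
      (hm.continuous_iteratedFDeriv (m := i) (by exact_mod_cast le_top)).continuousOn
    exact ⟨max C 0, le_max_right _ _, fun y hy => (hC y hy).trans (le_max_left _ _)⟩
  choose C hC0 hC using exists_bound
  exact ⟨∑ i ∈ Finset.range (M + 1), C i, Finset.sum_nonneg fun i _ => hC0 i, fun i hi y hy =>
    (hC i y hy).trans (Finset.single_le_sum (fun i _ => hC0 i) (Finset.mem_range_succ_iff.2 hi))⟩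

theorem isDistributional_mul (u : Distr E) {m : E → ℂ} (hm : ContDiff ℝ ∞ m) :
    IsDistributional fun ψ => pair u fun x => ψ x * m x where
  map_add ψ χ h h' := by
    rw [← pair_add u (h.mul hm) (h'.mul hm)]
    simp_rw [add_mul]
  map_const_mul c ψ h := by
    rw [← pair_const_mul u (h.mul hm)]
    simp_rw [mul_assoc]
  exists_bound K hK := by
    obtain ⟨M, C, hC, huC⟩ := exists_bound_pair u hK
    obtain ⟨C', hC', hmC'⟩ := exists_bound_iteratedFDeriv_on hm hK M
    refine ⟨M, C * (2 ^ M * C'), by positivity, fun ψ h hψK B hB => ?_⟩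
    rw [mul_assoc]
    exact huC _ (h.mul hm) (tsupport_mul_subset_left.trans hψK) _ <|
      hB.mul h hm hC' fun i hi x hx => hmC' i hi x (hψK hx)

/-- The product of a distribution and a smooth function. -/
def mulDistr (u : Distr E) (m : E → ℂ) (hm : ContDiff ℝ ∞ m) : Distr E :=
  ofFunctional _ (isDistributional_mul u hm)

theorem pair_mulDistr (u : Distr E) {m : E → ℂ} (hm : ContDiff ℝ ∞ m) {ψ : E → ℂ}
    (h : IsTest ψ) : pair (mulDistr u m hm) ψ = pair u fun x => ψ x * m x :=
  pair_ofFunctional _ h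

theorem pair_add_distr (u v : Distr E) {ψ : E → ℂ} (h : IsTest ψ) :
    pair (u + v) ψ = pair u ψ + pair v ψ := by
  have add_apply (φ : Test E) : (u + v) φ = u φ + v φ := rfl
  rw [pair_eq _ h, pair_eq _ h, pair_eq _ h, add_apply, add_apply]
  ring

theorem tsupport_pair_slice_subset {X : Type*} [TopologicalSpace X] [T2Space X] (u : Distr E)
    {Ψ : X × E → ℂ} (h : HasCompactSupport Ψ) :
    tsupport (fun x => pair u fun y => Ψ (x, y)) ⊆ Prod.fst '' tsupport Ψ :=
  closure_minimal (fun x hx => by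
    by_contra hx'
    exact hx (by simp only [slice_eq_zero hx', pair_zero]))
    (h.isCompact.image continuous_fst).isClosed

theorem exists_hasDerivBound_pair_slice [FiniteDimensional ℝ X] (u : Distr E) {K : Set E}
    (hK : IsCompact K) (M : ℕ) :
    ∃ (N : ℕ) (C : ℝ), 0 ≤ C ∧ ∀ Ψ : X × E → ℂ, IsTest Ψ → Prod.snd '' tsupport Ψ ⊆ K →
      ∀ B, HasDerivBound N Ψ B → HasDerivBound M (fun x => pair u fun y => Ψ (x, y)) (C * B) := by
  choose N C hC huC using fun k : ℕ => exists_bound_pair_slice (X := X) u hK k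
  refine ⟨∑ k ∈ Finset.range (M + 1), N k, ∑ k ∈ Finset.range (M + 1), C k,
    Finset.sum_nonneg fun k _ => hC k, fun Ψ h hΨK B hB k hk x => ?_⟩
  have hk' : k ∈ Finset.range (M + 1) := Finset.mem_range_succ_iff.2 hk
  refine (huC k Ψ h hΨK B (fun i hi => hB i (hi.trans ?_)) x).trans ?_
  · exact Finset.single_le_sum (fun _ _ => Nat.zero_le _) hk'
  · exact mul_le_mul_of_nonneg_right (Finset.single_le_sum (fun i _ => hC i) hk') hB.nonneg

theorem isDistributional_tensor [FiniteDimensional ℝ X] (f : Distr X) (g : Distr E) :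
    IsDistributional fun Ψ : X × E → ℂ => pair f fun x => pair g fun y => Ψ (x, y) where
  map_add Ψ Φ h h' := by
    rw [← pair_add f (h.pair_slice g) (h'.pair_slice g)]
    simp_rw [fun x => pair_add g (h.slice x) (h'.slice x)]
  map_const_mul c Ψ h := by
    rw [← pair_const_mul f (h.pair_slice g)]
    simp_rw [fun x => pair_const_mul g (h.slice x)]
  exists_bound K hK := by
    obtain ⟨M, C, hC, hfC⟩ := exists_bound_pair f (hK.image continuous_fst)
    obtain ⟨N, D, hD, hgD⟩ :=
      exists_hasDerivBound_pair_slice (X := X) g (hK.image continuous_snd) M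
    refine ⟨N, C * D, mul_nonneg hC hD, fun Ψ h hΨK B hB => ?_⟩
    rw [mul_assoc]
    exact hfC _ (h.pair_slice g) ((tsupport_pair_slice_subset g h.compact).trans
      (image_mono hΨK)) _ (hgD Ψ h (image_mono hΨK) B hB)

/-- The tensor product of two distributions. -/
def tensorDistr [FiniteDimensional ℝ X] (f : Distr X) (g : Distr E) : Distr (X × E) :=
  ofFunctional _ (isDistributional_tensor f g)

theorem pair_tensorDistr [FiniteDimensional ℝ X] (f : Distr X) (g : Distr E) {Ψ : X × E → ℂ}
    (h : IsTest Ψ) : pair (tensorDistr f g) Ψ = pair f fun x => pair g fun y => Ψ (x, y) :=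
  pair_ofFunctional _ h

theorem IsTest.tensor {A : Type*} [NormedRing A] [NormedAlgebra ℝ A] {ψ : X → A} {χ : E → A}
    (h : IsTest ψ) (h' : IsTest χ) : IsTest (fun z : X × E => ψ z.1 * χ z.2) where
  smooth := (h.smooth.comp contDiff_fst).mul (h'.smooth.comp contDiff_snd)
  compact := .intro (h.compact.isCompact.prod h'.compact.isCompact) fun z hz => by
    by_cases h1 : z.1 ∈ tsupport ψ
    · have h2 : z.2 ∉ tsupport χ := fun h2 => hz ⟨h1, h2⟩
      simp [image_eq_zero_of_notMem_tsupport h2]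
    · simp [image_eq_zero_of_notMem_tsupport h1]

theorem ofReal_tensorTest (φ ψ : Test E) :
    (fun z : E × E => ((tensorTest φ ψ z : ℝ) : ℂ)) = fun z => (φ z.1 : ℂ) * (ψ z.2 : ℂ) :=
  funext fun _ => Complex.ofReal_mul _ _

theorem IsTensorProduct.pair_tensor {f g : Distr E} {T : Distr (E × E)}
    (hT : IsTensorProduct f g T) {φ ψ : E → ℝ} (hφ : IsTest φ) (hψ : IsTest ψ) :
    pair T (fun z => (φ z.1 : ℂ) * (ψ z.2 : ℂ)) =
      pair f (fun x => (φ x : ℂ)) * pair g (fun x => (ψ x : ℂ)) := by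
  have tensor_apply := hT (toTest φ hφ) (toTest ψ hψ)
  rw [← pair_ofReal, ← pair_ofReal, ← pair_ofReal] at tensor_apply
  rwa [ofReal_tensorTest] at tensor_apply

theorem isTensorProduct_tensorDistr [FiniteDimensional ℝ E] (f g : Distr E) :
    IsTensorProduct f g (tensorDistr f g) := by
  intro φ ψ
  have hφ := (isTest_test φ).ofReal
  have hψ := (isTest_test ψ).ofReal
  rw [← pair_ofReal, ofReal_tensorTest, pair_tensorDistr f g (hφ.tensor hψ)]
  simp_rw [fun x => pair_const_mul g hψ (φ x : ℂ), pair_ofReal, mul_comm _ (g ψ)]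
  rw [pair_const_mul f hφ, pair_ofReal, mul_comm]

end Construction

section Exponentials

variable {E : Type*} [NormedAddCommGroup E] [NormedSpace ℝ E]

theorem hasDerivAt_cexp_neg_I_mul (t : ℝ) :
    HasDerivAt (fun t : ℝ => Complex.exp (-(Complex.I * t)))
      (-Complex.I * Complex.exp (-(Complex.I * t))) t := by
  have hasDerivAt_exponent : HasDerivAt (fun t : ℝ => -(Complex.I * (t : ℂ))) (-Complex.I) t :=
    ((Complex.ofRealCLM.hasDerivAt (x := t)).const_mul Complex.I).neg.congr_deriv (by simp)
  exact hasDerivAt_exponent.cexp.congr_deriv (mul_comm _ _)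

theorem iteratedDeriv_cexp_neg_I_mul (i : ℕ) :
    iteratedDeriv i (fun t : ℝ => Complex.exp (-(Complex.I * t))) =
      fun t : ℝ => (-Complex.I) ^ i * Complex.exp (-(Complex.I * t)) := by
  induction i with
  | zero => simp
  | succ i ih =>
    rw [iteratedDeriv_succ, ih]
    ext t
    rw [((hasDerivAt_cexp_neg_I_mul t).const_mul _).deriv, pow_succ, mul_assoc]

theorem norm_iteratedFDeriv_expChar_le (ξ : E →L[ℝ] ℝ) (i : ℕ) (x : E) :
    ‖iteratedFDeriv ℝ i (expChar ξ) x‖ ≤ ‖ξ‖ ^ i := by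
  have contDiff_cexp : ContDiff ℝ ∞ fun t : ℝ => Complex.exp (-(Complex.I * (t : ℂ))) :=
    (contDiff_const.mul Complex.ofRealCLM.contDiff).neg.cexp
  have norm_iteratedFDeriv_cexp (t : ℝ) :
      ‖iteratedFDeriv ℝ i (fun t : ℝ => Complex.exp (-(Complex.I * t))) t‖ = 1 := by
    have exponent_eq : -(Complex.I * t) = ((-t : ℝ) : ℂ) * Complex.I := by
      push_cast
      ring
    rw [norm_iteratedFDeriv_eq_norm_iteratedDeriv, iteratedDeriv_cexp_neg_I_mul]
    beta_reduce
    rw [exponent_eq, norm_mul, Complex.norm_exp_ofReal_mul_I, mul_one, norm_pow, norm_neg,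
      Complex.norm_I, one_pow]
  have comp_le := norm_iteratedFDeriv_comp_affine_le contDiff_cexp ξ 0 i x
  simp only [zero_add, norm_iteratedFDeriv_cexp, one_mul] at comp_le
  exact comp_le

theorem exists_bound_pair_expChar (u : Distr E) {K : Set E} (hK : IsCompact K) :
    ∃ (M : ℕ) (C : ℝ), 0 ≤ C ∧ ∀ ψ : E → ℂ, IsTest ψ → tsupport ψ ⊆ K → ∀ B, HasDerivBound M ψ B →
      ∀ ξ : E →L[ℝ] ℝ, ‖pair u (fun x => ψ x * expChar ξ x)‖ ≤ C * B * (1 + ‖ξ‖) ^ M := by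
  obtain ⟨M, C, hC, huC⟩ := exists_bound_pair u hK
  refine ⟨M, C * 2 ^ M, by positivity, fun ψ h hψK B hB ξ => ?_⟩
  have expChar_bound (i : ℕ) (hi : i ≤ M) (x : E) :
      ‖iteratedFDeriv ℝ i (expChar ξ) x‖ ≤ (1 + ‖ξ‖) ^ M :=
    calc ‖iteratedFDeriv ℝ i (expChar ξ) x‖ ≤ ‖ξ‖ ^ i := norm_iteratedFDeriv_expChar_le ξ i x
      _ ≤ (1 + ‖ξ‖) ^ i := by gcongr; linarith
      _ ≤ (1 + ‖ξ‖) ^ M := pow_le_pow_right₀ (by linarith [norm_nonneg ξ]) hi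
  refine (huC _ (h.mul (contDiff_expChar ξ)) (tsupport_mul_subset_left.trans hψK) _ <|
    hB.mul h (contDiff_expChar ξ) (by positivity) fun i hi x _ => expChar_bound i hi x).trans_eq ?_
  ring

end Exponentials

section Density

variable {E : Type*} [NormedAddCommGroup E] [NormedSpace ℝ E] [MeasureSpace E] [BorelSpace E]
  [IsLocallyFiniteMeasure (volume : Measure E)]

theorem integrable_mul_of_continuousOn {ψ a : E → ℂ} (h : IsTest ψ)
    (ha : ContinuousOn a (tsupport ψ)) : Integrable (fun x => ψ x * a x) := by
  have integrableOn_tsupport : IntegrableOn (fun x => ψ x * a x) (tsupport ψ) :=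
    (h.continuous.continuousOn.mul ha).integrableOn_compact h.compact
  refine (integrableOn_iff_integrable_of_support_subset fun x hx => ?_).1 integrableOn_tsupport
  exact subset_tsupport _ (left_ne_zero_of_mul hx)

theorem pair_eq_integral_of_forall_test {u : Distr E} {U : Set E} {a : E → ℂ}
    (ha : ContinuousOn a U)
    (hua : ∀ φ : Test E, tsupport φ ⊆ U → u φ = ∫ y, φ y • a y) {ψ : E → ℂ} (h : IsTest ψ)
    (hψU : tsupport ψ ⊆ U) : pair u ψ = ∫ y, ψ y * a y := by
  have re_subset : tsupport (fun x => (ψ x).re) ⊆ U :=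
    (tsupport_comp_subset Complex.zero_re _).trans hψU
  have im_subset : tsupport (fun x => (ψ x).im) ⊆ U :=
    (tsupport_comp_subset Complex.zero_im _).trans hψU
  have integrable_ofReal_mul (φ : E → ℝ) (hφ : IsTest φ) (hφU : tsupport φ ⊆ U) :
      Integrable fun x => (φ x : ℂ) * a x :=
    integrable_mul_of_continuousOn hφ.ofReal
      (ha.mono ((tsupport_comp_subset Complex.ofReal_zero _).trans hφU))
  rw [pair_eq u h, hua _ re_subset, hua _ im_subset, ← integral_const_mul]
  simp only [toTest_apply, Complex.real_smul]
  rw [← integral_add (integrable_ofReal_mul _ h.re re_subset)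
    ((integrable_ofReal_mul _ h.im im_subset).const_mul _)]
  refine integral_congr_ae (ae_of_all _ fun x => ?_)
  simp only
  conv_rhs => rw [← Complex.re_add_im (ψ x)]
  ring

theorem pair_ofFunction {w : E → ℂ} (hw : Continuous w) {ψ : E → ℂ} (h : IsTest ψ) :
    pair (ofFunction w) ψ = ∫ x, ψ x * w x :=
  pair_eq_integral_of_forall_test hw.continuousOn (fun φ _ => ofFunction_apply hw φ) h
    (subset_univ _)

end Density

section Mollification

variable {X E G : Type*} [NormedAddCommGroup X] [NormedSpace ℝ X] [NormedAddCommGroup E]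
  [NormedSpace ℝ E] [NormedAddCommGroup G] [NormedSpace ℝ G]

theorem IsTest.comp_equiv {ψ : E → G} (h : IsTest ψ) (e : X ≃L[ℝ] E) :
    IsTest (fun x => ψ (e x)) where
  smooth := h.smooth.comp e.contDiff
  compact := h.compact.comp_homeomorph e.toHomeomorph

theorem IsTest.comp_add_right {ψ : E → G} (h : IsTest ψ) (s : E) : IsTest (fun y => ψ (y + s)) where
  smooth := h.smooth.comp (contDiff_id.add contDiff_const)
  compact := h.compact.comp_homeomorph (Homeomorph.addRight s)

theorem IsTest.comp_sub_left {ψ : E → G} (h : IsTest ψ) (s : E) : IsTest (fun y => ψ (s - y)) where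
  smooth := h.smooth.comp (contDiff_const.sub contDiff_id)
  compact := h.compact.comp_homeomorph (Homeomorph.subLeft s)

theorem IsTest.mul_comp_sub {ψ χ : E → ℂ} (h : IsTest ψ) (h' : IsTest χ) :
    IsTest (fun z : E × E => ψ z.1 * χ (z.1 - z.2)) := by
  simpa [neg_add_eq_sub] using (h.tensor h').comp_equiv
    ((ContinuousLinearEquiv.refl ℝ E).skewProd (.neg ℝ) (.id ℝ E))

theorem IsTest.mul_comp_add {ψ : X → ℂ} {χ : E → ℂ} (h : IsTest ψ) (h' : IsTest χ) (A : X →L[ℝ] E) :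
    IsTest (fun z : X × E => ψ z.1 * χ (z.2 + A z.1)) :=
  (h.tensor h').comp_equiv ((ContinuousLinearEquiv.refl ℝ X).skewProd (.refl ℝ E) A)

theorem distr_ext {u v : Distr E} (h : ∀ ψ, IsTest ψ → pair u ψ = pair v ψ) : u = v := by
  refine DFunLike.ext u v fun φ => ?_
  rw [← pair_ofReal, ← pair_ofReal, h _ (isTest_test φ).ofReal]

/-- A sequence of smooth probability densities concentrating at the origin. -/
structure IsMollifier [MeasureSpace E] (R : ℕ → E → ℝ) : Prop where
  test : ∀ j, IsTest (R j)
  nonneg : ∀ j z, 0 ≤ R j z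
  integral_eq_one : ∀ j, ∫ z, R j z = 1
  support : ∀ δ : ℝ, 0 < δ → ∀ᶠ j in atTop, ∀ z, R j z ≠ 0 → ‖z‖ < δ

/-- The mollification (convolution) of a distribution by a density. -/
def mollify (u : Distr E) (r : E → ℝ) (x : E) : ℂ := pair u (fun y => (r (x - y) : ℂ))

theorem IsTensorProduct.mollify_eq {f g : Distr E} {T : Distr (E × E)} (hT : IsTensorProduct f g T)
    {r : E → ℝ} (hr : IsTest r) :
    mollify T (fun z => r z.1 * r z.2) = fun z => mollify f r z.1 * mollify g r z.2 := by
  ext z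
  rw [mollify, mollify, mollify, ← hT.pair_tensor (hr.comp_sub_left z.1) (hr.comp_sub_left z.2)]
  simp only [Prod.fst_sub, Prod.snd_sub, Complex.ofReal_mul]

variable [FiniteDimensional ℝ E]

theorem exists_contDiff_zero_one_nhdsSet {s t : Set E} (hs : IsClosed s) (ht : IsClosed t)
    (hst : Disjoint s t) : ∃ h : E → ℝ, ContDiff ℝ ∞ h ∧ (∀ᶠ y in 𝓝ˢ s, h y = 0) ∧
      ∀ᶠ y in 𝓝ˢ t, h y = 1 := by
  obtain ⟨h, h0, h1, -⟩ :=
    exists_contMDiffMap_zero_one_nhds_of_isClosed (modelWithCornersSelf ℝ E) (n := ⊤) hs ht hst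
  exact ⟨h, h.contMDiff.contDiff, h0, h1⟩

theorem exists_isTest_eq_one_nhdsSet {K U : Set E} (hK : IsCompact K) (hU : IsOpen U)
    (hKU : K ⊆ U) : ∃ χ : E → ℝ, IsTest χ ∧ tsupport χ ⊆ U ∧ ∀ᶠ y in 𝓝ˢ K, χ y = 1 := by
  obtain ⟨L, hL, hKL, hLU⟩ := exists_compact_between hK hU hKU
  obtain ⟨χ, hχ1, hχ0, -⟩ := exists_contMDiffMap_one_nhds_of_subset_interior
    (modelWithCornersSelf ℝ E) (n := ⊤) hK.isClosed hKL
  have tsupport_subset : tsupport χ ⊆ L := closure_minimal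
    (fun y hy => by_contra fun hyL => hy (hχ0 y hyL)) hL.isClosed
  exact ⟨χ, ⟨χ.contMDiff.contDiff, hL.of_isClosed_subset (isClosed_tsupport _) tsupport_subset⟩,
    tsupport_subset.trans hLU, hχ1⟩

theorem exists_isTest_eventually_eq_one (x : E) :
    ∃ χ : E → ℝ, IsTest χ ∧ ∀ᶠ y in 𝓝 x, χ y = 1 := by
  obtain ⟨χ, hχ, -, hχ1⟩ := exists_isTest_eq_one_nhdsSet (isCompact_singleton (x := x)) isOpen_univ
    (subset_univ _)
  exact ⟨χ, hχ, by rwa [nhdsSet_singleton] at hχ1⟩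

theorem contDiff_pair_slice (u : Distr X) {Ψ : E × X → ℂ}
    (h : ∀ χ : E → ℝ, IsTest χ → IsTest fun z : E × X => (χ z.1 : ℂ) * Ψ z) :
    ContDiff ℝ ∞ fun x => pair u fun y => Ψ (x, y) := by
  rw [contDiff_iff_contDiffAt]
  intro x
  obtain ⟨χ, hχ, hχ1⟩ := exists_isTest_eventually_eq_one x
  refine ((h χ hχ).pair_slice u).smooth.contDiffAt.congr_of_eventuallyEq ?_
  filter_upwards [hχ1] with y hy
  simp [hy]

theorem contDiff_mollify (u : Distr E) {r : E → ℝ} (hr : IsTest r) :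
    ContDiff ℝ ∞ (mollify u r) :=
  contDiff_pair_slice u (Ψ := fun z : E × E => (r (z.1 - z.2) : ℂ)) fun _ hχ =>
    hχ.ofReal.mul_comp_sub hr.ofReal

theorem continuous_pair_translate (u : Distr E) {ψ : E → ℂ} (h : IsTest ψ) :
    Continuous (fun s => pair u (fun y => ψ (y + s))) :=
  (contDiff_pair_slice u (Ψ := fun z : E × E => ψ (z.2 + z.1)) fun _ hχ =>
    hχ.ofReal.mul_comp_add h (.id ℝ E)).continuous

variable [MeasureSpace E] [BorelSpace E] [(volume : Measure E).IsAddHaarMeasure]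

theorem pair_ofFunction_mollify (u : Distr E) {r : E → ℝ} (hr : IsTest r) {ψ : E → ℂ}
    (h : IsTest ψ) :
    pair (ofFunction (mollify u r)) ψ = ∫ s, (r s : ℂ) * pair u (fun y => ψ (y + s)) := by
  have integral_translate (y : E) :
      ∫ x, ψ x * (r (x - y) : ℂ) = ∫ s, (r s : ℂ) * ψ (y + s) := by
    rw [← integral_add_left_eq_self (μ := volume) _ y]
    simp [mul_comm]
  calc pair (ofFunction (mollify u r)) ψ
      = ∫ x, pair u (fun y => ψ x * (r (x - y) : ℂ)) := by
        rw [pair_ofFunction (contDiff_mollify u hr).continuous h]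
        simp_rw [fun x => pair_const_mul u (hr.ofReal.comp_sub_left x) (ψ x), mollify]
    _ = pair u (fun y => ∫ x, ψ x * (r (x - y) : ℂ)) :=
        (pair_integral volume u (h.mul_comp_sub hr.ofReal)).symm
    _ = pair u (fun y => ∫ s, (r s : ℂ) * ψ (y + s)) := by simp_rw [integral_translate]
    _ = ∫ s, pair u (fun y => (r s : ℂ) * ψ (y + s)) :=
        pair_integral volume u (hr.ofReal.mul_comp_add h (.id ℝ E))
    _ = ∫ s, (r s : ℂ) * pair u (fun y => ψ (y + s)) := by
        simp_rw [fun s => pair_const_mul u (h.comp_add_right s) (r s : ℂ)]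

omit [FiniteDimensional ℝ E] in
theorem IsMollifier.norm_integral_sub_le {R : ℕ → E → ℝ} (hR : IsMollifier R) (j : ℕ) {h : E → ℂ}
    (hh : Continuous h) (c : ℂ) {ε : ℝ} (hε : ∀ z, R j z ≠ 0 → ‖h z - c‖ ≤ ε) :
    ‖(∫ z, (R j z : ℂ) * h z) - c‖ ≤ ε := by
  have integral_mul_const_eq : ∫ z, (R j z : ℂ) * c = c := by
    rw [integral_mul_const, integral_complex_ofReal, hR.integral_eq_one, Complex.ofReal_one,
      one_mul]
  have integrable_mul (g : E → ℂ) (hg : Continuous g) : Integrable (fun z => (R j z : ℂ) * g z) :=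
    ((hR.test j).ofReal.continuous.mul hg).integrable_of_hasCompactSupport
      (hR.test j).ofReal.compact.mul_right
  have integrable_density : Integrable (R j) :=
    (hR.test j).continuous.integrable_of_hasCompactSupport (hR.test j).compact
  calc ‖(∫ z, (R j z : ℂ) * h z) - c‖ = ‖∫ z, ((R j z : ℂ) * h z - (R j z : ℂ) * c)‖ := by
        rw [integral_sub (integrable_mul _ hh) (integrable_mul _ continuous_const),
          integral_mul_const_eq]
    _ ≤ ∫ z, R j z * ε := by
        refine norm_integral_le_of_norm_le (integrable_density.mul_const ε) ?_
        refine ae_of_all _ fun z => ?_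
        rw [← mul_sub, norm_mul, Complex.norm_real, Real.norm_of_nonneg (hR.nonneg j z)]
        by_cases hz : R j z = 0
        · simp [hz]
        · exact mul_le_mul_of_nonneg_left (hε z hz) (hR.nonneg j z)
    _ = ε := by rw [integral_mul_const, hR.integral_eq_one, one_mul]

omit [FiniteDimensional ℝ E] in
theorem IsMollifier.tendsto_integral {R : ℕ → E → ℝ} (hR : IsMollifier R) {h : E → ℂ}
    (hh : Continuous h) : Tendsto (fun j => ∫ z, (R j z : ℂ) * h z) atTop (𝓝 (h 0)) := by
  rw [Metric.tendsto_nhds]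
  intro ε hε
  obtain ⟨δ, hδ, dist_lt⟩ := Metric.continuousAt_iff.1 (hh.continuousAt (x := 0)) (ε / 2)
    (half_pos hε)
  filter_upwards [hR.support δ hδ] with j hj
  rw [dist_eq_norm]
  refine (hR.norm_integral_sub_le j hh _ fun z hz => ?_).trans_lt (half_lt_self hε)
  rw [← dist_eq_norm]
  exact (dist_lt (by simpa using hj z hz)).le

theorem IsMollifier.tendsto_pair {R : ℕ → E → ℝ} (hR : IsMollifier R) (u : Distr E) {ψ : E → ℂ}
    (h : IsTest ψ) :
    Tendsto (fun j => pair (ofFunction (mollify u (R j))) ψ) atTop (𝓝 (pair u ψ)) := by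
  simp_rw [fun j => pair_ofFunction_mollify u (hR.test j) h]
  simpa using hR.tendsto_integral (continuous_pair_translate u h)

omit [BorelSpace E] in
theorem IsMollifier.prod {R : ℕ → E → ℝ} (hR : IsMollifier R) :
    IsMollifier (fun j (z : E × E) => R j z.1 * R j z.2) where
  test j := (hR.test j).tensor (hR.test j)
  nonneg j z := mul_nonneg (hR.nonneg j _) (hR.nonneg j _)
  integral_eq_one j := by
    rw [Measure.volume_eq_prod, integral_prod_mul, hR.integral_eq_one, one_mul]
  support δ hδ := by
    filter_upwards [hR.support δ hδ] with j hj z hz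
    rw [Prod.norm_def, max_lt_iff]
    exact ⟨hj _ (left_ne_zero_of_mul hz), hj _ (right_ne_zero_of_mul hz)⟩

variable (E) in
theorem exists_isMollifier : ∃ R : ℕ → E → ℝ, IsMollifier R := by
  let bump (j : ℕ) : ContDiffBump (0 : E) :=
    ⟨((j : ℝ) + 2)⁻¹, ((j : ℝ) + 1)⁻¹, by positivity, by gcongr; norm_num⟩
  refine ⟨fun j => (bump j).normed volume,
    fun j => ⟨(bump j).contDiff_normed, (bump j).hasCompactSupport_normed⟩,
    fun j z => (bump j).nonneg_normed z, fun j => (bump j).integral_normed, fun δ hδ => ?_⟩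
  have tendsto_radius : Tendsto (fun j : ℕ => ((j : ℝ) + 1)⁻¹) atTop (𝓝 0) := by
    simpa using tendsto_one_div_add_atTop_nhds_zero_nat (𝕜 := ℝ)
  filter_upwards [tendsto_radius.eventually (gt_mem_nhds hδ)] with j hj z hz
  have mem_support : z ∈ Function.support ((bump j).normed volume) := hz
  rw [(bump j).support_normed_eq, mem_ball_zero_iff] at mem_support
  exact mem_support.trans hj

instance : (volume : Measure (E × E)).IsAddHaarMeasure :=
  inferInstanceAs (((volume : Measure E).prod (volume : Measure E)).IsAddHaarMeasure)

theorem IsTensorProduct.unique {f g : Distr E} {T T' : Distr (E × E)}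
    (hT : IsTensorProduct f g T) (hT' : IsTensorProduct f g T') : T = T' := by
  obtain ⟨R, hR⟩ := exists_isMollifier E
  refine distr_ext fun ψ h => tendsto_nhds_unique (hR.prod.tendsto_pair T h) ?_
  have tendsto_pair := hR.prod.tendsto_pair T' h
  simp_rw [hT'.mollify_eq (hR.test _), ← hT.mollify_eq (hR.test _)] at tendsto_pair
  exact tendsto_pair

end Mollification

section SingularSupport

variable {E : Type*} [NormedAddCommGroup E] [NormedSpace ℝ E]

theorem isTest_sum {ι : Type*} (I : Finset ι) {ψ : ι → E → ℂ} (h : ∀ i ∈ I, IsTest (ψ i)) :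
    IsTest (fun x => ∑ i ∈ I, ψ i x) := by
  classical
  induction I using Finset.induction_on with
  | empty => simpa using isTest_zero
  | insert i I hi ih =>
    simp_rw [Finset.sum_insert hi]
    exact (h i (Finset.mem_insert_self i I)).add
      (ih fun j hj => h j (Finset.mem_insert_of_mem hj))

theorem pair_sum (u : Distr E) {ι : Type*} (I : Finset ι) {ψ : ι → E → ℂ}
    (h : ∀ i ∈ I, IsTest (ψ i)) :
    pair u (fun x => ∑ i ∈ I, ψ i x) = ∑ i ∈ I, pair u (ψ i) := by
  classical
  induction I using Finset.induction_on with
  | empty => simpa using pair_zero u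
  | insert i I hi ih =>
    have isTest_of_mem (j : ι) (hj : j ∈ I) : IsTest (ψ j) := h j (Finset.mem_insert_of_mem hj)
    simp_rw [Finset.sum_insert hi]
    rw [pair_add u (h i (Finset.mem_insert_self i I)) (isTest_sum I isTest_of_mem),
      ih isTest_of_mem]

variable [MeasureSpace E]

theorem isClosed_singularSupport (u : Distr E) : IsClosed (singularSupport u) := by
  rw [← isOpen_compl_iff, isOpen_iff_mem_nhds]
  intro x hx
  obtain ⟨U, hU, hxU, a, ha, hua⟩ := not_not.1 hx
  exact mem_of_superset (hU.mem_nhds hxU) fun y hy => not_not.2 ⟨U, hU, hy, a, ha, hua⟩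

/-- The distribution `u` coincides with the function `a` on a neighbourhood of the set `s`. -/
def EqNear (u : Distr E) (a : E → ℂ) (s : Set E) : Prop :=
  ∃ O, IsOpen O ∧ s ⊆ O ∧ ∀ ψ, IsTest ψ → tsupport ψ ⊆ O → pair u ψ = ∫ y, ψ y * a y

theorem EqNear.mono {u : Distr E} {a : E → ℂ} {s t : Set E} (h : EqNear u a t) (hst : s ⊆ t) :
    EqNear u a s :=
  let ⟨O, hO, htO, hua⟩ := h
  ⟨O, hO, hst.trans htO, hua⟩

variable [BorelSpace E] [IsLocallyFiniteMeasure (volume : Measure E)]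

theorem pair_eq_integral_finsum (u : Distr E) {ι : Type*} {s : Set E} {U : ι → Set E}
    {a : ι → E → ℂ} (ha : ∀ i, ContinuousOn (a i) (U i))
    (hua : ∀ i ψ, IsTest ψ → tsupport ψ ⊆ U i → pair u ψ = ∫ y, ψ y * a i y)
    (θ : SmoothPartitionOfUnity ι (modelWithCornersSelf ℝ E) E s) (hθ : θ.IsSubordinate U)
    {ψ : E → ℂ} (h : IsTest ψ) (hψs : tsupport ψ ⊆ s) :
    pair u ψ = ∫ y, ψ y * ∑ᶠ i, θ i y • a i y := by
  have finite_index : {i | (Function.support (θ i) ∩ tsupport ψ).Nonempty}.Finite :=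
    θ.locallyFinite.finite_nonempty_inter_compact h.compact
  let I := finite_index.toFinset
  have mem_index {y : E} (hy : y ∈ tsupport ψ) (i : ι) (hi : θ i y ≠ 0) : i ∈ I :=
    finite_index.mem_toFinset.2 ⟨y, hi, hy⟩
  have isTest_piece (i : ι) : IsTest (fun y => ψ y * (θ i y : ℂ)) :=
    h.mul (Complex.ofRealCLM.contDiff.comp (θ i).contMDiff.contDiff)
  have tsupport_piece (i : ι) : tsupport (fun y => ψ y * (θ i y : ℂ)) ⊆ U i :=
    (tsupport_mul_subset_right.trans (tsupport_comp_subset Complex.ofReal_zero _)).trans (hθ i)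
  have eq_sum_pieces : ψ = fun y => ∑ i ∈ I, ψ y * (θ i y : ℂ) := by
    ext y
    by_cases hy : y ∈ tsupport ψ
    · have sum_eq_one := θ.sum_eq_one (hψs hy)
      rw [finsum_eq_sum_of_support_subset _ (s := I) (mem_index hy)] at sum_eq_one
      rw [← Finset.mul_sum, ← Complex.ofReal_sum, sum_eq_one, Complex.ofReal_one, mul_one]
    · simp [image_eq_zero_of_notMem_tsupport hy]
  have mul_finsum_eq (y : E) :
      ψ y * ∑ᶠ i, θ i y • a i y = ∑ i ∈ I, (ψ y * (θ i y : ℂ)) * a i y := by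
    by_cases hy : y ∈ tsupport ψ
    · rw [finsum_eq_sum_of_support_subset _ (s := I)
        (fun i hi => mem_index hy i (left_ne_zero_of_smul hi)), Finset.mul_sum]
      simp only [Complex.real_smul, mul_assoc]
    · simp [image_eq_zero_of_notMem_tsupport hy]
  calc pair u ψ = ∑ i ∈ I, pair u (fun y => ψ y * (θ i y : ℂ)) := by
        conv_lhs => rw [eq_sum_pieces]
        exact pair_sum u I fun i _ => isTest_piece i
    _ = ∑ i ∈ I, ∫ y, (ψ y * (θ i y : ℂ)) * a i y :=
        Finset.sum_congr rfl fun i _ => hua i _ (isTest_piece i) (tsupport_piece i)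
    _ = ∫ y, ψ y * ∑ᶠ i, θ i y • a i y := by
        simp_rw [mul_finsum_eq]
        exact (integral_finsetSum _ fun i _ => integrable_mul_of_continuousOn (isTest_piece i)
          ((ha i).mono (tsupport_piece i))).symm

theorem exists_contDiff_eqNear [FiniteDimensional ℝ E] (u : Distr E) {s : Set E} (hs : IsClosed s)
    (hsu : Disjoint s (singularSupport u)) :
    ∃ a : E → ℂ, ContDiff ℝ ∞ a ∧ EqNear u a s := by
  obtain ⟨O, hO, hsO, hOu⟩ := normal_exists_closure_subset hs
    (isClosed_singularSupport u).isOpen_compl (subset_compl_iff_disjoint_right.2 hsu)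
  have smooth_near (x : ((singularSupport u)ᶜ : Set E)) : ∃ U : Set E, IsOpen U ∧ x.1 ∈ U ∧
      ∃ a : E → ℂ, ContDiffOn ℝ ∞ a U ∧
        ∀ φ : Test E, tsupport φ ⊆ U → u φ = ∫ y, φ y • a y := not_not.1 x.2
  choose U hU hxU a ha hua using smooth_near
  obtain ⟨θ, hθ⟩ := SmoothPartitionOfUnity.exists_isSubordinate (modelWithCornersSelf ℝ E)
    (isClosed_closure (s := O)) U hU (fun x hx => mem_iUnion.2 ⟨⟨x, hOu hx⟩, hxU _⟩)
  refine ⟨fun y => ∑ᶠ i, θ i y • a i y, ?_, O, hO, hsO, fun ψ h hψ => ?_⟩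
  · rw [contDiff_iff_contDiffAt]
    intro x
    exact θ.contDiffAt_finsum fun i hx => (ha i).contDiffAt ((hU i).mem_nhds (hθ i hx))
  · exact pair_eq_integral_finsum u (fun i => (ha i).continuousOn)
      (fun i _ hψ hψU => pair_eq_integral_of_forall_test (ha i).continuousOn (hua i) hψ hψU)
      θ hθ h (hψ.trans subset_closure)

end SingularSupport

section Decay

variable {E F G : Type*} [NormedAddCommGroup E] [NormedSpace ℝ E] [NormedAddCommGroup F]
  [NormedSpace ℝ F] [NormedAddCommGroup G] [NormedSpace ℝ G]

theorem IsTest.fderiv_apply {ψ : E → G} (h : IsTest ψ) (v : E) :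
    IsTest (fun y => fderiv ℝ ψ y v) :=
  h.fderiv.clm_comp (ContinuousLinearMap.apply ℝ G v)

theorem HasDerivBound.fderiv_apply {ψ : E → G} (h : IsTest ψ) {M : ℕ} {B : ℝ}
    (hB : HasDerivBound (M + 1) ψ B) (v : E) :
    HasDerivBound M (fun y => fderiv ℝ ψ y v) (‖v‖ * B) := fun i hi y =>
  calc ‖iteratedFDeriv ℝ i (fun y => fderiv ℝ ψ y v) y‖
      ≤ ‖v‖ * ‖iteratedFDeriv ℝ i (fderiv ℝ ψ) y‖ :=
        norm_iteratedFDeriv_clm_apply_const h.fderiv.smooth.contDiffAt (by exact_mod_cast le_top)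
    _ ≤ ‖v‖ * B := by
        rw [norm_iteratedFDeriv_fderiv]
        exact mul_le_mul_of_nonneg_left (hB _ (Nat.add_le_add_right hi 1) y) (norm_nonneg v)

theorem HasDerivBound.comp_add_right {ψ : E → G} {M : ℕ} {B : ℝ} (hB : HasDerivBound M ψ B)
    (s : E) : HasDerivBound M (fun y => ψ (y + s)) B := fun i hi y => by
  rw [iteratedFDeriv_comp_add_right]
  exact hB i hi (y + s)

/-- The distribution `S` is invariant under translations in the direction `v`: its derivative in
this direction, here tested against `ψ`, vanishes. -/
def IsInvariant (S : Distr E) (v : E) : Prop :=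
  ∀ ψ : E → ℂ, IsTest ψ → pair S (fun y => fderiv ℝ ψ y v) = 0

theorem fderiv_mul_expChar {ψ : E → ℂ} (h : IsTest ψ) (ζ : E →L[ℝ] ℝ) (v y : E) :
    fderiv ℝ (fun y => ψ y * expChar ζ y) y v =
      fderiv ℝ ψ y v * expChar ζ y - (Complex.I * (ζ v : ℂ)) * (ψ y * expChar ζ y) := by
  have hasFDerivAt_exponent : HasFDerivAt (fun y => -(Complex.I * (ζ y : ℂ)))
      (-(Complex.I • (Complex.ofRealCLM ∘L ζ))) y :=
    ((Complex.ofRealCLM ∘L ζ).hasFDerivAt.const_mul Complex.I).neg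
  have fderiv_eq : fderiv ℝ (fun y => ψ y * expChar ζ y) y = _ :=
    ((h.smooth.differentiable (by simp) y).hasFDerivAt.mul hasFDerivAt_exponent.cexp).fderiv
  rw [fderiv_eq]
  simp [expChar]
  ring

theorem IsInvariant.pair_fderiv {S : Distr E} {v : E} (hS : IsInvariant S v) {ψ : E → ℂ}
    (h : IsTest ψ) (ζ : E →L[ℝ] ℝ) :
    pair S (fun y => fderiv ℝ ψ y v * expChar ζ y) =
      (Complex.I * (ζ v : ℂ)) * pair S (fun y => ψ y * expChar ζ y) := by
  have smooth_expChar := contDiff_expChar ζ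
  have pair_fderiv_eq_zero := hS _ (h.mul smooth_expChar)
  simp_rw [fderiv_mul_expChar h] at pair_fderiv_eq_zero
  rw [pair_sub S ((h.fderiv_apply v).mul smooth_expChar) ((h.mul smooth_expChar).const_mul _),
    pair_const_mul S (h.mul smooth_expChar)] at pair_fderiv_eq_zero
  exact sub_eq_zero.1 pair_fderiv_eq_zero

theorem exists_bound_of_isInvariant (S : Distr E) {K : Set E} (hK : IsCompact K) :
    ∃ (M : ℕ) (C : ℝ), 0 ≤ C ∧ ∀ v, IsInvariant S v → ∀ (N : ℕ) (ψ : E → ℂ), IsTest ψ →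
      tsupport ψ ⊆ K → ∀ B, HasDerivBound (M + N) ψ B → ∀ ζ : E →L[ℝ] ℝ,
        |ζ v| ^ N * ‖pair S (fun y => ψ y * expChar ζ y)‖ ≤
          C * (‖v‖ ^ N * B) * (1 + ‖ζ‖) ^ M := by
  obtain ⟨M, C, hC, hSC⟩ := exists_bound_pair_expChar S hK
  refine ⟨M, C, hC, fun v hv N => ?_⟩
  induction N with
  | zero => simpa using hSC
  | succ N ih =>
    intro ψ h hψK B hB ζ
    calc |ζ v| ^ (N + 1) * ‖pair S (fun y => ψ y * expChar ζ y)‖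
        = |ζ v| ^ N * ‖pair S (fun y => fderiv ℝ ψ y v * expChar ζ y)‖ := by
          rw [hv.pair_fderiv h, norm_mul, norm_mul, Complex.norm_I, Complex.norm_real,
            Real.norm_eq_abs]
          ring
      _ ≤ C * (‖v‖ ^ N * (‖v‖ * B)) * (1 + ‖ζ‖) ^ M :=
          ih _ (h.fderiv_apply v) ((tsupport_fderiv_apply_subset ℝ v).trans hψK) _
            (HasDerivBound.fderiv_apply h hB v) ζ
      _ = C * (‖v‖ ^ (N + 1) * B) * (1 + ‖ζ‖) ^ M := by ring

theorem exists_opNorm_le_two_mul (f : F →L[ℝ] ℝ) : ∃ v, ‖v‖ ≤ 1 ∧ ‖f‖ ≤ 2 * ‖f v‖ := by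
  by_cases hf : f = 0
  · exact ⟨0, by simp, by simp [hf]⟩
  · obtain ⟨v, hv, hfv⟩ := f.exists_lt_apply_of_lt_opNorm (half_lt_self (norm_pos_iff.2 hf))
    exact ⟨v, hv.le, by linarith⟩

theorem one_add_pow_mul_le {t a b q C D : ℝ} {N M : ℕ} (ht : 0 ≤ t) (hb : 0 ≤ b) (hq : 0 ≤ q)
    (hta : t ≤ b * a) (hqC : q ≤ C * (1 + t) ^ M) (hqD : a ^ (N + M) * q ≤ D * (1 + t) ^ M) :
    (1 + t) ^ N * q ≤ 2 ^ (N + M) * (C + b ^ (N + M) * D) := by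
  have pow_mul_le : t ^ (N + M) * q ≤ b ^ (N + M) * D * (1 + t) ^ M :=
    calc t ^ (N + M) * q ≤ (b * a) ^ (N + M) * q := by gcongr
      _ = b ^ (N + M) * (a ^ (N + M) * q) := by ring
      _ ≤ b ^ (N + M) * (D * (1 + t) ^ M) := by gcongr
      _ = b ^ (N + M) * D * (1 + t) ^ M := by ring
  have one_add_pow_le : (1 + t) ^ (N + M) ≤ 2 ^ (N + M) * (1 + t ^ (N + M)) := by
    refine (add_pow_le zero_le_one ht (N + M)).trans ?_
    rw [one_pow]
    gcongr
    · exact one_le_two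
    · exact Nat.sub_le _ _
  refine le_of_mul_le_mul_right ?_ (by positivity : 0 < (1 + t) ^ M)
  calc (1 + t) ^ N * q * (1 + t) ^ M = (1 + t) ^ (N + M) * q := by ring
    _ ≤ 2 ^ (N + M) * (1 + t ^ (N + M)) * q := by gcongr
    _ = 2 ^ (N + M) * (q + t ^ (N + M) * q) := by ring
    _ ≤ 2 ^ (N + M) * (C * (1 + t) ^ M + b ^ (N + M) * D * (1 + t) ^ M) := by gcongr
    _ = 2 ^ (N + M) * (C + b ^ (N + M) * D) * (1 + t) ^ M := by ring

theorem exists_decay_of_isInvariant {S : Distr E} {A : F →L[ℝ] E} (hS : ∀ v, IsInvariant S (A v))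
    {c : ℝ} {V : Set (E →L[ℝ] ℝ)} (hV : ∀ ζ ∈ V, ‖ζ‖ ≤ c * ‖ζ ∘L A‖) {K : Set E}
    (hK : IsCompact K) (N : ℕ) :
    ∃ (M : ℕ) (C : ℝ), 0 ≤ C ∧ ∀ ψ : E → ℂ, IsTest ψ → tsupport ψ ⊆ K → ∀ B, HasDerivBound M ψ B →
      ∀ ζ ∈ V, (1 + ‖ζ‖) ^ N * ‖pair S (fun y => ψ y * expChar ζ y)‖ ≤ C * B := by
  obtain ⟨M, C, hC, hSC⟩ := exists_bound_of_isInvariant S hK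
  refine ⟨M + (N + M), 2 ^ (N + M) * (C + (|c| * 2) ^ (N + M) * (C * ‖A‖ ^ (N + M))),
    by positivity, fun ψ h hψK B hB ζ hζ => ?_⟩
  have hB0 := hB.nonneg
  obtain ⟨v, hv, norm_comp_le⟩ := exists_opNorm_le_two_mul (ζ ∘L A)
  have norm_le_abs : ‖ζ‖ ≤ |c| * 2 * |ζ (A v)| :=
    calc ‖ζ‖ ≤ c * ‖ζ ∘L A‖ := hV ζ hζ
      _ ≤ |c| * (2 * |ζ (A v)|) := by gcongr; exacts [le_abs_self c, norm_comp_le]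
      _ = |c| * 2 * |ζ (A v)| := by ring
  have norm_direction_le : ‖A v‖ ≤ ‖A‖ :=
    (A.le_opNorm v).trans (mul_le_of_le_one_right (norm_nonneg A) hv)
  have pair_le := hSC (A v) (hS v) 0 ψ h hψK B (fun i hi => hB i (by omega)) ζ
  have pow_mul_pair_le := (hSC (A v) (hS v) (N + M) ψ h hψK B hB ζ).trans
    (show _ ≤ C * (‖A‖ ^ (N + M) * B) * (1 + ‖ζ‖) ^ M by gcongr)
  simp only [pow_zero, one_mul] at pair_le
  refine (one_add_pow_mul_le (norm_nonneg ζ) (by positivity) (norm_nonneg _) norm_le_abs pair_le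
    pow_mul_pair_le).trans_eq ?_
  ring

/-- Rapid decay on `V`, uniformly for small translations of `Φ`, of the Fourier transform of
`T` localized by `Φ`. -/
def UniformDecay (T : Distr E) (Φ : E → ℂ) (V : Set (E →L[ℝ] ℝ)) : Prop :=
  ∃ δ : ℝ, 0 < δ ∧ ∀ N : ℕ, ∃ C, 0 ≤ C ∧ ∀ s : E, ‖s‖ < δ → ∀ ζ ∈ V,
    (1 + ‖ζ‖) ^ N * ‖pair T (fun y => Φ (y + s) * expChar ζ y)‖ ≤ C

theorem UniformDecay.add {T : Distr E} {Φ Φ' : E → ℂ} {V : Set (E →L[ℝ] ℝ)} (hΦ : IsTest Φ)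
    (hΦ' : IsTest Φ') (h : UniformDecay T Φ V) (h' : UniformDecay T Φ' V) :
    UniformDecay T (fun y => Φ y + Φ' y) V := by
  obtain ⟨δ, hδ, decay⟩ := h
  obtain ⟨δ', hδ', decay'⟩ := h'
  refine ⟨min δ δ', lt_min hδ hδ', fun N => ?_⟩
  obtain ⟨C, hC0, hC⟩ := decay N
  obtain ⟨C', hC0', hC'⟩ := decay' N
  refine ⟨C + C', add_nonneg hC0 hC0', fun s hs ζ hζ => ?_⟩
  simp_rw [add_mul]
  rw [pair_add T ((hΦ.comp_add_right s).mul (contDiff_expChar ζ))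
    ((hΦ'.comp_add_right s).mul (contDiff_expChar ζ))]
  refine (mul_le_mul_of_nonneg_left (norm_add_le _ _) (by positivity)).trans ?_
  rw [mul_add]
  exact add_le_add (hC s (hs.trans_le (min_le_left _ _)) ζ hζ)
    (hC' s (hs.trans_le (min_le_right _ _)) ζ hζ)

omit [NormedSpace ℝ E] in
theorem tsupport_comp_add_right_subset {Φ : E → ℂ} {δ : ℝ} {s : E} (hs : ‖s‖ ≤ δ) :
    tsupport (fun y => Φ (y + s)) ⊆ Metric.cthickening δ (tsupport Φ) := fun y hy =>
  Metric.mem_cthickening_of_dist_le y (y + s) δ _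
    (tsupport_comp_subset_preimage Φ (f := fun y : E => y + s) (by fun_prop) hy)
    (by simpa using hs)

theorem uniformDecay_of_eq_mul [ProperSpace E] {S T : Distr E} {A : F →L[ℝ] E}
    (hS : ∀ v, IsInvariant S (A v)) {c : ℝ} {V : Set (E →L[ℝ] ℝ)}
    (hV : ∀ ζ ∈ V, ‖ζ‖ ≤ c * ‖ζ ∘L A‖) {Φ m : E → ℂ} (hΦ : IsTest Φ) (hm : ContDiff ℝ ∞ m)
    {O : Set E} (hO : IsOpen O) (hΦO : tsupport Φ ⊆ O)
    (hT : ∀ Ψ, IsTest Ψ → tsupport Ψ ⊆ O → pair T Ψ = pair S (fun y => Ψ y * m y)) :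
    UniformDecay T Φ V := by
  obtain ⟨δ, hδ, hδO⟩ := hΦ.compact.isCompact.exists_cthickening_subset_open hO hΦO
  refine ⟨δ, hδ, fun N => ?_⟩
  have hK : IsCompact (Metric.cthickening δ (tsupport Φ)) := hΦ.compact.isCompact.cthickening
  obtain ⟨M, C, hC, hSC⟩ := exists_decay_of_isInvariant hS hV hK N
  obtain ⟨B, hB⟩ := hΦ.exists_hasDerivBound M
  obtain ⟨D, hD, hmD⟩ := exists_bound_iteratedFDeriv_on hm hK M
  have hB0 := hB.nonneg
  refine ⟨C * (2 ^ M * D * B), by positivity, fun s hs ζ hζ => ?_⟩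
  have isTest_translate : IsTest (fun y => Φ (y + s)) := hΦ.comp_add_right s
  have tsupport_translate := tsupport_comp_add_right_subset (Φ := Φ) hs.le
  have pair_eq : pair T (fun y => Φ (y + s) * expChar ζ y) =
      pair S (fun y => Φ (y + s) * m y * expChar ζ y) := by
    rw [hT _ (isTest_translate.mul (contDiff_expChar ζ))
      (tsupport_mul_subset_left.trans (tsupport_translate.trans hδO))]
    simp_rw [mul_right_comm]
  rw [pair_eq]
  exact hSC _ (isTest_translate.mul hm) (tsupport_mul_subset_left.trans tsupport_translate) _
    ((hB.comp_add_right s).mul isTest_translate hm hD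
      fun i hi y hy => hmD i hi y (tsupport_translate hy)) ζ hζ

end Decay

section WaveFront

variable {E : Type*} [NormedAddCommGroup E] [NormedSpace ℝ E]

theorem UniformDecay.notMem_waveFrontSet {T : Distr E} {φ : Test E} {V : Set (E →L[ℝ] ℝ)}
    (h : UniformDecay T (fun y => (φ y : ℂ)) V) (hV : IsOpen V) (hVc : IsConic V) {x : E}
    (hx : φ x ≠ 0) {ξ : E →L[ℝ] ℝ} (hξ : ξ ∈ V) : (x, ξ) ∉ waveFrontSet T := by
  obtain ⟨δ, hδ, decay⟩ := h
  rintro ⟨-, no_decay⟩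
  refine no_decay ⟨φ, hx, V, hV, hVc, hξ, fun N => ?_⟩
  obtain ⟨C, -, hC⟩ := decay N
  refine ⟨C, fun ζ hζ => ?_⟩
  rw [localFourier_eq_pair]
  simpa using hC 0 (by simpa using hδ) ζ hζ

variable [FiniteDimensional ℝ E]

theorem exists_isTest_apply_ne_zero {U : Set E} (hU : IsOpen U) {x : E} (hx : x ∈ U) :
    ∃ χ : E → ℝ, IsTest χ ∧ tsupport χ ⊆ U ∧ χ x ≠ 0 := by
  obtain ⟨χ, hχ, hχU, hχ1⟩ := exists_isTest_eq_one_nhdsSet (isCompact_singleton (x := x))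
    hU (singleton_subset_iff.2 hx)
  rw [nhdsSet_singleton] at hχ1
  exact ⟨χ, hχ, hχU, hχ1.self_of_nhds.trans_ne one_ne_zero⟩

variable [MeasureSpace E] [BorelSpace E] [(volume : Measure E).IsAddHaarMeasure]

theorem integral_fderiv_apply_eq_zero {ψ : E → ℂ} (h : IsTest ψ) (v : E) :
    ∫ x, fderiv ℝ ψ x v = 0 := by
  have integrable_fderiv := (h.fderiv_apply v).continuous.integrable_of_hasCompactSupport
    (μ := volume) (h.fderiv_apply v).compact
  have integration_by_parts := integral_smul_fderiv_eq_neg_fderiv_smul_of_integrable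
    (μ := (volume : Measure E)) (𝕜 := ℝ) (f := fun _ => (1 : ℝ)) (g := ψ) (v := v) (by simp)
    (by simpa using integrable_fderiv)
    (by simpa using h.continuous.integrable_of_hasCompactSupport h.compact)
    (fun _ _ => differentiableAt_const _) (fun x _ => h.smooth.differentiable (by simp) x)
  simpa using integration_by_parts

theorem pair_ofFunction_one {ψ : E → ℂ} (h : IsTest ψ) :
    pair (ofFunction fun _ : E => (1 : ℂ)) ψ = ∫ x, ψ x := by
  simp [pair_ofFunction continuous_const h]

theorem isInvariant_ofFunction_one (v : E) :
    IsInvariant (ofFunction fun _ : E => (1 : ℂ)) v := fun _ h =>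
  (pair_ofFunction_one (h.fderiv_apply v)).trans (integral_fderiv_apply_eq_zero h v)

theorem waveFrontSet_ofFunction {w : E → ℂ} (hw : ContDiff ℝ ∞ w) :
    waveFrontSet (ofFunction w) = ∅ := by
  rw [eq_empty_iff_forall_notMem]
  rintro ⟨x, ξ⟩
  obtain ⟨χ, hχ, -, hχx⟩ := exists_isTest_apply_ne_zero isOpen_univ (mem_univ x)
  refine UniformDecay.notMem_waveFrontSet (φ := toTest χ hχ) (V := univ) ?_ isOpen_univ
    (fun _ _ _ _ => mem_univ _) hχx (mem_univ _)
  refine uniformDecay_of_eq_mul (A := ContinuousLinearMap.id ℝ E) (c := 1)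
    isInvariant_ofFunction_one (fun ζ _ => ?_) hχ.ofReal hw isOpen_univ (subset_univ _)
    fun Ψ h _ => ?_
  · rw [ContinuousLinearMap.comp_id, one_mul]
  · rw [pair_ofFunction hw.continuous h, pair_ofFunction_one (h.mul hw)]

end WaveFront

section Tensor

variable {X E : Type*} [NormedAddCommGroup X] [NormedSpace ℝ X] [NormedAddCommGroup E]
  [NormedSpace ℝ E]

/-- The upper bound on the wave front set of a tensor product given by closed sets `A` and `B`
which contain the singular supports of the factors: away from `A × B`, one of the factors is smooth
and only covectors which are conormal to the corresponding variable are left. -/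
def tensorCone (A : Set X) (B : Set E) : Set ((X × E) × (X × E →L[ℝ] ℝ)) :=
  {p | p.2 ≠ 0 ∧ ((p.1.1 ∈ A ∧ p.1.2 ∈ B) ∨
    p.2 ∘L ContinuousLinearMap.inl ℝ X E = 0 ∨ p.2 ∘L ContinuousLinearMap.inr ℝ X E = 0)}

theorem isClosedCone_tensorCone {A : Set X} {B : Set E} (hA : IsClosed A) (hB : IsClosed B) :
    IsClosedCone (tensorCone A B) where
  ne_zero p hp := hp.1
  conic := fun ⟨z, ζ⟩ ⟨ζ_ne_zero, h⟩ t ht =>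
    ⟨smul_ne_zero ht.ne' ζ_ne_zero, h.imp_right (Or.imp
      (fun h => by rw [ContinuousLinearMap.smul_comp, h, smul_zero])
      (fun h => by rw [ContinuousLinearMap.smul_comp, h, smul_zero]))⟩
  closed := by
    have union_zero_eq : tensorCone A B ∪ {p | p.2 = 0} = {p | (p.1.1 ∈ A ∧ p.1.2 ∈ B) ∨
        p.2 ∘L ContinuousLinearMap.inl ℝ X E = 0 ∨ p.2 ∘L ContinuousLinearMap.inr ℝ X E = 0} := by
      ext ⟨z, ζ⟩
      by_cases hζ : ζ = 0 <;> simp [tensorCone, hζ]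
    rw [union_zero_eq]
    exact ((hA.preimage (continuous_fst.comp continuous_fst)).inter
      (hB.preimage (continuous_snd.comp continuous_fst))).union
        ((isClosed_eq (by fun_prop) continuous_const).union
          (isClosed_eq (by fun_prop) continuous_const))

theorem disjoint_tensorCone_diagonalConormal {A B : Set E} (hAB : A ∩ B = ∅) :
    Disjoint (tensorCone A B) diagonalConormal := by
  rw [Set.disjoint_left]
  rintro ⟨⟨x, y⟩, ζ⟩ ⟨ζ_ne_zero, h⟩ ⟨rfl : x = y, -, conormal⟩
  have add_eq_zero (v : E) : ζ (v, 0) + ζ (0, v) = 0 := by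
    rw [← map_add, Prod.mk_add_mk, add_zero, zero_add, conormal]
  rcases h with h | h | h
  · exact eq_empty_iff_forall_notMem.1 hAB x h
  · have apply_inl (v : E) : ζ (v, 0) = 0 := DFunLike.congr_fun h v
    have apply_inr (v : E) : ζ (0, v) = 0 := by simpa [apply_inl] using add_eq_zero v
    exact ζ_ne_zero (ContinuousLinearMap.prod_ext (ContinuousLinearMap.ext apply_inl)
      (ContinuousLinearMap.ext apply_inr))
  · have apply_inr (v : E) : ζ (0, v) = 0 := DFunLike.congr_fun h v
    have apply_inl (v : E) : ζ (v, 0) = 0 := by simpa [apply_inr] using add_eq_zero v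
    exact ζ_ne_zero (ContinuousLinearMap.prod_ext (ContinuousLinearMap.ext apply_inl)
      (ContinuousLinearMap.ext apply_inr))

theorem fderiv_slice_fst {Ψ : X × E → ℂ} (h : IsTest Ψ) (x v : X) (y : E) :
    fderiv ℝ (fun x => Ψ (x, y)) x v = fderiv ℝ Ψ (x, y) (v, 0) :=
  DFunLike.congr_fun (((h.smooth.differentiable (by simp) (x, y)).hasFDerivAt).comp
    (f := fun x => (x, y)) x (hasFDerivAt_prodMk_left x y)).fderiv v

theorem fderiv_slice_snd {Ψ : X × E → ℂ} (h : IsTest Ψ) (x : X) (y v : E) :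
    fderiv ℝ (fun y => Ψ (x, y)) y v = fderiv ℝ Ψ (x, y) (0, v) :=
  DFunLike.congr_fun (((h.smooth.differentiable (by simp) (x, y)).hasFDerivAt).comp y
    (hasFDerivAt_prodMk_right x y)).fderiv v

theorem exists_isOpen_isConic_norm_le {F G : Type*} [NormedAddCommGroup F] [NormedSpace ℝ F]
    [NormedAddCommGroup G] [NormedSpace ℝ G] {A : G →L[ℝ] F} {ζ₀ : F →L[ℝ] ℝ}
    (hA : ζ₀ ∘L A ≠ 0) : ∃ (c : ℝ) (V : Set (F →L[ℝ] ℝ)),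
      IsOpen V ∧ IsConic V ∧ ζ₀ ∈ V ∧ ∀ ζ ∈ V, ‖ζ‖ ≤ c * ‖ζ ∘L A‖ := by
  have norm_pos : 0 < ‖ζ₀ ∘L A‖ := norm_pos_iff.2 hA
  set c := (‖ζ₀‖ + 1) / ‖ζ₀ ∘L A‖
  refine ⟨c, {ζ | ‖ζ‖ < c * ‖ζ ∘L A‖}, isOpen_lt (by fun_prop) (by fun_prop),
    fun ζ (hζ : ‖ζ‖ < c * ‖ζ ∘L A‖) t ht => ?_, ?_, fun ζ hζ => hζ.le⟩
  · calc ‖t • ζ‖ = t * ‖ζ‖ := norm_smul_of_nonneg ht.le ζ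
      _ < t * (c * ‖ζ ∘L A‖) := mul_lt_mul_of_pos_left hζ ht
      _ = c * ‖(t • ζ) ∘L A‖ := by
        rw [ContinuousLinearMap.smul_comp, norm_smul_of_nonneg ht.le (ζ ∘L A), mul_left_comm]
  · change ‖ζ₀‖ < c * ‖ζ₀ ∘L A‖
    rw [div_mul_cancel₀ _ norm_pos.ne']
    exact lt_add_one _

variable [FiniteDimensional ℝ X] [FiniteDimensional ℝ E]

section First

variable [MeasureSpace X] [BorelSpace X] [(volume : Measure X).IsAddHaarMeasure]

theorem isInvariant_tensorDistr_ofFunction_one_left (g : Distr E) (v : X) :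
    IsInvariant (tensorDistr (ofFunction fun _ : X => (1 : ℂ)) g) (v, 0) := by
  intro Ψ h
  have isTest_fderiv := h.fderiv_apply (v, 0)
  have integral_eq_zero (y : E) : ∫ x, fderiv ℝ Ψ (x, y) (v, 0) = 0 := by
    simp_rw [← fderiv_slice_fst h]
    exact integral_fderiv_apply_eq_zero (h.swap.slice y) v
  rw [pair_tensorDistr _ _ isTest_fderiv, pair_ofFunction_one (isTest_fderiv.pair_slice g),
    ← pair_integral volume g isTest_fderiv]
  simp_rw [integral_eq_zero, pair_zero]

theorem uniformDecay_tensorDistr_left (f : Distr X) (g : Distr E) {Φ : X × E → ℂ}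
    (hΦ : IsTest Φ) (hΦf : Disjoint (Prod.fst '' tsupport Φ) (singularSupport f)) {c : ℝ}
    {V : Set (X × E →L[ℝ] ℝ)} (hV : ∀ ζ ∈ V, ‖ζ‖ ≤ c * ‖ζ ∘L ContinuousLinearMap.inl ℝ X E‖) :
    UniformDecay (tensorDistr f g) Φ V := by
  obtain ⟨a, ha, O, hO, hΦO, haf⟩ := exists_contDiff_eqNear f
    (hΦ.compact.isCompact.image continuous_fst).isClosed hΦf
  refine uniformDecay_of_eq_mul (isInvariant_tensorDistr_ofFunction_one_left g) hV hΦ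
    (ha.comp contDiff_fst) (hO.preimage continuous_fst) (image_subset_iff.1 hΦO) fun Ψ h hΨO => ?_
  have isTest_mul := h.mul (ha.comp contDiff_fst)
  rw [pair_tensorDistr _ _ h, pair_tensorDistr _ _ isTest_mul,
    pair_ofFunction_one (isTest_mul.pair_slice g), haf _ (h.pair_slice g)
      ((tsupport_pair_slice_subset g h.compact).trans (image_subset_iff.2 hΨO))]
  refine integral_congr_ae (ae_of_all _ fun x => ?_)
  simp only [Function.comp_apply]
  rw [mul_comm, ← pair_const_mul g (h.slice x)]
  simp_rw [mul_comm]

end First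

section Second

variable [MeasureSpace E] [BorelSpace E] [(volume : Measure E).IsAddHaarMeasure]

theorem isInvariant_tensorDistr_ofFunction_one_right (f : Distr X) (v : E) :
    IsInvariant (tensorDistr f (ofFunction fun _ : E => (1 : ℂ))) (0, v) := by
  intro Ψ h
  have pair_slice_eq_zero (x : X) :
      pair (ofFunction fun _ : E => (1 : ℂ)) (fun y => fderiv ℝ Ψ (x, y) (0, v)) = 0 := by
    simp_rw [← fderiv_slice_snd h]
    exact isInvariant_ofFunction_one v _ (h.slice x)
  rw [pair_tensorDistr _ _ (h.fderiv_apply (0, v))]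
  simp_rw [pair_slice_eq_zero, pair_zero]

theorem uniformDecay_tensorDistr_right (f : Distr X) (g : Distr E) {Φ : X × E → ℂ}
    (hΦ : IsTest Φ) (hΦg : Disjoint (Prod.snd '' tsupport Φ) (singularSupport g)) {c : ℝ}
    {V : Set (X × E →L[ℝ] ℝ)} (hV : ∀ ζ ∈ V, ‖ζ‖ ≤ c * ‖ζ ∘L ContinuousLinearMap.inr ℝ X E‖) :
    UniformDecay (tensorDistr f g) Φ V := by
  obtain ⟨b, hb, O, hO, hΦO, hbg⟩ := exists_contDiff_eqNear g
    (hΦ.compact.isCompact.image continuous_snd).isClosed hΦg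
  refine uniformDecay_of_eq_mul (isInvariant_tensorDistr_ofFunction_one_right f) hV hΦ
    (hb.comp contDiff_snd) (hO.preimage continuous_snd) (image_subset_iff.1 hΦO) fun Ψ h hΨO => ?_
  have isTest_mul := h.mul (hb.comp contDiff_snd)
  have pair_slice (x : X) : pair g (fun y => Ψ (x, y)) =
      pair (ofFunction fun _ : E => (1 : ℂ)) fun y => Ψ (x, y) * b y := by
    rw [hbg _ (h.slice x) ((tsupport_slice_subset h.compact x).trans (image_subset_iff.2 hΨO))]
    exact (pair_ofFunction_one (isTest_mul.slice x)).symm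
  rw [pair_tensorDistr _ _ h, pair_tensorDistr _ _ isTest_mul]
  simp_rw [pair_slice]
  rfl

end Second

theorem tsupport_ofReal_subset {S : Type*} [TopologicalSpace S] (φ : S → ℝ) :
    tsupport (fun x => (φ x : ℂ)) ⊆ tsupport φ :=
  tsupport_comp_subset (g := ((↑) : ℝ → ℂ)) Complex.ofReal_zero φ

variable [MeasureSpace X] [BorelSpace X] [(volume : Measure X).IsAddHaarMeasure]
  [MeasureSpace E] [BorelSpace E] [(volume : Measure E).IsAddHaarMeasure]

theorem waveFrontSet_tensorDistr_subset (f : Distr X) (g : Distr E) :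
    waveFrontSet (tensorDistr f g) ⊆ tensorCone (singularSupport f) (singularSupport g) := by
  rintro ⟨z, ζ₀⟩ hz
  refine ⟨hz.1, ?_⟩
  by_contra! hcon
  obtain ⟨hfg, hl, hr⟩ := hcon
  by_cases hzf : z.1 ∈ singularSupport f
  · obtain ⟨c, V, hV, hVc, hζV, hVb⟩ := exists_isOpen_isConic_norm_le hr
    obtain ⟨χ, hχ, hχg, hχz⟩ := exists_isTest_apply_ne_zero
      ((isClosed_singularSupport g).isOpen_compl.preimage continuous_snd) (x := z) (hfg hzf)
    exact UniformDecay.notMem_waveFrontSet (φ := toTest χ hχ)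
      (uniformDecay_tensorDistr_right f g hχ.ofReal (disjoint_left.2 (image_subset_iff.2
        ((tsupport_ofReal_subset χ).trans hχg))) hVb) hV hVc hχz hζV hz
  · obtain ⟨c, V, hV, hVc, hζV, hVb⟩ := exists_isOpen_isConic_norm_le hl
    obtain ⟨χ, hχ, hχf, hχz⟩ := exists_isTest_apply_ne_zero
      ((isClosed_singularSupport f).isOpen_compl.preimage continuous_fst) (x := z) hzf
    exact UniformDecay.notMem_waveFrontSet (φ := toTest χ hχ)
      (uniformDecay_tensorDistr_left f g hχ.ofReal (disjoint_left.2 (image_subset_iff.2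
        ((tsupport_ofReal_subset χ).trans hχf))) hVb) hV hVc hχz hζV hz

end Tensor

section Approximation

variable {E : Type*} [NormedAddCommGroup E] [NormedSpace ℝ E]

theorem expChar_add (ζ : E →L[ℝ] ℝ) (x y : E) : expChar ζ (x + y) = expChar ζ x * expChar ζ y := by
  rw [expChar, expChar, expChar, ← Complex.exp_add, map_add]
  push_cast
  ring_nf

theorem disjoint_tsupport_of_eventually_eq_zero {X M : Type*} [TopologicalSpace X] [Zero M]
    {h : X → M} {s : Set X} (hs : ∀ᶠ x in 𝓝ˢ s, h x = 0) : Disjoint (tsupport h) s :=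
  disjoint_right.2 fun _ hx =>
    notMem_tsupport_iff_eventuallyEq.2 (eventually_nhdsSet_iff_forall.1 hs _ hx)

variable [FiniteDimensional ℝ E]

theorem IsTest.exists_add_eq_of_disjoint {ψ : E → ℂ} (h : IsTest ψ) {s t : Set E}
    (hs : IsClosed s) (ht : IsClosed t) (hst : Disjoint (tsupport ψ ∩ s) t) :
    ∃ ψ₁ ψ₂ : E → ℂ, IsTest ψ₁ ∧ IsTest ψ₂ ∧ (ψ = fun x => ψ₁ x + ψ₂ x) ∧
      Disjoint (tsupport ψ₁) s ∧ Disjoint (tsupport ψ₂) t := by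
  obtain ⟨θ, hθ, hθ0, hθ1⟩ := exists_contDiff_zero_one_nhdsSet
    (s := tsupport ψ ∩ s) (t := tsupport ψ ∩ t) ((isClosed_tsupport _).inter hs)
    ((isClosed_tsupport _).inter ht) (hst.mono_right inter_subset_right)
  have contDiff_θ : ContDiff ℝ ∞ (fun z => (θ z : ℂ)) := Complex.ofRealCLM.contDiff.comp hθ
  have disjoint_of_eq_zero {m : E → ℂ} {r : Set E} (hm : ∀ᶠ z in 𝓝ˢ (tsupport ψ ∩ r), m z = 0) :
      Disjoint (tsupport fun z => ψ z * m z) r :=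
    disjoint_left.2 fun z hz hzr => disjoint_left.1 (disjoint_tsupport_of_eventually_eq_zero hm)
      (tsupport_mul_subset_right hz) ⟨tsupport_mul_subset_left hz, hzr⟩
  exact ⟨fun z => ψ z * θ z, fun z => ψ z * (1 - θ z), h.mul contDiff_θ,
    h.mul (contDiff_const.sub contDiff_θ), funext fun z => by ring,
    disjoint_of_eq_zero (hθ0.mono fun z hz => by simp [hz]),
    disjoint_of_eq_zero (hθ1.mono fun z hz => by simp [hz])⟩

theorem continuous_pair_translate_expChar (u : Distr E) {Φ : E → ℂ} (h : IsTest Φ) :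
    Continuous (fun p : E × (E →L[ℝ] ℝ) =>
      pair u (fun y => Φ (y + p.1) * expChar p.2 (y + p.1))) := by
  refine (contDiff_pair_slice u
    (Ψ := fun z : (E × (E →L[ℝ] ℝ)) × E => Φ (z.2 + z.1.1) * expChar z.1.2 (z.2 + z.1.1))
    fun χ hχ => ?_).continuous
  have contDiff_phase : ContDiff ℝ ∞
      (fun z : (E × (E →L[ℝ] ℝ)) × E => expChar z.1.2 (z.2 + z.1.1)) := by
    have contDiff_add : ContDiff ℝ ∞ (fun z : (E × (E →L[ℝ] ℝ)) × E => z.2 + z.1.1) := by fun_prop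
    exact (contDiff_const.mul (Complex.ofRealCLM.contDiff.comp
      ((contDiff_snd.comp contDiff_fst).clm_apply contDiff_add))).neg.cexp
  simpa only [ContinuousLinearMap.coe_fst', mul_assoc] using
    (hχ.ofReal.mul_comp_add h (.fst ℝ E (E →L[ℝ] ℝ))).mul contDiff_phase

theorem exists_norm_le_of_isClosed_isConic {F : Type*} [NormedAddCommGroup F] [NormedSpace ℝ F]
    {V : Set (E →L[ℝ] ℝ)} (hV : IsClosed V) (hVc : IsConic V) (A : F →L[ℝ] E)
    (hA : ∀ ζ ∈ V, ζ ∘L A = 0 → ζ = 0) : ∃ c : ℝ, ∀ ζ ∈ V, ‖ζ‖ ≤ c * ‖ζ ∘L A‖ := by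
  have normalize_mem (ζ : E →L[ℝ] ℝ) (hζ : ζ ∈ V) (hζ0 : ζ ≠ 0) :
      ‖ζ‖⁻¹ • ζ ∈ V ∩ Metric.sphere 0 1 :=
    ⟨hVc ζ hζ _ (inv_pos.2 (norm_pos_iff.2 hζ0)), by simp [norm_smul, hζ0]⟩
  rcases (V ∩ Metric.sphere 0 1).eq_empty_or_nonempty with hempty | hne
  · refine ⟨0, fun ζ hζ => ?_⟩
    by_cases hζ0 : ζ = 0
    · simp [hζ0]
    · exact ((hempty ▸ normalize_mem ζ hζ hζ0 : _ ∈ (∅ : Set (E →L[ℝ] ℝ)))).elim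
  · obtain ⟨ζ₀, hζ₀, hmin⟩ := ((isCompact_sphere 0 1).inter_left hV).exists_isMinOn hne
      (f := fun ζ => ‖ζ ∘L A‖) (by fun_prop)
    have min_pos : 0 < ‖ζ₀ ∘L A‖ := norm_pos_iff.2 fun h =>
      Metric.ne_of_mem_sphere hζ₀.2 one_ne_zero (hA ζ₀ hζ₀.1 h)
    refine ⟨‖ζ₀ ∘L A‖⁻¹, fun ζ hζ => ?_⟩
    by_cases hζ0 : ζ = 0
    · simp [hζ0]
    · have min_le : ‖ζ₀ ∘L A‖ ≤ ‖(‖ζ‖⁻¹ • ζ) ∘L A‖ := hmin (normalize_mem ζ hζ hζ0)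
      rw [ContinuousLinearMap.smul_comp, norm_smul, norm_inv, norm_norm, inv_mul_eq_div,
        le_div_iff₀ (norm_pos_iff.2 hζ0)] at min_le
      rwa [inv_mul_eq_div, le_div_iff₀ min_pos, mul_comm]

omit [FiniteDimensional ℝ E] in
theorem norm_pair_translate_expChar (T : Distr E) {Φ : E → ℂ} (hΦ : IsTest Φ) (s : E)
    (ζ : E →L[ℝ] ℝ) :
    ‖pair T (fun y => Φ (y + s) * expChar ζ (y + s))‖ =
      ‖pair T (fun y => Φ (y + s) * expChar ζ y)‖ := by
  have phase_factors (y : E) :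
      Φ (y + s) * expChar ζ (y + s) = expChar ζ s * (Φ (y + s) * expChar ζ y) := by
    rw [expChar_add]
    ring
  simp_rw [phase_factors]
  rw [pair_const_mul T ((hΦ.comp_add_right s).mul (contDiff_expChar ζ)), norm_mul, norm_expChar,
    one_mul]

theorem UniformDecay.eventually_norm_pair_translate_sub_le {T : Distr E} {Φ : E → ℂ}
    (hΦ : IsTest Φ) {V : Set (E →L[ℝ] ℝ)} (h : UniformDecay T Φ V) (N : ℕ) {ε : ℝ} (hε : 0 < ε) :
    ∀ᶠ s in 𝓝 (0 : E), ∀ ζ ∈ V, ‖pair T (fun y => Φ (y + s) * expChar ζ (y + s)) -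
      pair T (fun y => Φ y * expChar ζ y)‖ ≤ ε / (1 + ‖ζ‖) ^ N := by
  obtain ⟨δ, hδ, decay⟩ := h
  obtain ⟨C, hC0, hC⟩ := decay (N + 1)
  let k : E × (E →L[ℝ] ℝ) → ℂ := fun p => pair T (fun y => Φ (y + p.1) * expChar p.2 (y + p.1))
  have continuous_k : Continuous k := continuous_pair_translate_expChar T hΦ
  have k_zero (ζ : E →L[ℝ] ℝ) : pair T (fun y => Φ y * expChar ζ y) = k (0, ζ) := by simp [k]
  have norm_k_le {s : E} (hs : ‖s‖ < δ) {ζ : E →L[ℝ] ℝ} (hζ : ζ ∈ V) :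
      ‖k (s, ζ)‖ ≤ C / (1 + ‖ζ‖) ^ (N + 1) := by
    rw [norm_pair_translate_expChar T hΦ, le_div_iff₀ (by positivity), mul_comm]
    exact hC s hs ζ hζ
  -- Beyond this radius the decay of order `N + 1` already gives the bound.
  let r := 2 * C / ε
  have eventually_le_of_norm_le : ∀ᶠ s in 𝓝 (0 : E), ∀ ζ ∈ Metric.closedBall (0 : E →L[ℝ] ℝ) r,
      ‖k (s, ζ) - k (0, ζ)‖ ≤ ε / (1 + r) ^ N := by
    refine (isCompact_closedBall 0 r).eventually_forall_of_forall_eventually fun ζ _ => ?_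
    have continuous_diff : Continuous (fun z : E × (E →L[ℝ] ℝ) => ‖k z - k (0, z.2)‖) := by
      fun_prop
    refine (continuous_diff.tendsto (0, ζ)).eventually_le_const ?_
    simp only [sub_self, norm_zero]
    positivity
  filter_upwards [eventually_le_of_norm_le, Metric.ball_mem_nhds 0 hδ] with s hs hsδ ζ hζ
  rw [k_zero]
  rcases le_or_gt ‖ζ‖ r with hζr | hζr
  · refine (hs ζ (mem_closedBall_zero_iff.2 hζr)).trans ?_
    gcongr
  · have two_mul_le : 2 * C ≤ ε * (1 + ‖ζ‖) := by
      have := (div_lt_iff₀ hε).1 hζr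
      linarith
    calc ‖k (s, ζ) - k (0, ζ)‖
        ≤ C / (1 + ‖ζ‖) ^ (N + 1) + C / (1 + ‖ζ‖) ^ (N + 1) :=
          (norm_sub_le _ _).trans (add_le_add (norm_k_le (mem_ball_zero_iff.1 hsδ) hζ)
            (norm_k_le (by simpa using hδ) hζ))
      _ = 2 * C / (1 + ‖ζ‖) ^ (N + 1) := by ring
      _ ≤ ε * (1 + ‖ζ‖) / (1 + ‖ζ‖) ^ (N + 1) := by gcongr
      _ = ε / (1 + ‖ζ‖) ^ N := by
          rw [pow_succ, mul_div_mul_right _ _ (by positivity)]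

theorem uniformDecay_of_subset_zero (T : Distr E) {Φ : E → ℂ} (hΦ : IsTest Φ)
    {V : Set (E →L[ℝ] ℝ)} (hV : V ⊆ {0}) : UniformDecay T Φ V :=
  uniformDecay_of_eq_mul (A := (0 : E →L[ℝ] E)) (S := T) (c := 0)
    (fun _ _ _ => by simp [pair_zero]) (fun ζ hζ => by simp [mem_singleton_iff.1 (hV hζ)]) hΦ
    (contDiff_const (c := (1 : ℂ))) isOpen_univ (subset_univ _) fun _ _ _ => by simp

section Mollifier

variable [MeasureSpace E] [BorelSpace E] [(volume : Measure E).IsAddHaarMeasure]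

theorem IsMollifier.eventually_fourier_le {R : ℕ → E → ℝ} (hR : IsMollifier R) {T : Distr E}
    {Φ : E → ℂ} (hΦ : IsTest Φ) {V : Set (E →L[ℝ] ℝ)} (h : UniformDecay T Φ V) (N : ℕ) {ε : ℝ}
    (hε : 0 < ε) : ∀ᶠ j in atTop, ∀ ζ ∈ V, ‖ζ‖ ^ N *
      ‖pair (ofFunction (mollify T (R j))) (fun y => Φ y * expChar ζ y) -
        pair T (fun y => Φ y * expChar ζ y)‖ ≤ ε := by
  obtain ⟨δ, hδ, hdiff⟩ :=
    Metric.eventually_nhds_iff.1 (h.eventually_norm_pair_translate_sub_le hΦ N hε)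
  filter_upwards [hR.support δ hδ] with j hj ζ hζ
  have continuous_translate :
      Continuous fun s => pair T (fun y => Φ (y + s) * expChar ζ (y + s)) :=
    continuous_pair_translate T (hΦ.mul (contDiff_expChar ζ))
  have norm_sub_le := hR.norm_integral_sub_le j continuous_translate
    (pair T (fun y => Φ y * expChar ζ y)) fun s hs => hdiff (by simpa using hj s hs) ζ hζ
  rw [pair_ofFunction_mollify T (hR.test j) (hΦ.mul (contDiff_expChar ζ))]
  calc ‖ζ‖ ^ N * _ ≤ (1 + ‖ζ‖) ^ N * (ε / (1 + ‖ζ‖) ^ N) := by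
        gcongr
        linarith
    _ = ε := mul_div_cancel₀ _ (by positivity)

end Mollifier

section Tensor

variable {X : Type*} [NormedAddCommGroup X] [NormedSpace ℝ X] [FiniteDimensional ℝ X]
  [MeasureSpace X] [BorelSpace X] [(volume : Measure X).IsAddHaarMeasure]
  [MeasureSpace E] [BorelSpace E] [(volume : Measure E).IsAddHaarMeasure]

theorem uniformDecay_tensorDistr (f : Distr X) (g : Distr E) {φ : X × E → ℝ} (hφ : IsTest φ)
    {V : Set (X × E →L[ℝ] ℝ)} (hV : IsClosed V) (hVc : IsConic V)
    (hd : Disjoint (tensorCone (singularSupport f) (singularSupport g)) (tsupport φ ×ˢ V)) :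
    UniformDecay (tensorDistr f g) (fun z => (φ z : ℂ)) V := by
  by_cases hV0 : V ⊆ {0}
  · exact uniformDecay_of_subset_zero _ hφ.ofReal hV0
  obtain ⟨ζ₁, hζ₁, hζ₁0⟩ := not_subset.1 hV0
  rcases (tsupport φ).eq_empty_or_nonempty with hempty | ⟨z₁, hz₁⟩
  · refine ⟨1, one_pos, fun N => ⟨0, le_rfl, fun s _ ζ _ => ?_⟩⟩
    simp [tsupport_eq_empty_iff.1 hempty, pair_zero]
  have notMem_cone {z : X × E} (hz : z ∈ tsupport φ) {ζ : X × E →L[ℝ] ℝ} (hζ : ζ ∈ V)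
      (hcone : (z, ζ) ∈ tensorCone (singularSupport f) (singularSupport g)) : False :=
    disjoint_left.1 hd hcone ⟨hz, hζ⟩
  obtain ⟨c, hc⟩ := exists_norm_le_of_isClosed_isConic hV hVc (.inl ℝ X E) fun ζ hζ hζl => by
    by_contra hζ0
    exact notMem_cone hz₁ hζ ⟨hζ0, .inr (.inl hζl)⟩
  obtain ⟨c', hc'⟩ := exists_norm_le_of_isClosed_isConic hV hVc (.inr ℝ X E) fun ζ hζ hζr => by
    by_contra hζ0
    exact notMem_cone hz₁ hζ ⟨hζ0, .inr (.inr hζr)⟩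
  -- On the support of `φ` at most one factor is singular.
  obtain ⟨Φ, Φ', hΦ, hΦ', φ_eq, hΦf, hΦg⟩ := hφ.ofReal.exists_add_eq_of_disjoint
    ((isClosed_singularSupport f).preimage continuous_fst)
    ((isClosed_singularSupport g).preimage continuous_snd)
    (disjoint_left.2 fun z hz hz' =>
      notMem_cone (tsupport_ofReal_subset φ hz.1) hζ₁ ⟨hζ₁0, .inl ⟨hz.2, hz'⟩⟩)
  rw [φ_eq]
  exact (uniformDecay_tensorDistr_left f g hΦ (disjoint_image_left.2 hΦf) hc).add hΦ hΦ'
    (uniformDecay_tensorDistr_right f g hΦ' (disjoint_image_left.2 hΦg) hc')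

end Tensor

theorem tendstoIn_mollify_tensorDistr [MeasureSpace E] [BorelSpace E]
    [(volume : Measure E).IsAddHaarMeasure] (f g : Distr E) {R : ℕ → E × E → ℝ}
    (hR : IsMollifier R) :
    TendstoIn (tensorCone (singularSupport f) (singularSupport g))
      (fun j => ofFunction (mollify (tensorDistr f g) (R j))) (tensorDistr f g) where
  mem_seq j := by
    rw [waveFrontSet_ofFunction (contDiff_mollify _ (hR.test j))]
    exact empty_subset _
  mem_limit := waveFrontSet_tensorDistr_subset f g
  weak φ := by
    simpa only [pair_ofReal] using hR.tendsto_pair (tensorDistr f g) (isTest_test φ).ofReal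
  fourier φ V hV hVc hd N ε hε := by
    simp_rw [localFourier_eq_pair]
    exact hR.eventually_fourier_le (isTest_test φ).ofReal
      (uniformDecay_tensorDistr f g (isTest_test φ) hV hVc hd) N hε

end Approximation

section Diagonal

variable {E : Type*} [NormedAddCommGroup E] [NormedSpace ℝ E] [FiniteDimensional ℝ E]

theorem continuous_pair_translate_mul (u : Distr E) {φ q : E → ℂ} (h : IsTest φ)
    (hq : ContDiff ℝ ∞ q) :
    Continuous (fun p : E × E => pair u (fun y => φ (y + p.1) * q (y + p.1 - p.2))) := by
  refine (contDiff_pair_slice u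
    (Ψ := fun z : (E × E) × E => φ (z.2 + z.1.1) * q (z.2 + z.1.1 - z.1.2))
    fun χ hχ => ?_).continuous
  have contDiff_factor : ContDiff ℝ ∞ (fun z : (E × E) × E => q (z.2 + z.1.1 - z.1.2)) :=
    hq.comp (by fun_prop)
  simpa only [ContinuousLinearMap.coe_fst', mul_assoc] using
    (hχ.ofReal.mul_comp_add h (.fst ℝ E E)).mul contDiff_factor

omit [FiniteDimensional ℝ E] in
theorem IsTest.integrable [MeasureSpace E] [BorelSpace E]
    [IsFiniteMeasureOnCompacts (volume : Measure E)] {ψ : E → ℂ} (h : IsTest ψ) : Integrable ψ :=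
  h.continuous.integrable_of_hasCompactSupport h.compact

variable [MeasureSpace E] [BorelSpace E] [(volume : Measure E).IsAddHaarMeasure]

theorem mollify_ofFunction {q : E → ℂ} (hq : Continuous q) {r : E → ℝ} (hr : IsTest r) (x : E) :
    mollify (ofFunction q) r x = ∫ s, (r s : ℂ) * q (x - s) := by
  rw [mollify, pair_ofFunction hq (hr.comp_sub_left x).ofReal, ← integral_sub_left_eq_self _ _ x]
  simp

theorem pair_mul_mollify_ofFunction (g : Distr E) {φ q : E → ℂ} (hφ : IsTest φ)
    (hq : ContDiff ℝ ∞ q) {r : E → ℝ} (hr : IsTest r) (t : E) :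
    pair g (fun y => φ (y + t) * mollify (ofFunction q) r (y + t)) =
      ∫ s, (r s : ℂ) * pair g (fun y => φ (y + t) * q (y + t - s)) := by
  have contDiff_factor : ContDiff ℝ ∞ (fun z : E × E => q (z.2 + t - z.1)) := hq.comp (by fun_prop)
  have isTest_integrand :
      IsTest (fun z : E × E => (r z.1 : ℂ) * (φ (z.2 + t) * q (z.2 + t - z.1))) := by
    simpa only [mul_assoc] using
      (hr.ofReal.tensor (hφ.comp_add_right t)).mul contDiff_factor
  have isTest_product (s : E) : IsTest (fun y => φ (y + t) * q (y + t - s)) :=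
    (hφ.comp_add_right t).mul (hq.comp (by fun_prop))
  calc pair g (fun y => φ (y + t) * mollify (ofFunction q) r (y + t))
      = pair g (fun y => ∫ s, (r s : ℂ) * (φ (y + t) * q (y + t - s))) := by
        simp_rw [mollify_ofFunction hq.continuous hr, ← integral_const_mul, mul_left_comm]
    _ = ∫ s, (r s : ℂ) * pair g (fun y => φ (y + t) * q (y + t - s)) := by
        rw [pair_integral volume g isTest_integrand]
        simp_rw [fun s => pair_const_mul g (isTest_product s) (r s : ℂ)]

theorem integral_mul_mollify_ofFunction_mul_mollify (g : Distr E) {φ q : E → ℂ} (hφ : IsTest φ)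
    (hq : ContDiff ℝ ∞ q) {r : E → ℝ} (hr : IsTest r) :
    ∫ x, φ x * mollify (ofFunction q) r x * mollify g r x =
      ∫ p : E × E, ((r p.1 * r p.2 : ℝ) : ℂ) *
        pair g (fun y => φ (y + p.1) * q (y + p.1 - p.2)) := by
  have isTest_mul : IsTest (fun x => φ x * mollify (ofFunction q) r x) :=
    hφ.mul (contDiff_mollify _ hr)
  have integrable_density : Integrable (fun p : E × E => ((r p.1 * r p.2 : ℝ) : ℂ) *
      pair g (fun y => φ (y + p.1) * q (y + p.1 - p.2))) :=
    ((hr.tensor hr).ofReal.continuous.mul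
      (continuous_pair_translate_mul g hφ hq)).integrable_of_hasCompactSupport
        (hr.tensor hr).ofReal.compact.mul_right
  rw [← pair_ofFunction (contDiff_mollify g hr).continuous isTest_mul,
    pair_ofFunction_mollify g hr isTest_mul, Measure.volume_eq_prod,
    integral_prod _ integrable_density]
  simp_rw [pair_mul_mollify_ofFunction g hφ hq hr, ← integral_const_mul, Complex.ofReal_mul,
    mul_assoc]

theorem EqNear.eventually_mollify_eq {f : Distr E} {a : E → ℂ} {K : Set E} (hfa : EqNear f a K)
    (hK : IsCompact K) (ha : Continuous a) {R : ℕ → E → ℝ} (hR : IsMollifier R) :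
    ∀ᶠ j in atTop, ∀ x ∈ K, mollify f (R j) x = mollify (ofFunction a) (R j) x := by
  obtain ⟨O, hO, hKO, hfa⟩ := hfa
  obtain ⟨δ, hδ, hδO⟩ := hK.exists_cthickening_subset_open hO hKO
  filter_upwards [hR.support δ hδ] with j hj x hx
  have isTest_kernel := ((hR.test j).comp_sub_left x).ofReal
  have tsupport_kernel : tsupport (fun y => (R j (x - y) : ℂ)) ⊆ Metric.closedBall x δ :=
    closure_minimal (fun y hy => mem_closedBall_iff_norm'.2
      (hj (x - y) fun h => hy (by simp [h])).le) Metric.isClosed_closedBall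
  rw [mollify, mollify, pair_ofFunction ha isTest_kernel, hfa _ isTest_kernel
    (tsupport_kernel.trans ((Metric.closedBall_subset_cthickening hx δ).trans hδO))]

theorem IsMollifier.tendsto_integral_mul_mollify {R : ℕ → E → ℝ} (hR : IsMollifier R)
    {f : Distr E} (g : Distr E) {a : E → ℂ} (ha : ContDiff ℝ ∞ a) {φ : E → ℂ} (hφ : IsTest φ)
    (hfa : EqNear f a (tsupport φ)) :
    Tendsto (fun j => ∫ x, φ x * mollify f (R j) x * mollify g (R j) x) atTop
      (𝓝 (pair g (fun x => φ x * a x))) := by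
  have tendsto_smooth :=
    hR.prod.tendsto_integral (continuous_pair_translate_mul g hφ ha)
  simp only [Prod.fst_zero, Prod.snd_zero, add_zero, sub_zero] at tendsto_smooth
  refine tendsto_smooth.congr' ?_
  filter_upwards [hfa.eventually_mollify_eq hφ.compact ha.continuous hR] with j hj
  rw [← integral_mul_mollify_ofFunction_mul_mollify g hφ ha (hR.test j)]
  refine integral_congr_ae (ae_of_all _ fun x => ?_)
  by_cases hx : x ∈ tsupport φ
  · simp only [hj x hx]
  · simp [image_eq_zero_of_notMem_tsupport hx]

theorem exists_partition_eqNear (f g : Distr E)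
    (hfg : Disjoint (singularSupport f) (singularSupport g)) :
    ∃ χ a b : E → ℂ, ContDiff ℝ ∞ χ ∧ ContDiff ℝ ∞ a ∧ ContDiff ℝ ∞ b ∧
      EqNear f a (tsupport χ) ∧ EqNear g b (tsupport fun x => 1 - χ x) := by
  obtain ⟨χ, hχ, hχ0, hχ1⟩ := exists_contDiff_zero_one_nhdsSet (isClosed_singularSupport f)
    (isClosed_singularSupport g) hfg
  obtain ⟨a, ha, hfa⟩ := exists_contDiff_eqNear f (s := tsupport fun x => (χ x : ℂ))
    (isClosed_tsupport _)
    (disjoint_tsupport_of_eventually_eq_zero (hχ0.mono fun x hx => by simp [hx]))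
  obtain ⟨b, hb, hgb⟩ := exists_contDiff_eqNear g (s := tsupport fun x => 1 - (χ x : ℂ))
    (isClosed_tsupport _)
    (disjoint_tsupport_of_eventually_eq_zero (hχ1.mono fun x hx => by simp [hx]))
  exact ⟨fun x => χ x, a, b, Complex.ofRealCLM.contDiff.comp hχ, ha, hb, hfa, hgb⟩

theorem exists_tendsto_integral_mollify_mul_mollify (f g : Distr E)
    (hfg : Disjoint (singularSupport f) (singularSupport g)) :
    ∃ (p : Distr E) (m₁ m₂ : E → ℂ), ContDiff ℝ ∞ m₁ ∧ ContDiff ℝ ∞ m₂ ∧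
      (∀ ψ, IsTest ψ → pair p ψ = pair g (fun x => ψ x * m₁ x) + pair f (fun x => ψ x * m₂ x)) ∧
      ∀ R : ℕ → E → ℝ, IsMollifier R → ∀ φ, IsTest φ →
        Tendsto (fun j => ∫ x, φ x * (mollify f (R j) x * mollify g (R j) x)) atTop
          (𝓝 (pair p φ)) := by
  obtain ⟨χ, a, b, hχ, ha, hb, hfa, hgb⟩ := exists_partition_eqNear f g hfg
  have hχ' : ContDiff ℝ ∞ (fun x => 1 - χ x) := contDiff_const.sub hχ
  have pair_eq_add (ψ : E → ℂ) (h : IsTest ψ) :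
      pair (mulDistr g _ (hχ.mul ha) + mulDistr f _ (hχ'.mul hb)) ψ =
        pair g (fun x => ψ x * (χ x * a x)) + pair f (fun x => ψ x * ((1 - χ x) * b x)) := by
    rw [pair_add_distr _ _ h, pair_mulDistr _ _ h, pair_mulDistr _ _ h]
  refine ⟨_, _, _, hχ.mul ha, hχ'.mul hb, pair_eq_add, fun R hR φ hφ => ?_⟩
  have tendsto_left := hR.tendsto_integral_mul_mollify g ha (hφ.mul hχ)
    (hfa.mono tsupport_mul_subset_right)
  have tendsto_right := hR.tendsto_integral_mul_mollify f hb (hφ.mul hχ')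
    (hgb.mono tsupport_mul_subset_right)
  rw [pair_eq_add φ hφ]
  simp_rw [← mul_assoc]
  refine (tendsto_left.add tendsto_right).congr fun j => ?_
  have contDiff_f := contDiff_mollify f (hR.test j)
  have contDiff_g := contDiff_mollify g (hR.test j)
  rw [← integral_add (((hφ.mul hχ).mul contDiff_f).mul contDiff_g).integrable
    (((hφ.mul hχ').mul contDiff_g).mul contDiff_f).integrable]
  exact integral_congr_ae (ae_of_all _ fun x => by ring)

end Diagonal

section HolderBounds

theorem HasDerivBound.clm_comp {E G G' : Type*} [NormedAddCommGroup E] [NormedSpace ℝ E]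
    [NormedAddCommGroup G] [NormedSpace ℝ G] [NormedAddCommGroup G'] [NormedSpace ℝ G'] {M : ℕ}
    {ψ : E → G} {B : ℝ} (hB : HasDerivBound M ψ B) (h : ContDiff ℝ ∞ ψ) {L : G →L[ℝ] G'}
    (hL : ‖L‖ ≤ 1) : HasDerivBound M (fun x => L (ψ x)) B := fun i hi x =>
  (L.norm_iteratedFDeriv_comp_left h.contDiffAt (by exact_mod_cast le_top)).trans
    ((mul_le_of_le_one_left (norm_nonneg _) hL).trans (hB i hi x))

theorem HasDerivBound.re {E : Type*} [NormedAddCommGroup E] [NormedSpace ℝ E] {M : ℕ} {ψ : E → ℂ}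
    {B : ℝ} (hB : HasDerivBound M ψ B) (h : ContDiff ℝ ∞ ψ) :
    HasDerivBound M (fun x => (ψ x).re) B :=
  hB.clm_comp h Complex.reCLM_norm.le

theorem HasDerivBound.im {E : Type*} [NormedAddCommGroup E] [NormedSpace ℝ E] {M : ℕ} {ψ : E → ℂ}
    {B : ℝ} (hB : HasDerivBound M ψ B) (h : ContDiff ℝ ∞ ψ) :
    HasDerivBound M (fun x => (ψ x).im) B :=
  hB.clm_comp h Complex.imCLM_norm.le

variable {d : ℕ}

theorem rescale_apply (φ : Test (EuclideanSpace ℝ (Fin d))) (x : EuclideanSpace ℝ (Fin d))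
    {lam : ℝ} (hlam : 0 < lam) (y : EuclideanSpace ℝ (Fin d)) :
    rescale φ x lam hlam y = (lam ^ d)⁻¹ * φ (lam⁻¹ • (x - y)) := rfl

theorem rescale_smul (c : ℝ) (φ : Test (EuclideanSpace ℝ (Fin d)))
    (x : EuclideanSpace ℝ (Fin d)) {lam : ℝ} (hlam : 0 < lam) :
    rescale (c • φ) x lam hlam = c • rescale φ x lam hlam := by
  ext y
  change (lam ^ d)⁻¹ * (c * φ (lam⁻¹ • (x - y))) = c * ((lam ^ d)⁻¹ * φ (lam⁻¹ • (x - y)))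
  ring

theorem inv_smul_mem_unitTests {φ : Test (EuclideanSpace ℝ (Fin d))}
    (hφ : tsupport φ ⊆ Metric.ball 0 1) {r : ℕ} {B : ℝ} (hB : 0 < B) (hφB : HasDerivBound r φ B) :
    B⁻¹ • φ ∈ unitTests d r := by
  refine ⟨(closure_mono (Function.support_const_smul_subset B⁻¹ φ)).trans hφ, fun i hi x => ?_⟩
  have deriv_eq : iteratedFDeriv ℝ i (B⁻¹ • φ : Test _) x = B⁻¹ • iteratedFDeriv ℝ i φ x :=
    iteratedFDeriv_const_smul_apply (φ.contDiff.contDiffAt.of_le (by exact_mod_cast le_top))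
  rw [deriv_eq, norm_smul, Real.norm_of_nonneg (inv_nonneg.2 hB.le), inv_mul_le_one₀ hB]
  exact hφB i hi x

theorem exists_bound_rescale {u : Distr (EuclideanSpace ℝ (Fin d))} {α : ℝ}
    (hu : u ∈ negHolderLoc d α) {K : Set (EuclideanSpace ℝ (Fin d))} (hK : IsCompact K) :
    ∃ C, 0 ≤ C ∧ ∀ x ∈ K, ∀ (lam : ℝ) (hlam : 0 < lam), lam ≤ 1 →
      ∀ φ : Test (EuclideanSpace ℝ (Fin d)), tsupport φ ⊆ Metric.ball 0 1 →
        ∀ B, HasDerivBound (-strictFloor α).toNat φ B →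
          ‖u (rescale φ x lam hlam)‖ ≤ C * B * lam ^ α := by
  obtain ⟨C, hC⟩ := hu K hK
  refine ⟨|C|, abs_nonneg C, fun x hx lam hlam hlam1 φ hφ B hB => ?_⟩
  rcases hB.nonneg.eq_or_lt with rfl | hB0
  · have rescale_eq_zero : rescale φ x lam hlam = 0 := by
      ext y
      rw [rescale_apply, norm_le_zero_iff.1 (hB.norm_le _), mul_zero]
      rfl
    simp [rescale_eq_zero]
  · have bound := hC x hx lam hlam hlam1 _ (inv_smul_mem_unitTests hφ hB0 hB)
    rw [rescale_smul, map_smul, norm_smul, Real.norm_of_nonneg (inv_nonneg.2 hB0.le),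
      inv_mul_le_iff₀ hB0] at bound
    calc ‖u (rescale φ x lam hlam)‖ ≤ B * (C * lam ^ α) := bound
      _ ≤ B * (|C| * lam ^ α) := by
        gcongr
        exact le_abs_self C
      _ = |C| * B * lam ^ α := by ring

theorem pair_rescale (u : Distr (EuclideanSpace ℝ (Fin d))) {ψ : EuclideanSpace ℝ (Fin d) → ℂ}
    (h : IsTest ψ) (x : EuclideanSpace ℝ (Fin d)) {lam : ℝ} (hlam : 0 < lam) :
    pair u (fun y => ((lam ^ d)⁻¹ : ℝ) * ψ (lam⁻¹ • (x - y))) =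
      u (rescale (toTest _ h.re) x lam hlam) +
        Complex.I * u (rescale (toTest _ h.im) x lam hlam) := by
  have re_add_im : (fun y => (((lam ^ d)⁻¹ : ℝ) : ℂ) * ψ (lam⁻¹ • (x - y))) =
      fun y => (rescale (toTest _ h.re) x lam hlam y : ℂ) +
        Complex.I * (rescale (toTest _ h.im) x lam hlam y : ℂ) := by
    ext y
    simp only [rescale_apply, toTest_apply]
    conv_lhs => rw [← Complex.re_add_im (ψ (lam⁻¹ • (x - y)))]
    push_cast
    ring
  rw [re_add_im, pair_add u (isTest_test _).ofReal ((isTest_test _).ofReal.const_mul _),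
    pair_const_mul u (isTest_test _).ofReal, pair_ofReal, pair_ofReal]

theorem exists_bound_pair_rescale {u : Distr (EuclideanSpace ℝ (Fin d))} {α : ℝ}
    (hu : u ∈ negHolderLoc d α) {K : Set (EuclideanSpace ℝ (Fin d))} (hK : IsCompact K) :
    ∃ C, 0 ≤ C ∧ ∀ x ∈ K, ∀ lam : ℝ, 0 < lam → lam ≤ 1 →
      ∀ ψ : EuclideanSpace ℝ (Fin d) → ℂ, IsTest ψ → tsupport ψ ⊆ Metric.ball 0 1 →
        ∀ B, HasDerivBound (-strictFloor α).toNat ψ B →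
          ‖pair u (fun y => ((lam ^ d)⁻¹ : ℝ) * ψ (lam⁻¹ • (x - y)))‖ ≤ C * B * lam ^ α := by
  obtain ⟨C, hC0, hC⟩ := exists_bound_rescale hu hK
  refine ⟨2 * C, by positivity, fun x hx lam hlam hlam1 ψ h hs B hB => ?_⟩
  have bound_re := hC x hx lam hlam hlam1 (toTest _ h.re)
    ((tsupport_comp_subset Complex.zero_re ψ).trans hs) B (hB.re h.smooth)
  have bound_im := hC x hx lam hlam hlam1 (toTest _ h.im)
    ((tsupport_comp_subset Complex.zero_im ψ).trans hs) B (hB.im h.smooth)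
  rw [pair_rescale u h x hlam]
  refine (norm_add_le _ _).trans ?_
  rw [norm_mul, Complex.norm_I, one_mul]
  linarith

theorem exists_bound_iteratedFDeriv_dilation {E : Type*} [NormedAddCommGroup E] [NormedSpace ℝ E]
    [ProperSpace E] {m : E → ℂ} (hm : ContDiff ℝ ∞ m) {K : Set E} (hK : IsCompact K) (M : ℕ) :
    ∃ C, 0 ≤ C ∧ ∀ x ∈ K, ∀ c : ℝ, |c| ≤ 1 → ∀ i ≤ M, ∀ z ∈ Metric.ball (0 : E) 1,
      ‖iteratedFDeriv ℝ i (fun z => m (x + c • z)) z‖ ≤ C := by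
  obtain ⟨C, hC0, hC⟩ := exists_bound_iteratedFDeriv_on hm (hK.cthickening (r := 1)) M
  refine ⟨C, hC0, fun x hx c hc i hi z hz => ?_⟩
  let A : E →L[ℝ] E := c • ContinuousLinearMap.id ℝ E
  have norm_A_le : ‖A‖ ≤ 1 := (norm_smul_le c (ContinuousLinearMap.id ℝ E)).trans
    (mul_le_one₀ hc (norm_nonneg _) ContinuousLinearMap.norm_id_le)
  have mem_cthickening : x + A z ∈ Metric.cthickening 1 K := by
    refine Metric.mem_cthickening_of_dist_le _ x 1 K hx ?_
    rw [dist_eq_norm, add_sub_cancel_left]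
    exact (A.le_opNorm z).trans (mul_le_one₀ norm_A_le (norm_nonneg _) (mem_ball_zero_iff.1 hz).le)
  calc ‖iteratedFDeriv ℝ i (fun z => m (x + A z)) z‖
      ≤ ‖iteratedFDeriv ℝ i m (x + A z)‖ * ‖A‖ ^ i := norm_iteratedFDeriv_comp_affine_le hm A x i z
    _ ≤ ‖iteratedFDeriv ℝ i m (x + A z)‖ :=
        mul_le_of_le_one_right (norm_nonneg _) (pow_le_one₀ (norm_nonneg _) norm_A_le)
    _ ≤ C := hC i hi _ mem_cthickening

theorem toNat_neg_strictFloor_anti {α γ : ℝ} (h : γ ≤ α) :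
    (-strictFloor α).toNat ≤ (-strictFloor γ).toNat := by
  have := Int.ceil_mono h
  unfold strictFloor
  omega

theorem exists_bound_pair_rescale_mul {u : Distr (EuclideanSpace ℝ (Fin d))} {α γ : ℝ}
    (hu : u ∈ negHolderLoc d α) (hγ : γ ≤ α) {m : EuclideanSpace ℝ (Fin d) → ℂ}
    (hm : ContDiff ℝ ∞ m) {K : Set (EuclideanSpace ℝ (Fin d))} (hK : IsCompact K) :
    ∃ C, ∀ x ∈ K, ∀ (lam : ℝ) (hlam : 0 < lam), lam ≤ 1 →
      ∀ φ ∈ unitTests d (-strictFloor γ).toNat,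
        ‖pair u (fun y => (rescale φ x lam hlam y : ℂ) * m y)‖ ≤ C * lam ^ γ := by
  set r := (-strictFloor α).toNat
  obtain ⟨C, hC0, hC⟩ := exists_bound_pair_rescale hu hK
  obtain ⟨C', hC'0, hC'⟩ := exists_bound_iteratedFDeriv_dilation hm hK r
  refine ⟨C * (2 ^ r * C' * 1), fun x hx lam hlam hlam1 φ hφ => ?_⟩
  have hφt := (isTest_test φ).ofReal
  have hφs : tsupport (fun z => (φ z : ℂ)) ⊆ Metric.ball 0 1 :=
    (tsupport_comp_subset Complex.ofReal_zero φ).trans hφ.1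
  have hφr : HasDerivBound r φ 1 := fun i hi => hφ.2 i (hi.trans (toNat_neg_strictFloor_anti hγ))
  have hm_dilation : ContDiff ℝ ∞ fun z => m (x + (-lam) • z) :=
    hm.comp (contDiff_const.add (contDiff_id.const_smul (-lam)))
  have bound_mul : HasDerivBound r (fun z => (φ z : ℂ) * m (x + (-lam) • z)) (2 ^ r * C' * 1) :=
    (hφr.clm_comp φ.contDiff Complex.ofRealCLM_norm.le).mul hφt hm_dilation hC'0
      fun i hi z hz => hC' x hx (-lam) (by rwa [abs_neg, abs_of_pos hlam]) i hi z (hφs hz)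
  have rescale_mul : (fun y => (rescale φ x lam hlam y : ℂ) * m y) =
      fun y => (((lam ^ d)⁻¹ : ℝ) : ℂ) *
        ((φ (lam⁻¹ • (x - y)) : ℂ) * m (x + (-lam) • lam⁻¹ • (x - y))) := by
    ext y
    have undo_dilation : x + (-lam) • lam⁻¹ • (x - y) = y := by
      rw [neg_smul, smul_inv_smul₀ hlam.ne', neg_sub, add_sub_cancel]
    rw [undo_dilation, rescale_apply]
    push_cast
    ring
  rw [rescale_mul]
  refine (hC x hx lam hlam hlam1 _ (hφt.mul hm_dilation) (tsupport_mul_subset_left.trans hφs) _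
    bound_mul).trans (mul_le_mul_of_nonneg_left ?_ (by positivity))
  exact Real.rpow_le_rpow_of_exponent_ge hlam hlam1 hγ

theorem mem_negHolderLoc_of_pair {f g p : Distr (EuclideanSpace ℝ (Fin d))} {α β γ : ℝ}
    (hf : f ∈ negHolderLoc d α) (hg : g ∈ negHolderLoc d β) (hγα : γ ≤ α) (hγβ : γ ≤ β)
    {m₁ m₂ : EuclideanSpace ℝ (Fin d) → ℂ} (hm₁ : ContDiff ℝ ∞ m₁) (hm₂ : ContDiff ℝ ∞ m₂)
    (hp : ∀ ψ, IsTest ψ → pair p ψ = pair g (fun x => ψ x * m₁ x) + pair f (fun x => ψ x * m₂ x)) :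
    p ∈ negHolderLoc d γ := by
  intro K hK
  obtain ⟨C₁, hC₁⟩ := exists_bound_pair_rescale_mul hg hγβ hm₁ hK
  obtain ⟨C₂, hC₂⟩ := exists_bound_pair_rescale_mul hf hγα hm₂ hK
  refine ⟨C₁ + C₂, fun x hx lam hlam hlam1 φ hφ => ?_⟩
  rw [← pair_ofReal, hp _ (isTest_test _).ofReal, add_mul]
  exact (norm_add_le _ _).trans
    (add_le_add (hC₁ x hx lam hlam hlam1 φ hφ) (hC₂ x hx lam hlam hlam1 φ hφ))

end HolderBounds

section Fourier

open scoped FourierTransform InnerProductSpace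

variable {E W : Type*} [NormedAddCommGroup E] [InnerProductSpace ℝ E] [FiniteDimensional ℝ E]
  [MeasurableSpace E] [BorelSpace E] [NormedAddCommGroup W] [InnerProductSpace ℝ W]
  [FiniteDimensional ℝ W] [MeasurableSpace W] [BorelSpace W]

theorem IsTest.exists_fourier_eq {ψ : E → ℂ} (h : IsTest ψ) : ∃ S : SchwartzMap E ℂ, 𝓕 ψ = S :=
  ⟨𝓕 (h.compact.toSchwartzMap h.smooth), rfl⟩

theorem IsTest.continuous_fourier {ψ : E → ℂ} (h : IsTest ψ) : Continuous (𝓕 ψ) := by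
  obtain ⟨S, hS⟩ := h.exists_fourier_eq
  exact hS ▸ S.continuous

theorem IsTest.integrable_fourier {ψ : E → ℂ} (h : IsTest ψ) : Integrable (𝓕 ψ) := by
  obtain ⟨S, hS⟩ := h.exists_fourier_eq
  exact hS ▸ S.integrable

theorem IsTest.exists_fourier_decay {ψ : E → ℂ} (h : IsTest ψ) (N : ℕ) :
    ∃ C, 0 ≤ C ∧ ∀ ξ, (1 + ‖ξ‖) ^ N * ‖𝓕 ψ ξ‖ ≤ C := by
  obtain ⟨S, hS⟩ := h.exists_fourier_eq
  rw [hS]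
  have decay :=
    S.one_add_le_sup_seminorm_apply (𝕜 := ℝ) (m := (N, 0)) (k := N) (n := 0) le_rfl le_rfl
  simp only [norm_iteratedFDeriv_zero] at decay
  exact ⟨_, (mul_nonneg (by positivity) (norm_nonneg _)).trans (decay 0), decay⟩

theorem IsTest.fourierInv_fourier {ψ : E → ℂ} (h : IsTest ψ) : 𝓕⁻ (𝓕 ψ) = ψ :=
  h.continuous.fourierInv_fourier_eq h.integrable h.integrable_fourier

/-- The inverse Fourier transform of the image under `D` of the measure with density `φ`. -/
def pushFourierInv (D : E →L[ℝ] W) (φ : E → ℂ) (ξ : W) : ℂ := 𝓕 φ (-(D.adjoint ξ))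

theorem integral_mul_comp_eq_integral_pushFourierInv (D : E →L[ℝ] W) {φ : E → ℂ} (hφ : IsTest φ)
    {H : W → ℂ} (hH : IsTest H) :
    ∫ x, φ x * H (D x) = ∫ ξ, pushFourierInv D φ ξ * 𝓕 H ξ := by
  let L : E →ₗ[ℝ] W →ₗ[ℝ] ℝ := -((innerₗ W).comp D.toLinearMap)
  have continuous_L : Continuous fun p : E × W => L p.1 p.2 := by
    have : Continuous fun p : E × W => -⟪D p.1, p.2⟫_ℝ := by fun_prop
    exact this
  have fourier_eq (ξ : W) :
      VectorFourier.fourierIntegral Real.fourierChar volume L φ ξ = pushFourierInv D φ ξ := by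
    rw [pushFourierInv, Real.fourier_eq, VectorFourier.fourierIntegral]
    simp [L, ContinuousLinearMap.adjoint_inner_right]
  have fourier_flip_eq (x : E) :
      VectorFourier.fourierIntegral Real.fourierChar volume L.flip (𝓕 H) x = H (D x) := by
    rw [← congrFun hH.fourierInv_fourier (D x), Real.fourierInv_eq, VectorFourier.fourierIntegral]
    simp [L, real_inner_comm]
  have flip := VectorFourier.integral_fourierIntegral_smul_eq_flip (μ := volume) (ν := volume)
    Real.continuous_fourierChar continuous_L hφ.integrable hH.integrable_fourier
  simp_rw [fourier_eq, fourier_flip_eq, smul_eq_mul] at flip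
  exact flip.symm

theorem integral_mul_fourier_eq {m H : W → ℂ} (hm : Integrable m) (hH : Integrable H) :
    ∫ ξ, m ξ * 𝓕 H ξ = ∫ w, 𝓕 m w * H w := by
  have flip := VectorFourier.integral_fourierIntegral_smul_eq_flip (e := Real.fourierChar)
    (μ := (volume : Measure W)) (ν := (volume : Measure W)) (L := innerₗ W)
    Real.continuous_fourierChar continuous_inner hm hH
  rw [flip_innerₗ] at flip
  exact flip.symm

theorem tendsto_integral_mul_fourier_of_decay {m : W → ℂ} (hm : AEStronglyMeasurable m)
    (hdecay : ∀ N : ℕ, ∃ C, ∀ ξ, ‖ξ‖ ^ N * ‖m ξ‖ ≤ C) {H : ℕ → W → ℂ} (hH : ∀ j, IsTest (H j))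
    {χ : W → ℂ} (hχ : IsTest χ) (hχH : ∀ j w, H j w * χ w = H j w)
    (hweak : ∀ ψ, IsTest ψ → Tendsto (fun j => ∫ w, H j w * ψ w) atTop (𝓝 0)) :
    Tendsto (fun j => ∫ ξ, m ξ * 𝓕 (H j) ξ) atTop (𝓝 0) := by
  obtain ⟨C₀, hC₀⟩ := hdecay 0
  simp only [pow_zero, one_mul] at hC₀
  have integrable_pow_mul (N : ℕ) : Integrable fun ξ => ‖ξ‖ ^ N * ‖m ξ‖ := by
    obtain ⟨C, hC⟩ := hdecay (N + (volume : Measure W).integrablePower)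
    exact integrable_of_le_of_pow_mul_le hC₀ hC hm
  have integrable_m : Integrable m := by
    simpa [integrable_norm_iff hm] using integrable_pow_mul 0
  have contDiff_fourier : ContDiff ℝ ∞ (𝓕 m) :=
    Real.contDiff_fourier (N := ⊤) fun n _ => integrable_pow_mul n
  refine (hweak _ (hχ.mul contDiff_fourier)).congr fun j => ?_
  rw [integral_mul_fourier_eq integrable_m (hH j).integrable]
  refine integral_congr_ae (ae_of_all _ fun w => ?_)
  beta_reduce
  rw [← mul_assoc, hχH, mul_comm]

theorem one_add_pow_le {t : ℝ} (ht : 0 ≤ t) (n : ℕ) : (1 + t) ^ n ≤ 2 ^ n * (1 + t ^ n) := by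
  refine (add_pow_le zero_le_one ht n).trans ?_
  rw [one_pow]
  exact mul_le_mul_of_nonneg_right (pow_le_pow_right₀ one_le_two (Nat.sub_le _ _)) (by positivity)

theorem tendsto_integral_mul_of_decay {V : Type*} [NormedAddCommGroup V] [MeasurableSpace V]
    {μ : Measure V} [μ.HasTemperateGrowth] {m : V → ℂ} (hm : AEStronglyMeasurable m μ) {C : ℝ}
    (hmC : ∀ ξ, ‖m ξ‖ ≤ C) {F : ℕ → V → ℂ} (hFm : ∀ j, AEStronglyMeasurable (F j) μ)
    (hF : ∀ (N : ℕ) (ε : ℝ), 0 < ε → ∀ᶠ j in atTop, ∀ ξ, m ξ ≠ 0 → ‖ξ‖ ^ N * ‖F j ξ‖ ≤ ε) :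
    Tendsto (fun j => ∫ ξ, m ξ * F j ξ ∂μ) atTop (𝓝 0) := by
  let n := μ.integrablePower
  have bound : ∀ᶠ j in atTop, ∀ ξ,
      ‖m ξ * F j ξ‖ ≤ C * (2 ^ n * 2) * (1 + ‖ξ‖) ^ (-(n : ℝ)) := by
    filter_upwards [hF 0 1 one_pos, hF n 1 one_pos] with j h0 hn ξ
    have hC : 0 ≤ C := (norm_nonneg _).trans (hmC ξ)
    by_cases hξ : m ξ = 0
    · rw [hξ, zero_mul, norm_zero]
      positivity
    have F_bound : (1 + ‖ξ‖) ^ n * ‖F j ξ‖ ≤ 2 ^ n * 2 := calc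
      (1 + ‖ξ‖) ^ n * ‖F j ξ‖ ≤ 2 ^ n * (1 + ‖ξ‖ ^ n) * ‖F j ξ‖ := by
        gcongr
        exact one_add_pow_le (norm_nonneg ξ) n
      _ = 2 ^ n * (‖ξ‖ ^ 0 * ‖F j ξ‖ + ‖ξ‖ ^ n * ‖F j ξ‖) := by ring
      _ ≤ 2 ^ n * 2 := by
        gcongr
        linarith [h0 ξ hξ, hn ξ hξ]
    rw [norm_mul, mul_assoc]
    refine mul_le_mul (hmC ξ) ?_ (norm_nonneg _) hC
    rwa [Real.rpow_neg (by positivity), Real.rpow_natCast, ← div_eq_mul_inv,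
      le_div_iff₀ (by positivity), mul_comm]
  have pointwise (ξ : V) : Tendsto (fun j => m ξ * F j ξ) atTop (𝓝 0) := by
    by_cases hξ : m ξ = 0
    · simp [hξ]
    · have F_tendsto : Tendsto (fun j => F j ξ) atTop (𝓝 0) := by
        refine Metric.nhds_basis_closedBall.tendsto_right_iff.2 fun ε hε => ?_
        filter_upwards [hF 0 ε hε] with j hj
        simpa using hj ξ hξ
      simpa using F_tendsto.const_mul (m ξ)
  simpa using tendsto_integral_filter_of_dominated_convergence _
    (Eventually.of_forall fun j => hm.mul (hFm j)) (bound.mono fun j hj => ae_of_all _ hj)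
    ((Measure.integrable_pow_neg_integrablePower μ).const_mul _) (ae_of_all _ pointwise)

omit [MeasurableSpace W] [BorelSpace W] in
theorem IsTest.exists_pushFourierInv_decay {φ : E → ℂ} (hφ : IsTest φ) (D : E →L[ℝ] W) {c : ℝ}
    (hc : 0 < c) (N : ℕ) :
    ∃ C, 0 ≤ C ∧ ∀ ξ, c * ‖ξ‖ < ‖D.adjoint ξ‖ → ‖ξ‖ ^ N * ‖pushFourierInv D φ ξ‖ ≤ C := by
  obtain ⟨C, hC0, hC⟩ := hφ.exists_fourier_decay N
  refine ⟨c⁻¹ ^ N * C, by positivity, fun ξ hξ => ?_⟩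
  have norm_le : ‖ξ‖ ≤ c⁻¹ * (1 + ‖-(D.adjoint ξ)‖) := by
    rw [norm_neg, inv_mul_eq_div, le_div_iff₀ hc]
    linarith
  calc ‖ξ‖ ^ N * ‖pushFourierInv D φ ξ‖
      ≤ (c⁻¹ * (1 + ‖-(D.adjoint ξ)‖)) ^ N * ‖pushFourierInv D φ ξ‖ := by gcongr
    _ = c⁻¹ ^ N * ((1 + ‖-(D.adjoint ξ)‖) ^ N * ‖𝓕 φ (-(D.adjoint ξ))‖) := by
        rw [mul_pow, mul_assoc, pushFourierInv]
    _ ≤ c⁻¹ ^ N * C := mul_le_mul_of_nonneg_left (hC _) (by positivity)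

/- On the Fourier side, the integral splits into the frequencies near the conormals of the range of
`D`, where `H j` decays, and the others, where the transform of `φ` does. -/
theorem tendsto_integral_mul_comp (D : E →L[ℝ] W) {c : ℝ} (hc : 0 < c) {H : ℕ → W → ℂ}
    (hH : ∀ j, IsTest (H j)) {χ : W → ℂ} (hχ : IsTest χ) (hχH : ∀ j w, H j w * χ w = H j w)
    (hweak : ∀ ψ, IsTest ψ → Tendsto (fun j => ∫ w, H j w * ψ w) atTop (𝓝 0))
    (hdecay : ∀ (N : ℕ) (ε : ℝ), 0 < ε → ∀ᶠ j in atTop, ∀ ξ, ‖D.adjoint ξ‖ ≤ c * ‖ξ‖ →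
      ‖ξ‖ ^ N * ‖𝓕 (H j) ξ‖ ≤ ε) {φ : E → ℂ} (hφ : IsTest φ) :
    Tendsto (fun j => ∫ x, φ x * H j (D x)) atTop (𝓝 0) := by
  let m : W → ℂ := pushFourierInv D φ
  let A : Set W := {ξ | ‖D.adjoint ξ‖ ≤ c * ‖ξ‖}
  have hA : MeasurableSet A := (isClosed_le (by fun_prop) (by fun_prop)).measurableSet
  have hm : AEStronglyMeasurable m :=
    (hφ.continuous_fourier.comp D.adjoint.continuous.neg).aestronglyMeasurable
  obtain ⟨C₀, -, hC₀⟩ := hφ.exists_fourier_decay 0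
  have norm_m_le (ξ : W) : ‖m ξ‖ ≤ C₀ := by
    simpa [m, pushFourierInv] using hC₀ (-(D.adjoint ξ))
  have far_decay (N : ℕ) : ∃ C, ∀ ξ, ‖ξ‖ ^ N * ‖Aᶜ.indicator m ξ‖ ≤ C := by
    obtain ⟨C, hC0, hC⟩ := hφ.exists_pushFourierInv_decay D hc N
    refine ⟨C, fun ξ => ?_⟩
    by_cases hξ : ξ ∈ A
    · simpa [hξ] using hC0
    · simpa [hξ] using hC ξ (not_le.1 hξ)
  have far := tendsto_integral_mul_fourier_of_decay (hm.indicator hA.compl) far_decay hH hχ hχH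
    hweak
  have near := tendsto_integral_mul_of_decay (hm.indicator hA)
    (fun ξ => (norm_indicator_le_norm_self _ _).trans (norm_m_le ξ))
    (fun j => (hH j).continuous_fourier.aestronglyMeasurable)
    fun N ε hε => (hdecay N ε hε).mono fun j hj ξ hξ =>
      hj ξ (show ξ ∈ A from mem_of_indicator_ne_zero hξ)
  have integrable_indicator (j : ℕ) {s : Set W} (hs : MeasurableSet s) :
      Integrable fun ξ => s.indicator m ξ * 𝓕 (H j) ξ :=
    (hH j).integrable_fourier.bdd_mul (hm.indicator hs)
      (ae_of_all _ fun ξ => (norm_indicator_le_norm_self _ _).trans (norm_m_le ξ))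
  have sum := near.add far
  rw [add_zero] at sum
  refine sum.congr fun j => ?_
  rw [← integral_add (integrable_indicator j hA) (integrable_indicator j hA.compl),
    integral_mul_comp_eq_integral_pushFourierInv D hφ (hH j)]
  refine integral_congr_ae (ae_of_all _ fun ξ => ?_)
  beta_reduce
  rw [← add_mul, ← Pi.add_apply, indicator_self_add_compl]

end Fourier

section Cones

variable {E : Type*} [NormedAddCommGroup E] [NormedSpace ℝ E]

theorem IsClosedCone.union {Γ Γ' : Set (E × (E →L[ℝ] ℝ))} (h : IsClosedCone Γ)
    (h' : IsClosedCone Γ') : IsClosedCone (Γ ∪ Γ') where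
  ne_zero p hp := hp.elim (h.ne_zero p) (h'.ne_zero p)
  conic p hp t ht := hp.imp (fun hp => h.conic p hp t ht) fun hp => h'.conic p hp t ht
  closed := by
    rw [union_union_distrib_right]
    exact h.closed.union h'.closed

theorem TendstoIn.mono {Γ Γ' : Set (E × (E →L[ℝ] ℝ))} {U : ℕ → Distr E} {u : Distr E}
    (h : TendstoIn Γ U u) (hΓ : Γ ⊆ Γ') : TendstoIn Γ' U u where
  mem_seq j := (h.mem_seq j).trans hΓ
  mem_limit := h.mem_limit.trans hΓ
  weak := h.weak
  fourier φ V hV hVc hd := h.fourier φ V hV hVc (hd.mono_left hΓ)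

/-- The diagonal map `x ↦ (x, x)` as a continuous linear map. -/
def diagL (E : Type*) [NormedAddCommGroup E] [NormedSpace ℝ E] : E →L[ℝ] E × E :=
  (ContinuousLinearMap.id ℝ E).prod (ContinuousLinearMap.id ℝ E)

/-- The cone of covectors of `E × E` whose restriction to the diagonal is small relative to their
norm: a closed conic neighbourhood of the conormal directions of the diagonal. -/
def nearConormal (E : Type*) [NormedAddCommGroup E] [NormedSpace ℝ E] (c : ℝ) :
    Set (E × E →L[ℝ] ℝ) :=
  {ζ | ‖ζ ∘L diagL E‖ ≤ c * ‖ζ‖}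

theorem isClosed_nearConormal (c : ℝ) : IsClosed (nearConormal E c) :=
  isClosed_le (by fun_prop) (by fun_prop)

theorem isConic_nearConormal (c : ℝ) : IsConic (nearConormal E c) := by
  intro ζ hζ t ht
  rw [nearConormal, mem_ofPred_eq] at hζ ⊢
  rw [ContinuousLinearMap.smul_comp, norm_smul, norm_smul, mul_left_comm]
  exact mul_le_mul_of_nonneg_left hζ (norm_nonneg t)

theorem IsClosedCone.notMem_of_comp_diagL_eq_zero {Γ : Set ((E × E) × (E × E →L[ℝ] ℝ))}
    (hΓ : IsClosedCone Γ) (hd : Disjoint Γ diagonalConormal) {x : E} {ζ : E × E →L[ℝ] ℝ}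
    (hζ : ζ ∘L diagL E = 0) : (diagL E x, ζ) ∉ Γ := fun h =>
  disjoint_left.1 hd h ⟨rfl, hΓ.ne_zero _ h, fun v => DFunLike.congr_fun hζ v⟩

/- The continuous function `‖ζ ∘L diagL E‖` is positive on the compact set of unit covectors of `Γ`
above the diagonal of `K`; the tube lemma makes this uniform. -/
theorem exists_forall_unit_lt_norm_comp_diagL [FiniteDimensional ℝ E]
    {Γ : Set ((E × E) × (E × E →L[ℝ] ℝ))} (hΓ : IsClosedCone Γ) (hd : Disjoint Γ diagonalConormal)
    {K : Set E} (hK : IsCompact K) : ∃ U : Set (E × E), IsOpen U ∧ diagL E '' K ⊆ U ∧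
      ∃ c : ℝ, 0 < c ∧ ∀ z ∈ U, ∀ ζ, ‖ζ‖ = 1 → (z, ζ) ∈ Γ → c < ‖ζ ∘L diagL E‖ := by
  let good : Set ((ℝ × (E × E)) × (E × E →L[ℝ] ℝ)) :=
    (fun q => (q.1.2, q.2)) ⁻¹' (Γ ∪ {p | p.2 = 0})ᶜ ∪ {q | q.1.1 < ‖q.2 ∘L diagL E‖}
  have isOpen_good : IsOpen good :=
    (hΓ.closed.isOpen_compl.preimage (by fun_prop)).union
      (isOpen_lt (continuous_fst.comp continuous_fst) (by fun_prop))
  have subset_good : ({(0 : ℝ)} ×ˢ (diagL E '' K)) ×ˢ Metric.sphere 0 1 ⊆ good := by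
    rintro ⟨⟨t, z⟩, ζ⟩ ⟨⟨ht, x, -, hx⟩, hζ⟩
    obtain rfl : t = 0 := ht
    obtain rfl : diagL E x = z := hx
    by_cases hζ0 : ζ ∘L diagL E = 0
    · exact Or.inl (not_or.2 ⟨hΓ.notMem_of_comp_diagL_eq_zero hd hζ0,
        norm_ne_zero_iff.1 (by simp [mem_sphere_zero_iff_norm.1 hζ])⟩)
    · exact Or.inr (norm_pos_iff.2 hζ0)
  obtain ⟨V, S, hV, -, hKV, hS, hVS⟩ := generalized_tube_lemma
    (isCompact_singleton.prod (hK.image (diagL E).continuous)) (isCompact_sphere _ _)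
    isOpen_good subset_good
  obtain ⟨I, U, hI, hU, h0I, hKU, hIU⟩ := generalized_tube_lemma
    isCompact_singleton (hK.image (diagL E).continuous) hV hKV
  obtain ⟨c, hc, hcI⟩ := (hI.eventually_mem (h0I rfl)).exists_gt
  refine ⟨U, hU, hKU, c, hc, fun z hz ζ hζ hzζ => ?_⟩
  have mem_good : ((c, z), ζ) ∈ good :=
    hVS ⟨hIU ⟨hcI, hz⟩, hS (mem_sphere_zero_iff_norm.2 hζ)⟩
  exact mem_good.resolve_left fun h => h (Or.inl hzζ)

theorem exists_disjoint_nearConormal [FiniteDimensional ℝ E]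
    {Γ : Set ((E × E) × (E × E →L[ℝ] ℝ))} (hΓ : IsClosedCone Γ) (hd : Disjoint Γ diagonalConormal)
    {K : Set E} (hK : IsCompact K) : ∃ U : Set (E × E), IsOpen U ∧ diagL E '' K ⊆ U ∧
      ∃ c : ℝ, 0 < c ∧ Disjoint Γ (U ×ˢ nearConormal E c) := by
  obtain ⟨U, hU, hKU, c, hc, lt_norm⟩ := exists_forall_unit_lt_norm_comp_diagL hΓ hd hK
  refine ⟨U, hU, hKU, c, hc, disjoint_left.2 ?_⟩
  rintro ⟨z, ζ⟩ hzζ ⟨hz, hζ : ‖ζ ∘L diagL E‖ ≤ c * ‖ζ‖⟩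
  have hpos : 0 < ‖ζ‖ := norm_pos_iff.2 (hΓ.ne_zero _ hzζ)
  have lt := lt_norm z hz (‖ζ‖⁻¹ • ζ) (by simp [norm_smul, hpos.ne'])
    (hΓ.conic _ hzζ _ (inv_pos.2 hpos))
  rw [ContinuousLinearMap.smul_comp, norm_smul, norm_inv, norm_norm, inv_mul_eq_div,
    lt_div_iff₀ hpos] at lt
  exact lt.not_ge hζ

end Cones

section Weak

variable {E : Type*} [NormedAddCommGroup E] [NormedSpace ℝ E]

theorem TendstoIn.tendsto_pair {Γ : Set (E × (E →L[ℝ] ℝ))} {U : ℕ → Distr E} {u : Distr E}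
    (h : TendstoIn Γ U u) {ψ : E → ℂ} (hψ : IsTest ψ) :
    Tendsto (fun j => pair (U j) ψ) atTop (𝓝 (pair u ψ)) := by
  simp_rw [pair_eq _ hψ]
  exact (h.weak _).add ((h.weak _).const_mul _)

theorem TendstoIn.eventually_norm_localFourier_sub_le {Γ : Set (E × (E →L[ℝ] ℝ))}
    {U U' : ℕ → Distr E} {u : Distr E} (h : TendstoIn Γ U u) (h' : TendstoIn Γ U' u) {φ : Test E}
    {V : Set (E →L[ℝ] ℝ)} (hV : IsClosed V) (hV' : IsConic V) (hd : Disjoint Γ (tsupport φ ×ˢ V))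
    (N : ℕ) {ε : ℝ} (hε : 0 < ε) : ∀ᶠ j in atTop, ∀ ξ ∈ V,
      ‖ξ‖ ^ N * ‖localFourier (U j) φ ξ - localFourier (U' j) φ ξ‖ ≤ ε := by
  filter_upwards [h.fourier φ V hV hV' hd N (ε / 2) (half_pos hε),
    h'.fourier φ V hV hV' hd N (ε / 2) (half_pos hε)] with j hj hj' ξ hξ
  calc ‖ξ‖ ^ N * ‖localFourier (U j) φ ξ - localFourier (U' j) φ ξ‖
      ≤ ‖ξ‖ ^ N * (‖localFourier (U j) φ ξ - localFourier u φ ξ‖ +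
          ‖localFourier (U' j) φ ξ - localFourier u φ ξ‖) := by
        gcongr
        rw [norm_sub_rev (localFourier (U' j) φ ξ)]
        exact norm_sub_le_norm_sub_add_norm_sub _ _ _
    _ ≤ ε := by
        rw [mul_add]
        linarith [hj ξ hξ, hj' ξ hξ]

variable [MeasureSpace E] [BorelSpace E] [IsLocallyFiniteMeasure (volume : Measure E)]

theorem pair_ofFunction_sub {w w' : E → ℂ} (hw : ContDiff ℝ ∞ w) (hw' : ContDiff ℝ ∞ w')
    {ψ : E → ℂ} (hψ : IsTest ψ) :
    pair (ofFunction w) ψ - pair (ofFunction w') ψ = ∫ z, ψ z * (w z - w' z) := by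
  rw [pair_ofFunction hw.continuous hψ, pair_ofFunction hw'.continuous hψ,
    ← integral_sub (hψ.mul hw).integrable (hψ.mul hw').integrable]
  simp only [mul_sub]

end Weak

section Restriction

open scoped FourierTransform InnerProductSpace

variable {E : Type*} [NormedAddCommGroup E] [InnerProductSpace ℝ E]

/-- The diagonal map into the `L²` product, which is the inner product space whose Fourier
transform is used on `E × E`. -/
def diagLp (E : Type*) [NormedAddCommGroup E] [InnerProductSpace ℝ E] :
    E →L[ℝ] WithLp 2 (E × E) :=
  (WithLp.prodContinuousLinearEquiv 2 ℝ E E).symm.toContinuousLinearMap ∘L diagL E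

/-- The covector `z ↦ 2π ⟪ξ, z⟫` on `E × E`, which translates the frequencies of the Fourier
transform of the `L²` product into those of `localFourier`. -/
def frequency (ξ : WithLp 2 (E × E)) : E × E →L[ℝ] ℝ :=
  (2 * Real.pi) • ((innerSL ℝ ξ) ∘L
    (WithLp.prodContinuousLinearEquiv 2 ℝ E E).symm.toContinuousLinearMap)

theorem frequency_ofLp (ξ q : WithLp 2 (E × E)) :
    frequency ξ (WithLp.ofLp q) = 2 * Real.pi * ⟪ξ, q⟫_ℝ :=
  rfl

theorem two_pi_mul_norm_le_norm_frequency (ξ : WithLp 2 (E × E)) :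
    2 * Real.pi * ‖ξ‖ ≤ ‖frequency ξ‖ := by
  rcases eq_or_ne ξ 0 with rfl | hξ
  · rw [norm_zero, mul_zero]
    positivity
  have norm_ofLp_le : ‖WithLp.ofLp ξ‖ ≤ ‖ξ‖ := by
    simpa using (WithLp.prod_lipschitzWith_ofLp 2 E E).norm_le_mul rfl ξ
  refine le_of_mul_le_mul_right ?_ (norm_pos_iff.2 hξ)
  calc 2 * Real.pi * ‖ξ‖ * ‖ξ‖ = frequency ξ (WithLp.ofLp ξ) := by
        rw [frequency_ofLp, real_inner_self_eq_norm_sq]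
        ring
    _ ≤ ‖frequency ξ‖ * ‖WithLp.ofLp ξ‖ :=
        (le_abs_self _).trans ((frequency ξ).le_opNorm _)
    _ ≤ ‖frequency ξ‖ * ‖ξ‖ := by gcongr

variable [FiniteDimensional ℝ E]

theorem norm_frequency_comp_diagL (ξ : WithLp 2 (E × E)) :
    ‖frequency ξ ∘L diagL E‖ = 2 * Real.pi * ‖(diagLp E).adjoint ξ‖ := by
  have comp_eq : frequency ξ ∘L diagL E = (2 * Real.pi) • innerSL ℝ ((diagLp E).adjoint ξ) := by
    ext v
    have apply_eq : (frequency ξ ∘L diagL E) v = 2 * Real.pi * ⟪ξ, diagLp E v⟫_ℝ := rfl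
    rw [apply_eq, ← ContinuousLinearMap.adjoint_inner_left]
    rfl
  rw [comp_eq, norm_smul, innerSL_apply_norm, Real.norm_of_nonneg (by positivity)]

theorem frequency_mem_nearConormal {c : ℝ} (hc : 0 ≤ c) {ξ : WithLp 2 (E × E)}
    (hξ : ‖(diagLp E).adjoint ξ‖ ≤ c * ‖ξ‖) : frequency ξ ∈ nearConormal E c := calc
  ‖frequency ξ ∘L diagL E‖ = 2 * Real.pi * ‖(diagLp E).adjoint ξ‖ := norm_frequency_comp_diagL ξ
  _ ≤ c * (2 * Real.pi * ‖ξ‖) := by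
    rw [mul_left_comm]
    gcongr
  _ ≤ c * ‖frequency ξ‖ := by
    gcongr
    exact two_pi_mul_norm_le_norm_frequency ξ

variable [MeasurableSpace E] [BorelSpace E]

theorem integral_comp_ofLp (F : E × E → ℂ) :
    ∫ q : WithLp 2 (E × E), F (WithLp.ofLp q) = ∫ z, F z :=
  (WithLp.volume_preserving_symm_measurableEquiv_toLp_prod E E).integral_comp' F

theorem fourier_comp_ofLp (F : E × E → ℂ) (ξ : WithLp 2 (E × E)) :
    𝓕 (fun q : WithLp 2 (E × E) => F (WithLp.ofLp q)) ξ =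
      ∫ z, F z * expChar (frequency ξ) z := by
  rw [← integral_comp_ofLp, Real.fourier_eq']
  refine integral_congr_ae (ae_of_all _ fun q => ?_)
  simp only [expChar, frequency_ofLp, smul_eq_mul, real_inner_comm ξ q]
  push_cast
  ring_nf

theorem TendstoIn.eventually_norm_fourier_sub_le {Γ : Set ((E × E) × (E × E →L[ℝ] ℝ))}
    {T : Distr (E × E)} {w w' : ℕ → E × E → ℂ} (hw : ∀ j, ContDiff ℝ ∞ (w j))
    (hw' : ∀ j, ContDiff ℝ ∞ (w' j)) (h : TendstoIn Γ (fun j => ofFunction (w j)) T)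
    (h' : TendstoIn Γ (fun j => ofFunction (w' j)) T) {c : ℝ} (hc : 0 ≤ c) {Φ : E × E → ℝ}
    (hΦ : IsTest Φ) (hd : Disjoint Γ (tsupport Φ ×ˢ nearConormal E c)) (N : ℕ) {ε : ℝ}
    (hε : 0 < ε) : ∀ᶠ j in atTop, ∀ ξ, ‖(diagLp E).adjoint ξ‖ ≤ c * ‖ξ‖ →
      ‖ξ‖ ^ N * ‖𝓕 (fun q : WithLp 2 (E × E) => (Φ (WithLp.ofLp q) : ℂ) *
        (w j (WithLp.ofLp q) - w' j (WithLp.ofLp q))) ξ‖ ≤ ε := by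
  filter_upwards [h.eventually_norm_localFourier_sub_le h' (φ := toTest Φ hΦ)
    (isClosed_nearConormal c) (isConic_nearConormal c) hd N hε] with j hj ξ hξ
  have norm_le : ‖ξ‖ ≤ ‖frequency ξ‖ := by
    nlinarith [two_pi_mul_norm_le_norm_frequency ξ, Real.pi_gt_three, norm_nonneg ξ]
  have fourier_eq : 𝓕 (fun q : WithLp 2 (E × E) => (Φ (WithLp.ofLp q) : ℂ) *
      (w j (WithLp.ofLp q) - w' j (WithLp.ofLp q))) ξ =
        localFourier (ofFunction (w j)) (toTest Φ hΦ) (frequency ξ) -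
          localFourier (ofFunction (w' j)) (toTest Φ hΦ) (frequency ξ) := by
    simp only [localFourier_eq_pair, toTest_apply]
    rw [pair_ofFunction_sub (hw j) (hw' j) (hΦ.ofReal.mul (contDiff_expChar _)),
      fourier_comp_ofLp fun z => (Φ z : ℂ) * (w j z - w' j z)]
    simp only [mul_right_comm]
  rw [fourier_eq]
  exact (mul_le_mul_of_nonneg_right (pow_le_pow_left₀ (norm_nonneg _) norm_le N)
    (norm_nonneg _)).trans (hj _ (frequency_mem_nearConormal hc hξ))

theorem TendstoIn.tendsto_integral_cutoff_sub {Γ : Set ((E × E) × (E × E →L[ℝ] ℝ))}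
    {T : Distr (E × E)} {w w' : ℕ → E × E → ℂ} (hw : ∀ j, ContDiff ℝ ∞ (w j))
    (hw' : ∀ j, ContDiff ℝ ∞ (w' j)) (h : TendstoIn Γ (fun j => ofFunction (w j)) T)
    (h' : TendstoIn Γ (fun j => ofFunction (w' j)) T) {Φ : E × E → ℂ} (hΦ : IsTest Φ)
    {ψ : WithLp 2 (E × E) → ℂ} (hψ : IsTest ψ) :
    Tendsto (fun j => ∫ q : WithLp 2 (E × E), Φ (WithLp.ofLp q) *
      (w j (WithLp.ofLp q) - w' j (WithLp.ofLp q)) * ψ q) atTop (𝓝 0) := by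
  let e := WithLp.prodContinuousLinearEquiv 2 ℝ E E
  have hψe := hΦ.mul (hψ.comp_equiv e.symm).smooth
  have tendsto_sub := (h.tendsto_pair hψe).sub (h'.tendsto_pair hψe)
  rw [sub_self] at tendsto_sub
  refine tendsto_sub.congr fun j => ?_
  rw [pair_ofFunction_sub (hw j) (hw' j) hψe, ← integral_comp_ofLp]
  refine integral_congr_ae (ae_of_all _ fun q => ?_)
  exact mul_right_comm _ _ _

theorem TendstoIn.tendsto_integral_diagonal {Γ : Set ((E × E) × (E × E →L[ℝ] ℝ))}
    (hΓ : IsClosedCone Γ) (hd : Disjoint Γ diagonalConormal) {T : Distr (E × E)}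
    {w w' : ℕ → E × E → ℂ} (hw : ∀ j, ContDiff ℝ ∞ (w j)) (hw' : ∀ j, ContDiff ℝ ∞ (w' j))
    (h : TendstoIn Γ (fun j => ofFunction (w j)) T)
    (h' : TendstoIn Γ (fun j => ofFunction (w' j)) T) {φ : E → ℂ} (hφ : IsTest φ) :
    Tendsto (fun j => ∫ x, φ x * (w j (x, x) - w' j (x, x))) atTop (𝓝 0) := by
  obtain ⟨U, hU, hKU, c, hc, hdc⟩ := exists_disjoint_nearConormal hΓ hd hφ.compact.isCompact
  obtain ⟨Φ, hΦ, hΦU, Φ_eq_one⟩ := exists_isTest_eq_one_nhdsSet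
    (hφ.compact.isCompact.image (diagL E).continuous) hU hKU
  obtain ⟨X, hX, -, X_eq_one⟩ := exists_isTest_eq_one_nhdsSet hΦ.compact.isCompact isOpen_univ
    (subset_univ _)
  let e := WithLp.prodContinuousLinearEquiv 2 ℝ E E
  have isTest_cutoff (j : ℕ) : IsTest fun z => (Φ z : ℂ) * (w j z - w' j z) :=
    hΦ.ofReal.mul ((hw j).sub (hw' j))
  have cutoff_mul (j : ℕ) (z : E × E) :
      (Φ z : ℂ) * (w j z - w' j z) * (X z : ℂ) = Φ z * (w j z - w' j z) := by
    by_cases hz : z ∈ tsupport Φ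
    · simp [X_eq_one.self_of_nhdsSet z hz]
    · simp [image_eq_zero_of_notMem_tsupport hz]
  have tendsto_cutoff := tendsto_integral_mul_comp (diagLp E) hc
    (fun j => (isTest_cutoff j).comp_equiv e) (hX.ofReal.comp_equiv e) (fun j q => cutoff_mul j _)
    (fun ψ hψ => tendsto_integral_cutoff_sub hw hw' h h' hΦ.ofReal hψ)
    (fun N ε hε => eventually_norm_fourier_sub_le hw hw' h h' hc.le hΦ
      (hdc.mono_right (prod_mono_left hΦU)) N hε) hφ
  refine tendsto_cutoff.congr fun j => integral_congr_ae (ae_of_all _ fun x => ?_)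
  have diag_eq : e (diagLp E x) = (x, x) := rfl
  simp only [diag_eq]
  by_cases hx : x ∈ tsupport φ
  · simp [Φ_eq_one.self_of_nhdsSet (x, x) ⟨x, hx, rfl⟩]
  · simp [image_eq_zero_of_notMem_tsupport hx]

end Restriction

section CanonicalProduct

variable {E : Type*} [NormedAddCommGroup E] [InnerProductSpace ℝ E] [FiniteDimensional ℝ E]
  [MeasurableSpace E] [BorelSpace E]

omit [FiniteDimensional ℝ E] [MeasurableSpace E] [BorelSpace E] in
theorem contDiff_diagonal {w : E × E → ℂ} (hw : ContDiff ℝ ∞ w) :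
    ContDiff ℝ ∞ fun x => w (x, x) :=
  hw.comp (contDiff_id.prodMk contDiff_id)

theorem ofFunction_diagonal_apply {w : E × E → ℂ} (hw : ContDiff ℝ ∞ w) (φ : Test E) :
    ofFunction (fun x => w (x, x)) φ = ∫ x, (φ x : ℂ) * w (x, x) := by
  rw [← pair_ofReal, pair_ofFunction (contDiff_diagonal hw).continuous (isTest_test φ).ofReal]

/- Two approximating sequences for different admissible cones are both admitted by the union of the
cones, so that their restrictions to the diagonal have the same limit. -/
theorem isDiagonalPullback_of_tendsto {T : Distr (E × E)} {Γ : Set ((E × E) × (E × E →L[ℝ] ℝ))}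
    (hΓ : IsAdmissible T Γ) {w : ℕ → E × E → ℂ} (hw : ∀ j, ContDiff ℝ ∞ (w j))
    (hwT : TendstoIn Γ (fun j => ofFunction (w j)) T) {p : Distr E}
    (hp : ∀ φ : Test E,
      Tendsto (fun j => ofFunction (fun x => w j (x, x)) φ) atTop (𝓝 (p φ))) :
    IsDiagonalPullback T p := by
  refine ⟨⟨Γ, hΓ, w, hw, hwT⟩, fun Γ' hΓ' w' hw' hwT' φ => ?_⟩
  have hφ := (isTest_test φ).ofReal
  have tendsto_sub := TendstoIn.tendsto_integral_diagonal (hΓ'.1.union hΓ.1)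
    (disjoint_union_left.2 ⟨hΓ'.2.1, hΓ.2.1⟩) hw' hw (hwT'.mono subset_union_left)
    (hwT.mono subset_union_right) hφ
  have tendsto_add := tendsto_sub.add (hp φ)
  rw [zero_add] at tendsto_add
  refine tendsto_add.congr fun j => ?_
  rw [ofFunction_diagonal_apply (hw j), ofFunction_diagonal_apply (hw' j), ← integral_add
    (hφ.mul ((contDiff_diagonal (hw' j)).sub (contDiff_diagonal (hw j)))).integrable
    (hφ.mul (contDiff_diagonal (hw j))).integrable]
  simp only [mul_sub, sub_add_cancel]

theorem IsDiagonalPullback.unique {T : Distr (E × E)} {p q : Distr E}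
    (hp : IsDiagonalPullback T p) (hq : IsDiagonalPullback T q) : p = q := by
  obtain ⟨Γ, hΓ, w, hw, hwT⟩ := hp.1
  exact DFunLike.ext p q fun φ =>
    tendsto_nhds_unique (hp.2 Γ hΓ w hw hwT φ) (hq.2 Γ hΓ w hw hwT φ)

theorem IsCanonicalProduct.unique {f g p q : Distr E} (hp : IsCanonicalProduct f g p)
    (hq : IsCanonicalProduct f g q) : p = q := by
  obtain ⟨T, hT, hTp⟩ := hp
  obtain ⟨T', hT', hTq⟩ := hq
  obtain rfl := hT.unique hT'
  exact hTp.unique hTq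

theorem isAdmissible_tensorCone (f g : Distr E)
    (hfg : singularSupport f ∩ singularSupport g = ∅) :
    IsAdmissible (tensorDistr f g) (tensorCone (singularSupport f) (singularSupport g)) :=
  ⟨isClosedCone_tensorCone (isClosed_singularSupport f) (isClosed_singularSupport g),
    disjoint_tensorCone_diagonalConormal hfg, waveFrontSet_tensorDistr_subset f g⟩

theorem exists_isCanonicalProduct (f g : Distr E)
    (hfg : singularSupport f ∩ singularSupport g = ∅) :
    ∃ p, IsCanonicalProduct f g p ∧ ∃ m₁ m₂ : E → ℂ, ContDiff ℝ ∞ m₁ ∧ ContDiff ℝ ∞ m₂ ∧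
      ∀ ψ, IsTest ψ →
        pair p ψ = pair g (fun x => ψ x * m₁ x) + pair f (fun x => ψ x * m₂ x) := by
  obtain ⟨p, m₁, m₂, hm₁, hm₂, hp, tendsto_p⟩ := exists_tendsto_integral_mollify_mul_mollify f g
    (disjoint_iff_inter_eq_empty.2 hfg)
  obtain ⟨R, hR⟩ := exists_isMollifier E
  have contDiff_mollify_prod (j : ℕ) := contDiff_mollify (tensorDistr f g) (hR.prod.test j)
  refine ⟨p, ⟨tensorDistr f g, isTensorProduct_tensorDistr f g, isDiagonalPullback_of_tendsto
    (isAdmissible_tensorCone f g hfg) contDiff_mollify_prod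
    (tendstoIn_mollify_tensorDistr f g hR.prod) fun φ => ?_⟩, m₁, m₂, hm₁, hm₂, hp⟩
  rw [← pair_ofReal]
  refine (tendsto_p R hR _ (isTest_test φ).ofReal).congr fun j => ?_
  rw [ofFunction_diagonal_apply (contDiff_mollify_prod j),
    (isTensorProduct_tensorDistr f g).mollify_eq (hR.test j)]

end CanonicalProduct

end

end HolderProduct

theorem mainTheorem7 (d : ℕ) (α β : ℝ) (hα : α < 0) (hβ : β < 0)
    (f g : HolderProduct.Distr (EuclideanSpace ℝ (Fin d)))
    (hf : f ∈ HolderProduct.negHolderLoc d α) (hg : g ∈ HolderProduct.negHolderLoc d β)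
    (hfg : HolderProduct.singularSupport f ∩ HolderProduct.singularSupport g = ∅) :
    ∃ p : HolderProduct.Distr (EuclideanSpace ℝ (Fin d)),
      HolderProduct.IsCanonicalProduct f g p ∧
      (∀ q : HolderProduct.Distr (EuclideanSpace ℝ (Fin d)),
        HolderProduct.IsCanonicalProduct f g q → q = p) ∧
      p ∈ HolderProduct.negHolderLoc d (α + β) := by
  obtain ⟨p, hp, m₁, m₂, hm₁, hm₂, pair_p⟩ := HolderProduct.exists_isCanonicalProduct f g hfg
  exact ⟨p, hp, fun q hq => hq.unique hp, HolderProduct.mem_negHolderLoc_of_pair hf hg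
    (by linarith) (by linarith) hm₁ hm₂ pair_p⟩
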